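/- **Setting.** Let $(\overline M,\overline\varphi,\overline\xi,\overline\eta,\overline g)$ be an almost contact B-metric manifold of dimension $2n+1$, $n\ge 2$: $\overline g$ is a semi-Riemannian metric, $\overline\varphi^2=-\mathrm{Id}+\overline\eta\otimes\overline\xi$, $\overline\eta(\overline\xi)=1$ and $\overline g(\overline\varphi X,\overline\varphi Y)=-\overline g(X,Y)+\overline\eta(X)\overline\eta(Y)$. Let $\overline\nabla$ be the Levi-Civita connection of $\overline g$ and assume that $\overline M$ is an $\mathcal F_0$-manifold, i.e. $\overline\nabla\,\overline\varphi=0$. Let $\overline{\widetilde g}(X,Y)=\overline g(X,\overline\varphi Y)+\overline\eta(X)\overline\eta(Y)$ be the associated metric. Curvature tensors are $R(X,Y,Z)=\nabla_X\nabla_YZ-\nabla_Y\nabla_XZ-\nabla_{[X,Y]}Z$, and $Ric(Y,Z)=\mathrm{trace}\{X\mapsto R(X,Y,Z)\}$. Assume that $\overline M$ has pointwise constant totally real sectional curvatures $\overline\nu(p),\overline{\widetilde\nu}(p)$: for every $p\in\overline M$ and every $\overline g$-non-degenerate plane $\alpha=\mathrm{span}\{x,y\}\subset T_p\overline M$ that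 is orthogonal to $\overline\xi$ and satisfies $\overline\varphi\alpha\perp\alpha$ (with respect to $\overline g$), $$\frac{\overline g(\overline R(x,y,y),x)}{\overline g(x,x)\overline g(y,y)-\overline g(x,y)^2}=\overline\nu(p),\qquad \frac{\overline{\widetilde g}(\overline{\widetilde R}(x,y,y),x)}{\overline g(x,x)\overline g(y,y)-\overline g(x,y)^2}=\overline{\widetilde\nu}(p),$$ where $\overline R,\overline{\widetilde R}$ are the curvature tensors of the Levi-Civita connections of $\overline g,\overline{\widetilde g}$. Let $(M,g)$ be a half lightlike submanifold of $(\overline M,\overline g)$: an immersed submanifold of codimension two, with induced metric $g$, whose radical distribution $\mathrm{Rad}(TM)=TM\cap TM^\perp$ has rank one. Let $\xi$ be a nowhere zero section of $\mathrm{Rad}(TM)$, $S(TM)$ a screen distribution ($TM=\mathrm{Rad}(TM)\perp S(TM)$), $S(TM^\perp)=\mathrm{span}\{L\}$ with $\overline g(L,L)=\pm1$ a screen transversal bundle ($TM^\perp=\mathrm{Rad}(TM)\perp S(TM^\perp)$), and $\mathrm{ltr}(TM)=\mathrm{span}\{N\}$ the lightlike transversal bundle, where $\overline g(N,\xi)=1$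 and $\overline g(N,N)=\overline g(N,L)=\overline g(N,X)=0$ for all $X\in S(TM)$. Let $P$ be the projection of $TM$ onto $S(TM)$ along $\mathrm{Rad}(TM)$, $\eta(X)=\overline g(X,N)$ and $\mu=\overline\eta(\xi)$. Assume that $M$ is - radical screen transversal: $\overline\varphi(\mathrm{Rad}(TM))=S(TM^\perp)$; - ascreen: $\overline\xi\in\mathrm{Rad}(TM)\oplus\mathrm{ltr}(TM)$ along $M$; - screen totally umbilical: there is a smooth function $\gamma$ on $M$ with $C(X,PY)=\gamma\,g(X,Y)$ for all tangent $X,Y$, where $C(X,PY)$ is the coefficient of $\xi$ in $\nabla_XPY=\nabla^*_XPY+C(X,PY)\xi$ with $\nabla^*_XPY\in S(TM)$, and $\nabla_XY$ is the $TM$-component of $\overline\nabla_XY$ with respect to $T\overline M=TM\oplus\mathrm{span}\{N,L\}$. **Proposition.** The curvature tensor $\widetilde R$ and the Ricci tensor $\widetilde{Ric}$ of the semi-Riemannian submanifold $(M,\widetilde g)$, where $\widetilde g$ is the metric induced on $M$ by $\overline{\widetilde g}$, are given, for all $X,Y,Z$ tangent to $M$, by $$\begin{aligned}\widetilde R(X,Y,Z)={}&[(\overline\nu-4\mu^2\gamma^2)g(Y,Z)-4\mu^2\gamma^2\overline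 g(Y,\overline\varphi Z)-\overline\nu\,\overline\eta(Y)\overline\eta(Z)]PX\\&-[(\overline\nu-4\mu^2\gamma^2)g(X,Z)-4\mu^2\gamma^2\overline g(X,\overline\varphi Z)-\overline\nu\,\overline\eta(X)\overline\eta(Z)]PY\\&-(\overline\nu-4\mu^2\gamma^2)\overline g(Y,\overline\varphi Z)\,\overline\varphi(PX)+(\overline\nu-4\mu^2\gamma^2)\overline g(X,\overline\varphi Z)\,\overline\varphi(PY)\\&+\overline\nu\,[\overline g(X,\overline\varphi Z)\eta(Y)-\overline g(Y,\overline\varphi Z)\eta(X)]\,\xi,\end{aligned}$$ $$\widetilde{Ric}(Y,Z)=2(n-2)(\overline\nu-4\mu^2\gamma^2)g(Y,Z)-[\overline\nu+4(2n-3)\mu^2\gamma^2]\,\overline g(Y,\overline\varphi Z)-2(n-1)\,\overline\nu\,\overline\eta(Y)\overline\eta(Z).$$ -/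

import Mathlib

open scoped Manifold ContDiff
open Bundle

noncomputable section

section Connections

variable {E : Type*} [NormedAddCommGroup E] [NormedSpace ℝ E]
  {Q : Type*} [TopologicalSpace Q] [ChartedSpace E Q] [IsManifold 𝓘(ℝ, E) ∞ Q]
  {M : Type*} [TopologicalSpace M]

/-- The vector field `X` on `Q` is smooth at `p`. -/
def SmoothFieldAt (X : Π x : Q, TangentSpace 𝓘(ℝ, E) x) (p : Q) : Prop :=
  ContMDiffAt 𝓘(ℝ, E) (𝓘(ℝ, E).prod 𝓘(ℝ, E)) ∞
    (fun x ↦ (TotalSpace.mk' E x (X x) : TangentBundle 𝓘(ℝ, E) Q)) p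

/-- `W` is a smooth vector field along the map `f : M → Q`: `W p` is tangent to `Q` at `f p`. -/
def SmoothFieldAlong (F : Type*) [NormedAddCommGroup F] [NormedSpace ℝ F] [ChartedSpace F M]
    (f : M → Q) (W : Π p : M, TangentSpace 𝓘(ℝ, E) (f p)) : Prop :=
  ContMDiff 𝓘(ℝ, F) (𝓘(ℝ, E).prod 𝓘(ℝ, E)) ∞
    (fun p ↦ (TotalSpace.mk' E (f p) (W p) : TangentBundle 𝓘(ℝ, E) Q))

variable {F : Type*} [NormedAddCommGroup F] [NormedSpace ℝ F] [ChartedSpace F M]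

/-- The pulled back form `f^* g`: `(f^* g)(v, w) = g (df v) (df w)`. -/
def inducedForm (f : M → Q)
    (g : Π x : Q, TangentSpace 𝓘(ℝ, E) x → TangentSpace 𝓘(ℝ, E) x → ℝ)
    (p : M) (v w : TangentSpace 𝓘(ℝ, F) p) : ℝ :=
  g (f p) (mfderiv 𝓘(ℝ, F) 𝓘(ℝ, E) f p v) (mfderiv 𝓘(ℝ, F) 𝓘(ℝ, E) f p w)

/-- `cov` is a Levi-Civita connection of the semi-Riemannian metric `g`: it is torsion-free,
`∇_X Y - ∇_Y X = [X, Y]`, and metric, `v(g(Y, Z)) = g(∇_v Y, Z) + g(Y, ∇_v Z)`.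
(In Mathlib `cov Y p v` stands for `∇_v Y` at `p`.) -/
structure IsLeviCivita (g : Π x : Q, TangentSpace 𝓘(ℝ, E) x → TangentSpace 𝓘(ℝ, E) x → ℝ)
    (cov : CovariantDerivative 𝓘(ℝ, E) E (TangentSpace 𝓘(ℝ, E) : Q → Type _)) : Prop where
  torsion_free : ∀ (p : Q) (X Y : Π x : Q, TangentSpace 𝓘(ℝ, E) x),
    MDiffAt (T% X) p → MDiffAt (T% Y) p →
      cov Y p (X p) - cov X p (Y p) = VectorField.mlieBracket 𝓘(ℝ, E) X Y p
  metric : ∀ (p : Q) (v : TangentSpace 𝓘(ℝ, E) p) (Y Z : Π x : Q, TangentSpace 𝓘(ℝ, E) x),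
    MDiffAt (T% Y) p → MDiffAt (T% Z) p →
      mvfderiv 𝓘(ℝ, E) (fun x ↦ g x (Y x) (Z x)) p v =
        g p (cov Y p v) (Z p) + g p (Y p) (cov Z p v)

/-- The curvature `R(X, Y, Z) = ∇_X ∇_Y Z - ∇_Y ∇_X Z - ∇_[X, Y] Z` of a connection. -/
def curvature (cov : CovariantDerivative 𝓘(ℝ, E) E (TangentSpace 𝓘(ℝ, E) : Q → Type _))
    (X Y Z : Π x : Q, TangentSpace 𝓘(ℝ, E) x) (p : Q) : TangentSpace 𝓘(ℝ, E) p :=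
  cov (fun x ↦ cov Z x (Y x)) p (X p) - cov (fun x ↦ cov Z x (X x)) p (Y p)
    - cov Z p (VectorField.mlieBracket 𝓘(ℝ, E) X Y p)

/-- The curvature tensor on tangent vectors at `p`, computed on the extensions of the vectors
which are constant in the preferred trivialization of the tangent bundle at `p`. -/
def curvatureAt (cov : CovariantDerivative 𝓘(ℝ, E) E (TangentSpace 𝓘(ℝ, E) : Q → Type _))
    (p : Q) (x y z : TangentSpace 𝓘(ℝ, E) p) : TangentSpace 𝓘(ℝ, E) p :=
  curvature cov (FiberBundle.extend E x) (FiberBundle.extend E y) (FiberBundle.extend E z) p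

/-- The Ricci tensor `Ric(y, z) = trace (x ↦ R(x, y, z))`; the trace is computed in a basis of
`T_p Q`, which is the model space `E` as a vector space. -/
def ricci [FiniteDimensional ℝ E]
    (cov : CovariantDerivative 𝓘(ℝ, E) E (TangentSpace 𝓘(ℝ, E) : Q → Type _))
    (p : Q) (y z : TangentSpace 𝓘(ℝ, E) p) : ℝ :=
  let b : Module.Basis (Fin (Module.finrank ℝ E)) ℝ (TangentSpace 𝓘(ℝ, E) p) :=
    Module.finBasis ℝ E
  ∑ i, b.coord i (curvatureAt cov p (b i) y z)

/-- The covariant derivative `∇_v W` of a vector field `W` along `f : M → Q` in the direction of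
`v ∈ T_p M`, for a connection on `Q` (the pulled back connection): writing `W = ∑ wⁱ (eᵢ ∘ f)` in
the local frame `e` given by the preferred trivialization of `TQ` at `f p`,
`∇_v W = ∑ v(wⁱ) eᵢ + ∑ wⁱ(p) ∇_{df v} eᵢ`. -/
def covAlong (cov : CovariantDerivative 𝓘(ℝ, E) E (TangentSpace 𝓘(ℝ, E) : Q → Type _))
    (f : M → Q) (W : Π p : M, TangentSpace 𝓘(ℝ, E) (f p)) (p : M)
    (v : TangentSpace 𝓘(ℝ, F) p) : TangentSpace 𝓘(ℝ, E) (f p) :=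
  let e := trivializationAt E (TangentSpace 𝓘(ℝ, E) : Q → Type _) (f p)
  e.symm (f p) (mvfderiv 𝓘(ℝ, F) (fun q ↦ (e (TotalSpace.mk' E (f q) (W q))).2) p v)
    + cov (FiberBundle.extend E (W p)) (f p) (mfderiv 𝓘(ℝ, F) 𝓘(ℝ, E) f p v)

end Connections

/-- An almost contact B-metric structure `(φ, ξ, η, g)` on a smooth manifold. -/
structure AlmostContactBMetric (E : Type*) [NormedAddCommGroup E] [NormedSpace ℝ E]
    (Q : Type*) [TopologicalSpace Q] [ChartedSpace E Q] [IsManifold 𝓘(ℝ, E) ∞ Q] where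
  φ : Π x : Q, TangentSpace 𝓘(ℝ, E) x →L[ℝ] TangentSpace 𝓘(ℝ, E) x
  ξ : Π x : Q, TangentSpace 𝓘(ℝ, E) x
  η : Π x : Q, TangentSpace 𝓘(ℝ, E) x →L[ℝ] ℝ
  g : Π x : Q, TangentSpace 𝓘(ℝ, E) x →L[ℝ] TangentSpace 𝓘(ℝ, E) x →L[ℝ] ℝ
  contMDiff_φ : ContMDiff 𝓘(ℝ, E) (𝓘(ℝ, E).prod 𝓘(ℝ, E →L[ℝ] E)) ∞
    (fun x ↦ TotalSpace.mk' (E →L[ℝ] E)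
      (E := fun x : Q ↦ TangentSpace 𝓘(ℝ, E) x →L[ℝ] TangentSpace 𝓘(ℝ, E) x) x (φ x))
  contMDiff_ξ : ∀ p, SmoothFieldAt ξ p
  contMDiff_η : ContMDiff 𝓘(ℝ, E) (𝓘(ℝ, E).prod 𝓘(ℝ, E →L[ℝ] ℝ)) ∞
    (fun x ↦ TotalSpace.mk' (E →L[ℝ] ℝ)
      (E := fun x : Q ↦ TangentSpace 𝓘(ℝ, E) x →L[ℝ] Bundle.Trivial Q ℝ x) x (η x))
  contMDiff_g : ContMDiff 𝓘(ℝ, E) (𝓘(ℝ, E).prod 𝓘(ℝ, E →L[ℝ] E →L[ℝ] ℝ)) ∞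
    (fun x ↦ TotalSpace.mk' (E →L[ℝ] E →L[ℝ] ℝ)
      (E := fun x : Q ↦
        TangentSpace 𝓘(ℝ, E) x →L[ℝ] TangentSpace 𝓘(ℝ, E) x →L[ℝ] Bundle.Trivial Q ℝ x) x (g x))
  φ_φ : ∀ x v, φ x (φ x v) = -v + η x v • ξ x
  η_ξ : ∀ x, η x (ξ x) = 1
  g_symm : ∀ x v w, g x v w = g x w v
  g_nondegenerate : ∀ x v, (∀ w, g x v w = 0) → v = 0
  g_φ_φ : ∀ x v w, g x (φ x v) (φ x w) = -g x v w + η x v * η x w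

namespace AlmostContactBMetric

variable {E : Type*} [NormedAddCommGroup E] [NormedSpace ℝ E]
  {Q : Type*} [TopologicalSpace Q] [ChartedSpace E Q] [IsManifold 𝓘(ℝ, E) ∞ Q]
  (A : AlmostContactBMetric E Q)

/-- The metric `g` as a function of two tangent vectors. -/
def metric (x : Q) (v w : TangentSpace 𝓘(ℝ, E) x) : ℝ := A.g x v w

/-- The associated B-metric `g̃(v, w) = g(v, φ w) + η(v) η(w)`. -/
def assocMetric (x : Q) (v w : TangentSpace 𝓘(ℝ, E) x) : ℝ :=
  A.g x v (A.φ x w) + A.η x v * A.η x w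

/-- The class `F₀`: the tensor `F(v, Y, w) = g((∇_v φ) Y, w)` vanishes, where
`(∇_v φ) Y = ∇_v (φ Y) - φ (∇_v Y)` and `∇` is the Levi-Civita connection of `g`. -/
def IsF0 (cov : CovariantDerivative 𝓘(ℝ, E) E (TangentSpace 𝓘(ℝ, E) : Q → Type _)) : Prop :=
  ∀ (p : Q) (v w : TangentSpace 𝓘(ℝ, E) p) (Y : Π x : Q, TangentSpace 𝓘(ℝ, E) x),
    SmoothFieldAt Y p → A.g p (cov (fun x ↦ A.φ x (Y x)) p v - A.φ p (cov Y p v)) w = 0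

/-- `g(x, x) g(y, y) - g(x, y)²`; it is nonzero exactly when `x`, `y` span a `g`-non-degenerate
section (a two-dimensional plane). -/
def gramDet (p : Q) (x y : TangentSpace 𝓘(ℝ, E) p) : ℝ :=
  A.g p x x * A.g p y y - A.g p x y ^ 2

/-- `x`, `y` span a `g`-non-degenerate section `α` which is totally real (`φ α` is orthogonal to
`α`) and orthogonal to `ξ`. -/
structure IsTotallyRealSection (p : Q) (x y : TangentSpace 𝓘(ℝ, E) p) : Prop where
  nondegenerate : A.gramDet p x y ≠ 0
  totally_real : ∀ v ∈ Submodule.span ℝ {x, y}, ∀ w ∈ Submodule.span ℝ {x, y},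
    A.g p (A.φ p v) w = 0
  orthogonal_ξ : ∀ v ∈ Submodule.span ℝ {x, y}, A.g p v (A.ξ p) = 0

/-- The manifold has pointwise constant totally real sectional curvatures `ν`, `ν'`: for all
non-degenerate totally real sections `α = span {x, y}` at `p` that are orthogonal to `ξ`,
`R(x, y, y, x) / (g(x, x) g(y, y) - g(x, y)²) = ν p` and
`R̃(x, y, y, x) / (g(x, x) g(y, y) - g(x, y)²) = ν' p`, where `R(x, y, z, w) = g(R(x, y, z), w)`
and `R̃(x, y, z, w) = g̃(R̃(x, y, z), w)` are the curvature tensors of the Levi-Civita connections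
`cov` of `g` and `cov'` of the associated metric `g̃`. -/
def HasConstTotallyRealCurvatures
    (cov cov' : CovariantDerivative 𝓘(ℝ, E) E (TangentSpace 𝓘(ℝ, E) : Q → Type _))
    (ν ν' : Q → ℝ) : Prop :=
  ∀ (p : Q) (x y : TangentSpace 𝓘(ℝ, E) p), A.IsTotallyRealSection p x y →
    A.metric p (curvatureAt cov p x y y) x / A.gramDet p x y = ν p ∧
    A.assocMetric p (curvatureAt cov' p x y y) x / A.gramDet p x y = ν' p

end AlmostContactBMetric

section HalfLightlike

variable {E : Type*} [NormedAddCommGroup E] [NormedSpace ℝ E]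
  {Q : Type*} [TopologicalSpace Q] [ChartedSpace E Q] [IsManifold 𝓘(ℝ, E) ∞ Q]
  {M : Type*} [TopologicalSpace M]

/-- The radical subspace `Rad (T_p M) = {v ∈ T_p M : g(v, w) = 0 for all w ∈ T_p M}` of the metric
induced on `M` by `f : M → Q`. -/
def radical (F : Type*) [NormedAddCommGroup F] [NormedSpace ℝ F] [ChartedSpace F M]
    (A : AlmostContactBMetric E Q) (f : M → Q) (p : M) :
    Submodule ℝ (TangentSpace 𝓘(ℝ, F) p) where
  carrier := {v | ∀ w, inducedForm f A.metric p v w = 0}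
  add_mem' := fun {a b} ha hb w ↦ by
    have h1 := ha w
    have h2 := hb w
    simp only [inducedForm, AlmostContactBMetric.metric] at h1 h2 ⊢
    simp only [map_add, add_apply, h1, h2, add_zero]
  zero_mem' := fun w ↦ by simp [inducedForm, AlmostContactBMetric.metric]
  smul_mem' := fun c a ha w ↦ by
    have h1 := ha w
    simp only [inducedForm, AlmostContactBMetric.metric] at h1 ⊢
    simp only [map_smul, smul_apply, h1, smul_zero]

/-- A half lightlike submanifold `M` of `(Q, g)`, immersed by `f`: it has codimension two and its
radical distribution has rank one. It comes with a screen distribution `S(TM)`, a section `ξ`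
spanning `Rad(TM)`, a unit section `L` spanning the screen transversal bundle `S(TM^⊥)` (so that
`TM^⊥ = Rad(TM) ⊥ S(TM^⊥)`), and the corresponding section `N` of the lightlike transversal bundle
`ltr(TM)`, which is determined by `ξ`, `L` and `S(TM)`. The distribution `screen` is smooth, being
the kernel of the smooth nowhere vanishing one-form `X ↦ g(X, N)`. -/
structure HalfLightlike (F : Type*) [NormedAddCommGroup F] [NormedSpace ℝ F] [ChartedSpace F M]
    [IsManifold 𝓘(ℝ, F) ∞ M] (A : AlmostContactBMetric E Q) (f : M → Q) where
  contMDiff_f : ContMDiff 𝓘(ℝ, F) 𝓘(ℝ, E) ∞ f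
  mfderiv_injective : ∀ p : M, Function.Injective (mfderiv 𝓘(ℝ, F) 𝓘(ℝ, E) f p)
  codim_two : Module.finrank ℝ E = Module.finrank ℝ F + 2
  finrank_radical : ∀ p : M, Module.finrank ℝ (radical F A f p) = 1
  screen : Π p : M, Submodule ℝ (TangentSpace 𝓘(ℝ, F) p)
  isCompl_screen : ∀ p : M, IsCompl (radical F A f p) (screen p)
  ξ : Π p : M, TangentSpace 𝓘(ℝ, F) p
  contMDiff_ξ : ∀ p, SmoothFieldAt ξ p
  ξ_mem : ∀ p, ξ p ∈ radical F A f p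
  ξ_ne_zero : ∀ p, ξ p ≠ 0
  L : Π p : M, TangentSpace 𝓘(ℝ, E) (f p)
  contMDiff_L : SmoothFieldAlong F f L
  L_normal : ∀ (p : M) (v : TangentSpace 𝓘(ℝ, F) p), A.g (f p) (L p) (mfderiv 𝓘(ℝ, F) 𝓘(ℝ, E) f p v) = 0
  L_unit : ∀ p, A.g (f p) (L p) (L p) = 1 ∨ A.g (f p) (L p) (L p) = -1
  N : Π p : M, TangentSpace 𝓘(ℝ, E) (f p)
  contMDiff_N : SmoothFieldAlong F f N
  N_ξ : ∀ p, A.g (f p) (N p) (mfderiv 𝓘(ℝ, F) 𝓘(ℝ, E) f p (ξ p)) = 1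
  N_N : ∀ p, A.g (f p) (N p) (N p) = 0
  N_L : ∀ p, A.g (f p) (N p) (L p) = 0
  N_screen : ∀ p, ∀ v ∈ screen p, A.g (f p) (N p) (mfderiv 𝓘(ℝ, F) 𝓘(ℝ, E) f p v) = 0

namespace HalfLightlike

variable {F : Type*} [NormedAddCommGroup F] [NormedSpace ℝ F] [ChartedSpace F M]
  [IsManifold 𝓘(ℝ, F) ∞ M] {A : AlmostContactBMetric E Q} {f : M → Q} (S : HalfLightlike F A f)

/-- The linear map `(v, a, b) ↦ df v + a N + b L` on `T_p M × ℝ × ℝ`. -/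
def gaussMap (p : M) :
    (TangentSpace 𝓘(ℝ, F) p × ℝ × ℝ) →ₗ[ℝ] TangentSpace 𝓘(ℝ, E) (f p) :=
  LinearMap.coprod (mfderiv 𝓘(ℝ, F) 𝓘(ℝ, E) f p).toLinearMap
    (LinearMap.coprod (LinearMap.toSpanSingleton ℝ _ (S.N p))
      (LinearMap.toSpanSingleton ℝ _ (S.L p)))

theorem gaussMap_apply (p : M) (v : TangentSpace 𝓘(ℝ, F) p) (a b : ℝ) :
    S.gaussMap p (v, a, b) =
      mfderiv 𝓘(ℝ, F) 𝓘(ℝ, E) f p v + (a • S.N p + b • S.L p) := by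
  simp [gaussMap]

theorem gaussMap_injective (p : M) : Function.Injective (S.gaussMap p) := by
  rw [← LinearMap.ker_eq_bot, LinearMap.ker_eq_bot']
  rintro ⟨v, a, b⟩ h
  rw [gaussMap_apply] at h
  have hL : ∀ w, A.g (f p) (mfderiv 𝓘(ℝ, F) 𝓘(ℝ, E) f p w) (S.L p) = 0 := fun w ↦ by
    rw [A.g_symm]; exact S.L_normal p w
  have ha : a = 0 := by
    have h1 := congrArg (fun u ↦ A.g (f p) u (mfderiv 𝓘(ℝ, F) 𝓘(ℝ, E) f p (S.ξ p))) h
    have h2 : A.g (f p) (mfderiv 𝓘(ℝ, F) 𝓘(ℝ, E) f p v)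
        (mfderiv 𝓘(ℝ, F) 𝓘(ℝ, E) f p (S.ξ p)) = 0 := by
      rw [A.g_symm]; exact S.ξ_mem p v
    simpa [h2, S.N_ξ, S.L_normal] using h1
  have hb : b = 0 := by
    have h1 := congrArg (fun u ↦ A.g (f p) u (S.L p)) h
    rcases S.L_unit p with hu | hu <;> simpa [ha, hL, hu] using h1
  have hv : v = 0 := by
    apply S.mfderiv_injective p
    simpa [ha, hb] using h
  simp [ha, hb, hv]

/-- The map `(s, c) ↦ s + c ξ` on `S(T_p M) × ℝ`. -/
def screenMap (p : M) : (S.screen p × ℝ) →ₗ[ℝ] TangentSpace 𝓘(ℝ, F) p :=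
  LinearMap.coprod (S.screen p).subtype (LinearMap.toSpanSingleton ℝ _ (S.ξ p))

theorem screenMap_apply (p : M) (s : S.screen p) (c : ℝ) :
    S.screenMap p (s, c) = (s : TangentSpace 𝓘(ℝ, F) p) + c • S.ξ p := by
  simp [screenMap]

theorem screenMap_injective (p : M) : Function.Injective (S.screenMap p) := by
  rw [← LinearMap.ker_eq_bot, LinearMap.ker_eq_bot']
  rintro ⟨s, c⟩ h
  rw [screenMap_apply] at h
  have hs : (s : TangentSpace 𝓘(ℝ, F) p) = -(c • S.ξ p) := eq_neg_of_add_eq_zero_left h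
  have h1 : (s : TangentSpace 𝓘(ℝ, F) p) ∈ radical F A f p := by
    rw [hs]; exact neg_mem (Submodule.smul_mem _ _ (S.ξ_mem p))
  have h2 : (s : TangentSpace 𝓘(ℝ, F) p) = 0 :=
    Submodule.disjoint_def.1 (S.isCompl_screen p).disjoint _ h1 s.2
  have h3 : c = 0 := by
    have h4 : c • S.ξ p = 0 := by rw [h2, zero_add] at h; exact h
    exact (smul_eq_zero.1 h4).resolve_right (S.ξ_ne_zero p)
  have h5 : s = 0 := Subtype.ext h2
  simp [h5, h3]

variable [FiniteDimensional ℝ E] [FiniteDimensional ℝ F]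

/-- The decomposition `TQ = TM ⊕ tr(TM)`, `tr(TM) = ltr(TM) ⊥ S(TM^⊥)`: every `w ∈ T_{f p} Q` is
uniquely `df v + a N + b L`, and `gaussEquiv.symm w = (v, a, b)`. -/
def gaussEquiv (p : M) :
    (TangentSpace 𝓘(ℝ, F) p × ℝ × ℝ) ≃ₗ[ℝ] TangentSpace 𝓘(ℝ, E) (f p) :=
  haveI : FiniteDimensional ℝ (TangentSpace 𝓘(ℝ, F) p) :=
    inferInstanceAs (FiniteDimensional ℝ F)
  haveI : FiniteDimensional ℝ (TangentSpace 𝓘(ℝ, E) (f p)) :=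
    inferInstanceAs (FiniteDimensional ℝ E)
  LinearMap.linearEquivOfInjective (S.gaussMap p) (S.gaussMap_injective p) (by
    rw [Module.finrank_prod, Module.finrank_prod, Module.finrank_self]
    exact S.codim_two.symm)

/-- The decomposition `TM = S(TM) ⊥ Rad(TM)`: every `v ∈ T_p M` is uniquely `s + c ξ` with
`s ∈ S(T_p M)`, and `screenEquiv.symm v = (s, c)`. -/
def screenEquiv (p : M) : (S.screen p × ℝ) ≃ₗ[ℝ] TangentSpace 𝓘(ℝ, F) p :=
  haveI : FiniteDimensional ℝ (TangentSpace 𝓘(ℝ, F) p) :=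
    inferInstanceAs (FiniteDimensional ℝ F)
  LinearMap.linearEquivOfInjective (S.screenMap p) (S.screenMap_injective p) (by
    rw [Module.finrank_prod, Module.finrank_self, add_comm, ← S.finrank_radical p]
    exact Submodule.finrank_add_eq_of_isCompl (S.isCompl_screen p))

/-- The projection `P` of `TM` onto `S(TM)`. -/
def P (p : M) (v : TangentSpace 𝓘(ℝ, F) p) : TangentSpace 𝓘(ℝ, F) p :=
  ((S.screenEquiv p).symm v).1

/-- The one-form `η(v) = g(v, N)` on `M`. -/
def η (p : M) (v : TangentSpace 𝓘(ℝ, F) p) : ℝ :=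
  A.g (f p) (mfderiv 𝓘(ℝ, F) 𝓘(ℝ, E) f p v) (S.N p)

/-- The function `μ = η̄(ξ)` on `M`, where `η̄` is the contact form of the ambient manifold. -/
def μ (p : M) : ℝ := A.η (f p) (mfderiv 𝓘(ℝ, F) 𝓘(ℝ, E) f p (S.ξ p))

/-- The induced connection `∇` on `M`: the `TM`-component of `∇̄_v Y` in the Gauss formula
`∇̄_v Y = ∇_v Y + B(v, Y) N + D(v, Y) L`, for a vector field `Y` on `M`. -/
def inducedConnection
    (cov : CovariantDerivative 𝓘(ℝ, E) E (TangentSpace 𝓘(ℝ, E) : Q → Type _))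
    (Y : Π p : M, TangentSpace 𝓘(ℝ, F) p) (p : M) (v : TangentSpace 𝓘(ℝ, F) p) :
    TangentSpace 𝓘(ℝ, F) p :=
  ((S.gaussEquiv p).symm
    (covAlong cov f (fun q ↦ mfderiv 𝓘(ℝ, F) 𝓘(ℝ, E) f q (Y q)) p v)).1

/-- The local second fundamental form `C` of the screen distribution: `C(v, PY)` is the
coefficient of `ξ` in the Gauss formula `∇_v PY = ∇*_v PY + C(v, PY) ξ`. -/
def C (cov : CovariantDerivative 𝓘(ℝ, E) E (TangentSpace 𝓘(ℝ, E) : Q → Type _))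
    (Y : Π p : M, TangentSpace 𝓘(ℝ, F) p) (p : M) (v : TangentSpace 𝓘(ℝ, F) p) : ℝ :=
  ((S.screenEquiv p).symm (S.inducedConnection cov (fun q ↦ S.P q (Y q)) p v)).2

/-- `M` is screen totally umbilical with smooth umbilicity function `γ`:
`C(X, PY) = γ g(X, Y)`. -/
structure IsScreenTotallyUmbilical
    (cov : CovariantDerivative 𝓘(ℝ, E) E (TangentSpace 𝓘(ℝ, E) : Q → Type _))
    (γ : M → ℝ) : Prop where
  contMDiff_γ : ContMDiff 𝓘(ℝ, F) 𝓘(ℝ, ℝ) ∞ γ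
  C_eq : ∀ (p : M) (v : TangentSpace 𝓘(ℝ, F) p) (Y : Π p : M, TangentSpace 𝓘(ℝ, F) p),
    SmoothFieldAt Y p → S.C cov Y p v = γ p * inducedForm f A.metric p v (Y p)

/-- Radical screen transversal: `φ̄(Rad(TM)) = S(TM^⊥)`. -/
def IsRSTHL : Prop :=
  ∀ p, ((radical F A f p).map (mfderiv 𝓘(ℝ, F) 𝓘(ℝ, E) f p).toLinearMap).map
    (A.φ (f p)).toLinearMap = Submodule.span ℝ {S.L p}

/-- Ascreen: the Reeb field `ξ̄` of the ambient manifold lies in `Rad(TM) ⊕ ltr(TM)` along `M`. -/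
def IsAscreen : Prop :=
  ∀ p, A.ξ (f p) ∈ (radical F A f p).map (mfderiv 𝓘(ℝ, F) 𝓘(ℝ, E) f p).toLinearMap ⊔
    Submodule.span ℝ {S.N p}

end HalfLightlike

end HalfLightlike
end

/-! Put `ζ = μ⁻¹ ξ` and `a = 2μγ`. The ascreen condition with `g(ξ̄, ξ̄) = 1` gives `ξ̄ = (2μ)⁻¹ ξ +
μ N`, so on `M` one has `η̄ = μ η`, `η̄(ζ) = 1` and `PX = X - η̄(X) ζ`. The radical screen
transversal condition makes `φ̄ζ` a normal field with `g(φ̄ζ, φ̄ζ) = 1`. Hence `TM` is the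
`g`-orthogonal complement of `ζ` and `φ̄ζ`, and `TQ = TM ⊕ ⟨ξ̄⟩ ⊕ ⟨φ̄ζ⟩`; vectors are identified by
pairing them with `TM`, `ξ̄` and `φ̄ζ`.

In the class `F₀` the tensors `φ̄`, `ξ̄`, `η̄` are parallel, and therefore so is `g̃`: both metrics
have the same connection and the same curvature. Differentiating `g(ζ, PZ) = 0`, the umbilicity of
the screen becomes the single equation `∇̄_X ζ = a PX` (`covAlong_zeta`), from which everything
extrinsic follows.

The ambient curvature is algebraic. It commutes with `φ̄` in every slot and is killed by `ξ̄`, so on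
`ker η̄`, with complex structure `φ̄`, it is a complex curvature tensor, determined by its values on
a real form. Vectors of an orthonormal real form span totally real sections, and polarization there
gives `R̄ = ν̄ π - ν̄' φ̄π` for the model tensor `π`
(`HasConstTotallyRealCurvatures.curvatureAt_eq`). Comparing this with `R̄(X, Y)ζ` computed from `∇̄ζ
= aP`, and using that `v` and `φ̄v` are independent, forces `ν̄' = 0` along `M` and `da = (ν̄ - a²)
η̄` (`assoc_curvature_eq_zero_and_mvfderiv_shape`).

The `g̃`-normal bundle of `M` is spanned by `ξ̄ - ζ` and `φ̄ζ - ζ`, and `∇̄_X Y = ∇̃_X Y - a [g(X,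
Y)(ξ̄ - ζ) + g(X, φ̄Y)(φ̄ζ - ζ)]` (`df_covM`). Applying this twice expresses `R̃` through `R̄`, `a`
and `da`. The equation for `da` cancels the normal components, and the tangential ones are the
asserted formula with `a² = 4μ²γ²` (`df_curvature`). Its trace consists of a multiple of the
identity, rank one terms and a multiple of `φ̄P`; the last is traceless because `(φ̄P)³ = -φ̄P`
(`ricci_eq`).

The analytic layer rests on fields with constant coordinates in a trivialization. They commute, and
they form local frames, so an identity for fields along a map need only be checked on functions
times frame fields. -/

noncomputable section
-- Calculus in a trivialization of the tangent bundle
section Coordinates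

set_option linter.unusedSectionVars false

variable {F : Type*} [NormedAddCommGroup F] [NormedSpace ℝ F]
  {M : Type*} [TopologicalSpace M] [ChartedSpace F M] [IsManifold 𝓘(ℝ, F) ∞ M]
  {G : Type*} [NormedAddCommGroup G] [NormedSpace ℝ G]

/-- The coordinates of a tangent vector in the preferred trivialization at `p₀`. -/
def coordVec (p₀ q : M) (v : TangentSpace 𝓘(ℝ, F) q) : F :=
  (trivializationAt F (TangentSpace 𝓘(ℝ, F) : M → Type _) p₀ (TotalSpace.mk' F q v)).2

/-- The tangent trivialization is the derivative of the chart. This makes coordinates linear in the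
vector and turns directional derivatives into ordinary ones. -/
theorem coordVec_eq_mfderiv {p₀ q : M} (hq : q ∈ (chartAt F p₀).source)
    (v : TangentSpace 𝓘(ℝ, F) q) :
    coordVec p₀ q v = mvfderiv 𝓘(ℝ, F) (extChartAt 𝓘(ℝ, F) p₀) q v := by
  have h := TangentBundle.continuousLinearMapAt_trivializationAt (I := 𝓘(ℝ, F)) hq
  have h2 := DFunLike.congr_fun h v
  rw [Trivialization.continuousLinearMapAt_apply,
    Trivialization.coe_linearMapAt_of_mem _ (by simpa using hq)] at h2
  exact h2

theorem coordVec_self (p : M) (v : TangentSpace 𝓘(ℝ, F) p) : coordVec p p v = v := by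
  rw [coordVec_eq_mfderiv (mem_chart_source F p)]
  have h := mfderiv_extChartAt_self (I := 𝓘(ℝ, F)) (x := p)
  exact DFunLike.congr_fun h v

theorem coordVec_add {p₀ q : M} (hq : q ∈ (chartAt F p₀).source)
    (v w : TangentSpace 𝓘(ℝ, F) q) :
    coordVec p₀ q (v + w) = coordVec p₀ q v + coordVec p₀ q w := by
  simp [coordVec_eq_mfderiv hq]

theorem coordVec_smul {p₀ q : M} (hq : q ∈ (chartAt F p₀).source) (c : ℝ)
    (v : TangentSpace 𝓘(ℝ, F) q) :
    coordVec p₀ q (c • v) = c • coordVec p₀ q v := by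
  simp [coordVec_eq_mfderiv hq]

/-- The vector field with constant coordinates `u` in the preferred trivialization at `p₀`. -/
def constField (p₀ : M) (u : F) (q : M) : TangentSpace 𝓘(ℝ, F) q :=
  (trivializationAt F (TangentSpace 𝓘(ℝ, F) : M → Type _) p₀).symm q u

theorem extend_eq_constField (p₀ : M) (v : TangentSpace 𝓘(ℝ, F) p₀) :
    FiberBundle.extend F v = constField p₀ (coordVec p₀ p₀ v) := rfl

theorem constField_coordVec {p₀ q : M} (hq : q ∈ (chartAt F p₀).source)
    (v : TangentSpace 𝓘(ℝ, F) q) : constField p₀ (coordVec p₀ q v) q = v :=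
  Trivialization.symm_apply_apply_mk _ (by simpa using hq) v

theorem coordVec_constField {p₀ q : M} (hq : q ∈ (chartAt F p₀).source) (u : F) :
    coordVec p₀ q (constField p₀ u q) = u := by
  rw [coordVec, constField, TotalSpace.mk', Trivialization.apply_mk_symm _ (by simpa using hq)]

theorem coordVec_injective {p₀ q : M} (hq : q ∈ (chartAt F p₀).source) :
    Function.Injective (coordVec p₀ q : TangentSpace 𝓘(ℝ, F) q → F) := fun v w h ↦ by
  rw [← constField_coordVec hq v, h, constField_coordVec hq w]

theorem constField_add {p₀ q : M} (hq : q ∈ (chartAt F p₀).source) (u v : F) :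
    constField p₀ (u + v) q = constField p₀ u q + constField p₀ v q := by
  apply coordVec_injective hq
  simp only [coordVec_add hq, coordVec_constField hq]

theorem constField_smul {p₀ q : M} (hq : q ∈ (chartAt F p₀).source) (c : ℝ) (u : F) :
    constField p₀ (c • u) q = c • constField p₀ u q := by
  apply coordVec_injective hq
  simp only [coordVec_smul hq, coordVec_constField hq]

theorem constField_sum {p₀ q : M} (hq : q ∈ (chartAt F p₀).source) {ι : Type*} (s : Finset ι)
    (u : ι → F) : constField p₀ (∑ i ∈ s, u i) q = ∑ i ∈ s, constField p₀ (u i) q :=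
  map_sum (AddMonoidHom.mk' (fun u ↦ constField p₀ u q) (constField_add hq)) u s

theorem mdiffAt_iff_coordVec {N : Type*} {H : Type*} [NormedAddCommGroup H] [NormedSpace ℝ H]
    [TopologicalSpace N] [ChartedSpace H N]
    {b : N → M} {V : Π x : N, TangentSpace 𝓘(ℝ, F) (b x)} {p₀ : M} {q : N}
    (hq : b q ∈ (chartAt F p₀).source) :
    MDifferentiableAt 𝓘(ℝ, H) (𝓘(ℝ, F).prod 𝓘(ℝ, F)) (fun x ↦ TotalSpace.mk' F (b x) (V x)) q ↔
      MDifferentiableAt 𝓘(ℝ, H) 𝓘(ℝ, F) b q ∧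
        MDifferentiableAt 𝓘(ℝ, H) 𝓘(ℝ, F) (fun x ↦ coordVec p₀ (b x) (V x)) q :=
  Trivialization.mdifferentiableAt_totalSpace_iff _ _
    (e := trivializationAt F (TangentSpace 𝓘(ℝ, F) : M → Type _) p₀) (by simpa using hq)

theorem contMDiffAt_iff_coordVec {N : Type*} {H : Type*} [NormedAddCommGroup H] [NormedSpace ℝ H]
    [TopologicalSpace N] [ChartedSpace H N]
    {b : N → M} {V : Π x : N, TangentSpace 𝓘(ℝ, F) (b x)} {p₀ : M} {q : N} 
    (hq : b q ∈ (chartAt F p₀).source) :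
    ContMDiffAt 𝓘(ℝ, H) (𝓘(ℝ, F).prod 𝓘(ℝ, F)) 2 (fun x ↦ TotalSpace.mk' F (b x) (V x)) q ↔
      ContMDiffAt 𝓘(ℝ, H) 𝓘(ℝ, F) 2 b q ∧
        ContMDiffAt 𝓘(ℝ, H) 𝓘(ℝ, F) 2 (fun x ↦ coordVec p₀ (b x) (V x)) q :=
  Trivialization.contMDiffAt_iff (e := trivializationAt F (TangentSpace 𝓘(ℝ, F) : M → Type _) p₀)
     (by simpa using hq)

theorem mvfderiv_eq_fderiv {h : M → G} {p₀ q : M} (hq : q ∈ (chartAt F p₀).source)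
    (hh : MDifferentiableAt 𝓘(ℝ, F) 𝓘(ℝ, G) h q) (v : TangentSpace 𝓘(ℝ, F) q) :
    mvfderiv 𝓘(ℝ, F) h q v =
      fderiv ℝ (h ∘ (extChartAt 𝓘(ℝ, F) p₀).symm) (extChartAt 𝓘(ℝ, F) p₀ q)
        (coordVec p₀ q v) := by
  have hq' : q ∈ (extChartAt 𝓘(ℝ, F) p₀).source := by simpa using hq
  have hs : MDifferentiableAt 𝓘(ℝ, F) 𝓘(ℝ, F) (extChartAt 𝓘(ℝ, F) p₀).symm
      (extChartAt 𝓘(ℝ, F) p₀ q) := by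
    have := mdifferentiableWithinAt_extChartAt_symm (I := 𝓘(ℝ, F))
      ((extChartAt 𝓘(ℝ, F) p₀).map_source hq')
    rwa [modelWithCornersSelf_coe, Set.range_id, mdifferentiableWithinAt_univ] at this
  have hl := (extChartAt 𝓘(ℝ, F) p₀).left_inv hq'
  have hd : MDifferentiableAt 𝓘(ℝ, F) 𝓘(ℝ, G) (h ∘ (extChartAt 𝓘(ℝ, F) p₀).symm)
      (extChartAt 𝓘(ℝ, F) p₀ q) := MDifferentiableAt.comp _ (by rwa [hl]) hs
  have he : h =ᶠ[nhds q] (h ∘ (extChartAt 𝓘(ℝ, F) p₀).symm) ∘ (extChartAt 𝓘(ℝ, F) p₀) := by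
    filter_upwards [(isOpen_extChartAt_source p₀).mem_nhds hq'] with x hx
    simp only [Function.comp_apply, (extChartAt 𝓘(ℝ, F) p₀).left_inv hx]
  have hc := mfderiv_comp_apply q hd (mdifferentiableAt_extChartAt hq) v
  rw [coordVec_eq_mfderiv hq]
  have h1 : mfderiv 𝓘(ℝ, F) 𝓘(ℝ, G) h q =
    mfderiv 𝓘(ℝ, F) 𝓘(ℝ, G) ((h ∘ (extChartAt 𝓘(ℝ, F) p₀).symm) ∘ (extChartAt 𝓘(ℝ, F) p₀)) q := he.mfderiv_eq
  have h2 : mvfderiv 𝓘(ℝ, F) h q v = mvfderiv 𝓘(ℝ, F) ((h ∘ (extChartAt 𝓘(ℝ, F) p₀).symm) ∘ (extChartAt 𝓘(ℝ, F) p₀)) q v := by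
    unfold mvfderiv
    exact DFunLike.congr_fun h1 v
  rw [h2]
  rw [mfderiv_eq_fderiv] at hc
  exact hc

theorem contDiffAt_comp_extChartAt_symm {h : M → G} {p : M}
    (hh : ContMDiffAt 𝓘(ℝ, F) 𝓘(ℝ, G) 2 h p) :
    ContDiffAt ℝ 2 (h ∘ (extChartAt 𝓘(ℝ, F) p).symm) (extChartAt 𝓘(ℝ, F) p p) := by
  have := (contMDiffAt_iff.1 hh).2
  rw [modelWithCornersSelf_coe, Set.range_id, contDiffWithinAt_univ] at this
  exact this

theorem differentiableAt_comp_extChartAt_symm {h : M → G} {p : M}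
    (hh : MDifferentiableAt 𝓘(ℝ, F) 𝓘(ℝ, G) h p) :
    DifferentiableAt ℝ (h ∘ (extChartAt 𝓘(ℝ, F) p).symm) (extChartAt 𝓘(ℝ, F) p p) := by
  have := ((mdifferentiableAt_iff _ _).1 hh).2
  rw [modelWithCornersSelf_coe, Set.range_id, differentiableWithinAt_univ] at this
  exact this

theorem eventually_mem_chartAt_source (p : M) : ∀ᶠ q in nhds p, q ∈ (chartAt F p).source :=
  (chartAt F p).open_source.mem_nhds (mem_chart_source F p)

theorem ContMDiffAt.eventually_mdifferentiableAt {h : M → G} {p : M}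
    (hh : ContMDiffAt 𝓘(ℝ, F) 𝓘(ℝ, G) 2 h p) :
    ∀ᶠ q in nhds p, MDifferentiableAt 𝓘(ℝ, F) 𝓘(ℝ, G) h q := by
  filter_upwards [(contMDiffAt_iff_contMDiffAt_nhds (by simp)).1 hh] with q hq using
    hq.mdifferentiableAt (by simp)

theorem ContMDiffAt.eventually_mvfderiv_eq_fderiv {h : M → G} {p : M}
    (hh : ContMDiffAt 𝓘(ℝ, F) 𝓘(ℝ, G) 2 h p) (Y : Π q : M, TangentSpace 𝓘(ℝ, F) q) :
    (fun q ↦ mvfderiv 𝓘(ℝ, F) h q (Y q)) =ᶠ[nhds p] fun q ↦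
      fderiv ℝ (h ∘ (extChartAt 𝓘(ℝ, F) p).symm) (extChartAt 𝓘(ℝ, F) p q)
        (coordVec p q (Y q)) := by
  filter_upwards [hh.eventually_mdifferentiableAt, eventually_mem_chartAt_source (F := F) p]
    with q hq hs using mvfderiv_eq_fderiv hs hq _

/-- The product rule for `DH(y)` with `H` the chart expression of `h`. The second derivative of `H`
appears explicitly so that its symmetry can be used for the bracket. -/
theorem hasMFDerivAt_fderiv_comp {h : M → G} {p : M}
    (hh : ContMDiffAt 𝓘(ℝ, F) 𝓘(ℝ, G) 2 h p) {y : M → F}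
    (hy : MDifferentiableAt 𝓘(ℝ, F) 𝓘(ℝ, F) y p) :
    MDifferentiableAt 𝓘(ℝ, F) 𝓘(ℝ, G) (fun q ↦
      fderiv ℝ (h ∘ (extChartAt 𝓘(ℝ, F) p).symm) (extChartAt 𝓘(ℝ, F) p q) (y q)) p ∧
    ∀ v, mvfderiv 𝓘(ℝ, F) (fun q ↦
      fderiv ℝ (h ∘ (extChartAt 𝓘(ℝ, F) p).symm) (extChartAt 𝓘(ℝ, F) p q) (y q)) p v =
      fderiv ℝ (fderiv ℝ (h ∘ (extChartAt 𝓘(ℝ, F) p).symm)) (extChartAt 𝓘(ℝ, F) p p)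
        (coordVec p p v) (y p) +
      fderiv ℝ (h ∘ (extChartAt 𝓘(ℝ, F) p).symm) (extChartAt 𝓘(ℝ, F) p p)
        (mvfderiv 𝓘(ℝ, F) y p v) := by
  set H := h ∘ (extChartAt 𝓘(ℝ, F) p).symm with hH
  set c := extChartAt 𝓘(ℝ, F) p with hc
  have hd : DifferentiableAt ℝ (fderiv ℝ H) (c p) :=
    ((contDiffAt_comp_extChartAt_symm hh).fderiv_right (m := 1) (by norm_num)).differentiableAt
      (by simp)
  have hcd : MDifferentiableAt 𝓘(ℝ, F) 𝓘(ℝ, F) c p :=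
    mdifferentiableAt_extChartAt (mem_chart_source F p)
  have h1 : MDifferentiableAt 𝓘(ℝ, F) 𝓘(ℝ, F →L[ℝ] G) (fun q ↦ fderiv ℝ H (c q)) p :=
    hd.mdifferentiableAt.comp p hcd
  have hB : DifferentiableAt ℝ (fun z : (F →L[ℝ] G) × F ↦ z.1 z.2) (fderiv ℝ H (c p), y p) := by
    fun_prop
  have h2 := h1.prodMk_space hy
  have h3 := hB.mdifferentiableAt.comp p h2
  refine ⟨h3, fun v ↦ ?_⟩
  have h4 := mvfderiv_eq_fderiv (mem_chart_source F p) h3 v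
  have e1 := differentiableAt_comp_extChartAt_symm hy
  have e2 : DifferentiableAt ℝ ((fun q ↦ fderiv ℝ H (c q)) ∘ c.symm) (c p) :=
    differentiableAt_comp_extChartAt_symm h1
  have e4 := mvfderiv_eq_fderiv (mem_chart_source F p) h1 v
  rw [show (fun q ↦ fderiv ℝ H (c q) (y q)) = (fun z : (F →L[ℝ] G) × F ↦ z.1 z.2) ∘ (fun q ↦ (fderiv ℝ H (c q), y q)) from rfl, h4, mvfderiv_eq_fderiv (mem_chart_source F p) hy v]
  -- The chart and its inverse cancel on the chart target only, hence the equality of germs.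
  have e3 : (fun q ↦ fderiv ℝ H (c q)) ∘ c.symm =ᶠ[nhds (c p)] fderiv ℝ H := by
    filter_upwards [extChartAt_target_mem_nhds (I := 𝓘(ℝ, F)) p] with z hz
    simp only [Function.comp_apply, hc, (extChartAt 𝓘(ℝ, F) p).right_inv hz]
  have e5 : ((fun z : (F →L[ℝ] G) × F ↦ z.1 z.2) ∘ (fun q ↦ (fderiv ℝ H (c q), y q))) ∘ c.symm
     = fun z ↦ ((fun q ↦ fderiv ℝ H (c q)) ∘ c.symm) z ((y ∘ c.symm) z) := rfl
  rw [e5, fderiv_clm_apply e2 e1, e3.fderiv_eq, e3.eq_of_nhds]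
  have : c.symm (c p) = p := extChartAt_to_inv p
  simp only [add_apply, ContinuousLinearMap.comp_apply, ContinuousLinearMap.flip_apply,
    Function.comp_apply]
  rw [add_comm, ← hc, this]

/-- The derivative of a `C^2` function in the direction of a differentiable vector field is
differentiable. -/
theorem mdifferentiableAt_mvfderiv_apply {h : M → G} {p : M}
    (hh : ContMDiffAt 𝓘(ℝ, F) 𝓘(ℝ, G) 2 h p) {Y : Π q : M, TangentSpace 𝓘(ℝ, F) q}
    (hY : MDiffAt (T% Y) p) :
    MDifferentiableAt 𝓘(ℝ, F) 𝓘(ℝ, G) (fun q ↦ mvfderiv 𝓘(ℝ, F) h q (Y q)) p :=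
  ((hasMFDerivAt_fderiv_comp hh ((mdiffAt_iff_coordVec (mem_chart_source F p)).1 hY).2).1).congr_of_eventuallyEq
    (hh.eventually_mvfderiv_eq_fderiv Y)

/-- The bracket is defined by pulling both fields back to the chart, and the pulled back field is
the coordinate expression of the original one. -/
theorem coordVec_mlieBracket {p : M} {X Y : Π q : M, TangentSpace 𝓘(ℝ, F) q}
    (hX : MDiffAt (T% X) p) (hY : MDiffAt (T% Y) p) :
    coordVec p p (VectorField.mlieBracket 𝓘(ℝ, F) X Y p) =
      mvfderiv 𝓘(ℝ, F) (fun q ↦ coordVec p q (Y q)) p (X p) -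
      mvfderiv 𝓘(ℝ, F) (fun q ↦ coordVec p q (X q)) p (Y p) := by
  have key : ∀ W : Π q : M, TangentSpace 𝓘(ℝ, F) q,
      VectorField.mpullbackWithin 𝓘(ℝ, F) 𝓘(ℝ, F) (extChartAt 𝓘(ℝ, F) p).symm W Set.univ
        =ᶠ[nhds (extChartAt 𝓘(ℝ, F) p p)]
        (fun q ↦ coordVec p q (W q)) ∘ (extChartAt 𝓘(ℝ, F) p).symm := fun W ↦ by
    filter_upwards [extChartAt_target_mem_nhds (I := 𝓘(ℝ, F)) p] with z hz
    have hs : (extChartAt 𝓘(ℝ, F) p).symm z ∈ (chartAt F p).source := by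
      simpa using (extChartAt 𝓘(ℝ, F) p).map_target hz
    have i1 := mfderivWithin_extChartAt_symm_comp_mfderiv_extChartAt hz
    have i3 := isInvertible_mfderivWithin_extChartAt_symm hz
    simp only [modelWithCornersSelf_coe, Set.range_id] at i1 i3
    have h1 := DFunLike.congr_fun i1 (W ((extChartAt 𝓘(ℝ, F) p).symm z))
    rw [Function.comp_apply, VectorField.mpullbackWithin_apply, coordVec_eq_mfderiv hs]
    have h2 := congrArg (mfderivWithin 𝓘(ℝ, F) 𝓘(ℝ, F) (extChartAt 𝓘(ℝ, F) p).symm Set.univ z).inverse h1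
    have h3 := DFunLike.congr_fun i3.inverse_comp_self (mfderiv 𝓘(ℝ, F) 𝓘(ℝ, F)
      (extChartAt 𝓘(ℝ, F) p) ((extChartAt 𝓘(ℝ, F) p).symm z) (W ((extChartAt 𝓘(ℝ, F) p).symm z)))
    exact h2.symm.trans h3
  have hXd := ((mdiffAt_iff_coordVec (mem_chart_source F p)).1 hX).2
  have hYd := ((mdiffAt_iff_coordVec (mem_chart_source F p)).1 hY).2
  have hinv : ∀ B : TangentSpace 𝓘(ℝ, F) (extChartAt 𝓘(ℝ, F) p p),
      ((mfderiv 𝓘(ℝ, F) 𝓘(ℝ, F) (extChartAt 𝓘(ℝ, F) p) p).inverse B : F) = B := fun B ↦ by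
    have i3 := isInvertible_mfderiv_extChartAt (I := 𝓘(ℝ, F)) (mem_extChartAt_source p)
    have h1 := DFunLike.congr_fun i3.self_comp_inverse B
    have h2 := coordVec_self p ((mfderiv 𝓘(ℝ, F) 𝓘(ℝ, F) (extChartAt 𝓘(ℝ, F) p) p).inverse B :
      TangentSpace 𝓘(ℝ, F) p)
    rw [coordVec_eq_mfderiv (mem_chart_source F p)] at h2
    exact h2.symm.trans h1
  have hb : coordVec p p (VectorField.mlieBracket 𝓘(ℝ, F) X Y p) =
      VectorField.lieBracketWithin ℝ
        (VectorField.mpullbackWithin 𝓘(ℝ, F) 𝓘(ℝ, F) (extChartAt 𝓘(ℝ, F) p).symm X Set.univ)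
        (VectorField.mpullbackWithin 𝓘(ℝ, F) 𝓘(ℝ, F) (extChartAt 𝓘(ℝ, F) p).symm Y Set.univ)
        Set.univ (extChartAt 𝓘(ℝ, F) p p) := by
    rw [← VectorField.mlieBracketWithin_univ, VectorField.mlieBracketWithin_apply, coordVec_self]
    simp only [modelWithCornersSelf_coe, Set.range_id, Set.preimage_univ, Set.univ_inter]
    exact hinv _
  have hl : ∀ V W V' W' : F → F, ∀ z, V =ᶠ[nhds z] V' → W =ᶠ[nhds z] W' →
      VectorField.lieBracketWithin ℝ V W Set.univ z =
        fderiv ℝ W' z (V' z) - fderiv ℝ V' z (W' z) := fun V W V' W' z h h' ↦ by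
    rw [VectorField.lieBracketWithin_univ, h.lieBracket_vectorField_eq h',
      VectorField.lieBracket_eq]
  rw [mvfderiv_eq_fderiv (mem_chart_source F p) hXd,
    mvfderiv_eq_fderiv (mem_chart_source F p) hYd, hb]
  refine (hl _ _ _ _ _ (key X) (key Y)).trans ?_
  have hp : (extChartAt 𝓘(ℝ, F) p).symm (extChartAt 𝓘(ℝ, F) p p) = p := extChartAt_to_inv p
  have hc : ∀ W : Π q : M, TangentSpace 𝓘(ℝ, F) q, ((fun q ↦ coordVec p q (W q)) ∘
      (extChartAt 𝓘(ℝ, F) p).symm) (extChartAt 𝓘(ℝ, F) p p) = coordVec p p (W p) := fun W ↦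
    congrArg (fun q ↦ coordVec p q (W q)) hp
  rw [hc X, hc Y]

/-- `[X, Y] h = X (Y h) - Y (X h)`. -/
theorem mvfderiv_mlieBracket {h : M → G} {p : M}
    (hh : ContMDiffAt 𝓘(ℝ, F) 𝓘(ℝ, G) 2 h p) {X Y : Π q : M, TangentSpace 𝓘(ℝ, F) q}
    (hX : MDiffAt (T% X) p) (hY : MDiffAt (T% Y) p) :
    mvfderiv 𝓘(ℝ, F) h p (VectorField.mlieBracket 𝓘(ℝ, F) X Y p) =
      mvfderiv 𝓘(ℝ, F) (fun q ↦ mvfderiv 𝓘(ℝ, F) h q (Y q)) p (X p) -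
      mvfderiv 𝓘(ℝ, F) (fun q ↦ mvfderiv 𝓘(ℝ, F) h q (X q)) p (Y p) := by
  have e : ∀ (Y : Π q : M, TangentSpace 𝓘(ℝ, F) q), MDiffAt (T% Y) p → ∀ v,
      mvfderiv 𝓘(ℝ, F) (fun q ↦ mvfderiv 𝓘(ℝ, F) h q (Y q)) p v = _ := fun Y hY v ↦
    (by 
      have := (hh.eventually_mvfderiv_eq_fderiv Y).mfderiv_eq (I := 𝓘(ℝ, F)) (I' := 𝓘(ℝ, G))
      exact DFunLike.congr_fun this v : _ = mvfderiv 𝓘(ℝ, F) _ p v).trans 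
    ((hasMFDerivAt_fderiv_comp hh ((mdiffAt_iff_coordVec (mem_chart_source F p)).1 hY).2).2 v)
  rw [e X hX, e Y hY, mvfderiv_eq_fderiv (mem_chart_source F p) (hh.mdifferentiableAt (by simp)),
    coordVec_mlieBracket hX hY, map_sub]
  -- The two second derivative terms cancel by symmetry, which is where class `C^2` is needed.
  have hsymm := (contDiffAt_comp_extChartAt_symm hh).isSymmSndFDerivAt (by simp)
  rw [hsymm.eq (coordVec p p (X p)) (coordVec p p (Y p))]
  abel

theorem smoothFieldAt_constField (p₀ : M) {q : M} (hq : q ∈ (chartAt F p₀).source) (u : F) :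
    SmoothFieldAt (constField p₀ u) q := by
  refine ((trivializationAt F (TangentSpace 𝓘(ℝ, F) : M → Type _) p₀).contMDiffAt_section_iff
    (by simpa using hq)).2 ?_
  refine (contMDiffAt_const (c := u)).congr_of_eventuallyEq ?_
  filter_upwards [(chartAt F p₀).open_source.mem_nhds hq] with x hx
  exact coordVec_constField hx u

theorem mdiffAt_constField (p₀ : M) {q : M} (hq : q ∈ (chartAt F p₀).source) (u : F) :
    MDiffAt (T% (constField p₀ u)) q :=
  (smoothFieldAt_constField p₀ hq u).mdifferentiableAt (by simp)

/-- These are coordinate fields: they differentiate the chart to constants, so their bracket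
differentiates the chart to zero. -/
theorem mlieBracket_constField (p₀ : M) {q : M} (hq : q ∈ (chartAt F p₀).source) (u v : F) :
    VectorField.mlieBracket 𝓘(ℝ, F) (constField p₀ u) (constField p₀ v) q = 0 := by
  have hc : ContMDiffAt 𝓘(ℝ, F) 𝓘(ℝ, F) 2 (extChartAt 𝓘(ℝ, F) p₀) q :=
    contMDiffAt_extChartAt' hq
  have hm := mdiffAt_constField p₀ hq
  have hz : ∀ w : F, ∀ v, mvfderiv 𝓘(ℝ, F) (fun x ↦
      mvfderiv 𝓘(ℝ, F) (extChartAt 𝓘(ℝ, F) p₀) x (constField p₀ w x)) q v = 0 := by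
    intro w v
    have : (fun x ↦ mvfderiv 𝓘(ℝ, F) (extChartAt 𝓘(ℝ, F) p₀) x (constField p₀ w x))
        =ᶠ[nhds q] fun _ ↦ w := by
      filter_upwards [(chartAt F p₀).open_source.mem_nhds hq] with x hx
      rw [← coordVec_eq_mfderiv hx, coordVec_constField hx]
    have h2 := this.mfderiv_eq (I := 𝓘(ℝ, F)) (I' := 𝓘(ℝ, F))
    have h3 := DFunLike.congr_fun (mvfderiv_const (I := 𝓘(ℝ, F)) w (x := q)) v
    exact (DFunLike.congr_fun h2 v).trans h3
  have := mvfderiv_mlieBracket hc (hm u) (hm v)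
  rw [hz u, hz v, sub_zero, ← coordVec_eq_mfderiv hq] at this
  apply coordVec_injective hq
  rw [this, coordVec_eq_mfderiv hq, map_zero]

/-- If `A q` is injective at `p`, then `V` is differentiable at `p` when `A V` is. -/
theorem mdifferentiableAt_of_clm_apply [FiniteDimensional ℝ G] {G' : Type*} [NormedAddCommGroup G']
    [NormedSpace ℝ G'] [FiniteDimensional ℝ G'] {A : M → G →L[ℝ] G'} {V : M → G} {p : M}
    (hA : ∀ u, MDifferentiableAt 𝓘(ℝ, F) 𝓘(ℝ, G') (fun q ↦ A q u) p)
    (hinj : Function.Injective (A p))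
    (hV : MDifferentiableAt 𝓘(ℝ, F) 𝓘(ℝ, G') (fun q ↦ A q (V q)) p) :
    MDifferentiableAt 𝓘(ℝ, F) 𝓘(ℝ, G) V p := by
  -- A left inverse of `A p` alone suffices: `L' ∘ A q` is the identity at `p`, hence invertible
  -- near `p`, and `V = (L' ∘ A)⁻¹ (L' (A V))` there.
  obtain ⟨L, hL⟩ := (A p).toLinearMap.exists_leftInverse_of_injective
    (LinearMap.ker_eq_bot.2 hinj)
  let L' : G' →L[ℝ] G := L.toContinuousLinearMap
  have hBp : L' ∘L A p = ContinuousLinearMap.id ℝ G := by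
    ext u; exact DFunLike.congr_fun hL u
  have hAd : MDifferentiableAt 𝓘(ℝ, F) 𝓘(ℝ, G →L[ℝ] G') A p := by
    let b := Module.finBasis ℝ G
    have e : A = fun q ↦ ∑ i, ContinuousLinearMap.smulRightL ℝ G G'
        (b.coord i).toContinuousLinearMap (A q (b i)) := by
      funext q
      ext u
      conv_lhs => rw [← b.sum_repr u, map_sum]
      simp
    rw [e]
    have := MDifferentiableAt.sum (I := 𝓘(ℝ, F)) (z := p) (t := Finset.univ)
      (f := fun i q ↦ ContinuousLinearMap.smulRightL ℝ G G'
        (b.coord i).toContinuousLinearMap (A q (b i))) fun i _ ↦ ?_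
    · convert! this using 1
      ext q
      simp
    exact (ContinuousLinearMap.mdifferentiableAt _).comp p (hA (b i))
  have hBd : MDifferentiableAt 𝓘(ℝ, F) 𝓘(ℝ, G →L[ℝ] G) (fun q ↦ L' ∘L A q) p :=
    (ContinuousLinearMap.mdifferentiableAt (ContinuousLinearMap.compL ℝ G G' G L')).comp p hAd
  have hinv : MDifferentiableAt 𝓘(ℝ, F) 𝓘(ℝ, G →L[ℝ] G) (fun q ↦ Ring.inverse (L' ∘L A q)) p := by
    have h1 : DifferentiableAt ℝ (Ring.inverse : (G →L[ℝ] G) → _) (L' ∘L A p) := by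
      have : CompleteSpace G := FiniteDimensional.complete ℝ G
      rw [hBp]
      exact differentiableAt_inverse (𝕜 := ℝ) (R := G →L[ℝ] G) isUnit_one
    exact h1.mdifferentiableAt.comp p hBd
  have hev : ∀ᶠ q in nhds p, IsUnit (L' ∘L A q) := by
    have : CompleteSpace G := FiniteDimensional.complete ℝ G
    refine hBd.continuousAt.eventually (Units.isOpen.mem_nhds ?_)
    show IsUnit (L' ∘L A p)
    rw [hBp]; exact isUnit_one
  have hLV : MDifferentiableAt 𝓘(ℝ, F) 𝓘(ℝ, G) (fun q ↦ L' (A q (V q))) p :=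
    (ContinuousLinearMap.mdifferentiableAt L').comp p hV
  have hB : DifferentiableAt ℝ (fun z : (G →L[ℝ] G) × G ↦ z.1 z.2)
    (Ring.inverse (L' ∘L A p), L' (A p (V p))) := by fun_prop
  refine (hB.mdifferentiableAt.comp p (hinv.prodMk_space hLV)).congr_of_eventuallyEq ?_
  filter_upwards [hev] with q hq
  have := DFunLike.congr_fun (Ring.inverse_mul_cancel _ hq) (V q)
  exact this.symm

end Coordinates
end

noncomputable section
-- Vector fields along a map
section Along

set_option linter.unusedSectionVars false

variable {E : Type*} [NormedAddCommGroup E] [NormedSpace ℝ E]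
  {Q : Type*} [TopologicalSpace Q] [ChartedSpace E Q] [IsManifold 𝓘(ℝ, E) ∞ Q]
  {F : Type*} [NormedAddCommGroup F] [NormedSpace ℝ F]
  {M : Type*} [TopologicalSpace M] [ChartedSpace F M] [IsManifold 𝓘(ℝ, F) ∞ M]

/-- The vector field `W` along `f` is differentiable at `p`. -/
abbrev MDiffAlongAt (F : Type*) [NormedAddCommGroup F] [NormedSpace ℝ F] [ChartedSpace F M]
    (f : M → Q) (W : Π p : M, TangentSpace 𝓘(ℝ, E) (f p)) (p : M) : Prop :=
  MDifferentiableAt 𝓘(ℝ, F) (𝓘(ℝ, E).prod 𝓘(ℝ, E))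
    (fun q ↦ (TotalSpace.mk' E (f q) (W q) : TangentBundle 𝓘(ℝ, E) Q)) p

/-- The vector field `W` along `f` is of class `C^2` at `p`. -/
abbrev C2AlongAt (F : Type*) [NormedAddCommGroup F] [NormedSpace ℝ F] [ChartedSpace F M]
    (f : M → Q) (W : Π p : M, TangentSpace 𝓘(ℝ, E) (f p)) (p : M) : Prop :=
  ContMDiffAt 𝓘(ℝ, F) (𝓘(ℝ, E).prod 𝓘(ℝ, E)) 2
    (fun q ↦ (TotalSpace.mk' E (f q) (W q) : TangentBundle 𝓘(ℝ, E) Q)) p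

variable {f : M → Q} {V W : Π p : M, TangentSpace 𝓘(ℝ, E) (f p)} {p : M}

theorem C2AlongAt.mdiff (h : C2AlongAt F f W p) : MDiffAlongAt F f W p :=
  h.mdifferentiableAt (by simp)

theorem C2AlongAt.eventually (h : C2AlongAt F f W p) : ∀ᶠ q in nhds p, C2AlongAt F f W q :=
  (contMDiffAt_iff_contMDiffAt_nhds (by simp)).1 h

theorem eventually_mem_source (hf : ContinuousAt f p) {x : Q} (hx : f p ∈ (chartAt E x).source) :
    ∀ᶠ q in nhds p, f q ∈ (chartAt E x).source :=
  hf.eventually ((chartAt E x).open_source.mem_nhds hx)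

theorem MDiffAlongAt.base (h : MDiffAlongAt F f W p) : MDifferentiableAt 𝓘(ℝ, F) 𝓘(ℝ, E) f p :=
  ((mdiffAt_iff_coordVec (mem_chart_source E (f p))).1 h).1

theorem C2AlongAt.base (h : C2AlongAt F f W p) : ContMDiffAt 𝓘(ℝ, F) 𝓘(ℝ, E) 2 f p :=
  ((contMDiffAt_iff_coordVec (mem_chart_source E (f p))).1 h).1

theorem MDiffAlongAt.coord (h : MDiffAlongAt F f W p) {x : Q} (hx : f p ∈ (chartAt E x).source) :
    MDifferentiableAt 𝓘(ℝ, F) 𝓘(ℝ, E) (fun q ↦ coordVec x (f q) (W q)) p :=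
  ((mdiffAt_iff_coordVec hx).1 h).2

theorem C2AlongAt.coord (h : C2AlongAt F f W p) {x : Q} (hx : f p ∈ (chartAt E x).source) :
    ContMDiffAt 𝓘(ℝ, F) 𝓘(ℝ, E) 2 (fun q ↦ coordVec x (f q) (W q)) p :=
  ((contMDiffAt_iff_coordVec hx).1 h).2

theorem MDiffAlongAt.congr (h : MDiffAlongAt F f V p) (hVW : ∀ᶠ q in nhds p, V q = W q) :
    MDiffAlongAt F f W p :=
  MDifferentiableAt.congr_of_eventuallyEq h (hVW.mono fun q hq ↦ by simp only [hq])

theorem C2AlongAt.congr (h : C2AlongAt F f V p) (hVW : ∀ᶠ q in nhds p, V q = W q) :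
    C2AlongAt F f W p :=
  ContMDiffAt.congr_of_eventuallyEq h (hVW.mono fun q hq ↦ by simp only [hq])

theorem MDiffAlongAt.add (hV : MDiffAlongAt F f V p) (hW : MDiffAlongAt F f W p) :
    MDiffAlongAt F f (fun q ↦ V q + W q) p := by
  have hx := mem_chart_source E (f p)
  refine (mdiffAt_iff_coordVec hx).2 ⟨hV.base, ((hV.coord hx).add (hW.coord hx)).congr_of_eventuallyEq ?_⟩
  filter_upwards [eventually_mem_source hV.base.continuousAt hx] with q hq
  exact coordVec_add hq _ _

theorem MDiffAlongAt.smul {h : M → ℝ} (hh : MDifferentiableAt 𝓘(ℝ, F) 𝓘(ℝ, ℝ) h p)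
    (hW : MDiffAlongAt F f W p) : MDiffAlongAt F f (fun q ↦ h q • W q) p := by
  have hx := mem_chart_source E (f p)
  refine (mdiffAt_iff_coordVec hx).2 ⟨hW.base, (hh.smul (hW.coord hx)).congr_of_eventuallyEq ?_⟩
  filter_upwards [eventually_mem_source hW.base.continuousAt hx] with q hq
  exact coordVec_smul hq _ _

theorem MDiffAlongAt.sub (hV : MDiffAlongAt F f V p) (hW : MDiffAlongAt F f W p) :
    MDiffAlongAt F f (fun q ↦ V q - W q) p := by
  refine (hV.add (hW.smul (mdifferentiableAt_const (c := (-1 : ℝ))))).congr ?_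
  filter_upwards with q
  module

theorem C2AlongAt.add (hV : C2AlongAt F f V p) (hW : C2AlongAt F f W p) :
    C2AlongAt F f (fun q ↦ V q + W q) p := by
  have hx := mem_chart_source E (f p)
  refine (contMDiffAt_iff_coordVec hx).2 ⟨hV.base, ((hV.coord hx).add (hW.coord hx)).congr_of_eventuallyEq ?_⟩
  filter_upwards [eventually_mem_source hV.base.continuousAt hx] with q hq
  exact coordVec_add hq _ _

theorem C2AlongAt.smul {h : M → ℝ} (hh : ContMDiffAt 𝓘(ℝ, F) 𝓘(ℝ, ℝ) 2 h p)
    (hW : C2AlongAt F f W p) : C2AlongAt F f (fun q ↦ h q • W q) p := by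
  have hx := mem_chart_source E (f p)
  refine (contMDiffAt_iff_coordVec hx).2 ⟨hW.base, (hh.smul (hW.coord hx)).congr_of_eventuallyEq ?_⟩
  filter_upwards [eventually_mem_source hW.base.continuousAt hx] with q hq
  exact coordVec_smul hq _ _

theorem MDiffAlongAt.comp (hf : MDifferentiableAt 𝓘(ℝ, F) 𝓘(ℝ, E) f p)
    {Y : Π x : Q, TangentSpace 𝓘(ℝ, E) x} (hY : MDiffAt (T% Y) (f p)) :
    MDiffAlongAt F f (fun q ↦ Y (f q)) p :=
  MDifferentiableAt.comp p hY hf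

theorem C2AlongAt.comp (hf : ContMDiffAt 𝓘(ℝ, F) 𝓘(ℝ, E) 2 f p)
    {Y : Π x : Q, TangentSpace 𝓘(ℝ, E) x} (hY : SmoothFieldAt Y (f p)) :
    C2AlongAt F f (fun q ↦ Y (f q)) p :=
  ContMDiffAt.comp p (ContMDiffAt.of_le hY (by norm_cast)) hf

theorem MDiffAlongAt.comp_constField (hf : MDifferentiableAt 𝓘(ℝ, F) 𝓘(ℝ, E) f p) {x : Q}
    (hx : f p ∈ (chartAt E x).source) (u : E) :
    MDiffAlongAt F f (fun q ↦ constField x u (f q)) p :=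
  .comp hf (mdiffAt_constField x hx u)

theorem C2AlongAt.comp_constField (hf : ContMDiffAt 𝓘(ℝ, F) 𝓘(ℝ, E) 2 f p) {x : Q}
    (hx : f p ∈ (chartAt E x).source) (u : E) :
    C2AlongAt F f (fun q ↦ constField x u (f q)) p :=
  .comp hf (smoothFieldAt_constField x hx u)

theorem MDiffAlongAt.mfderiv (hf : ContMDiff 𝓘(ℝ, F) 𝓘(ℝ, E) ∞ f)
    {Y : Π q : M, TangentSpace 𝓘(ℝ, F) q} (hY : MDiffAt (T% Y) p) :
    MDiffAlongAt F f (fun q ↦ mfderiv 𝓘(ℝ, F) 𝓘(ℝ, E) f q (Y q)) p :=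
  (((hf.contMDiff_tangentMap (m := 1) (by norm_cast)).mdifferentiable
    (by simp)).mdifferentiableAt).comp p hY

theorem C2AlongAt.mfderiv (hf : ContMDiff 𝓘(ℝ, F) 𝓘(ℝ, E) ∞ f)
    {Y : Π q : M, TangentSpace 𝓘(ℝ, F) q} (hY : SmoothFieldAt Y p) :
    C2AlongAt F f (fun q ↦ mfderiv 𝓘(ℝ, F) 𝓘(ℝ, E) f q (Y q)) p :=
  ((hf.contMDiff_tangentMap (m := 2) (by norm_cast)).contMDiffAt).comp p
    (ContMDiffAt.of_le hY (by norm_cast))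

variable [FiniteDimensional ℝ E]

theorem eventually_eq_sum_constField (hf : ContinuousAt f p) (W : Π p : M, TangentSpace 𝓘(ℝ, E) (f p)) {ι : Type*} [Fintype ι]
    (b : Module.Basis ι ℝ E) : ∀ᶠ q in nhds p, 
    ∑ i, b.coord i (coordVec (f p) (f q) (W q)) • constField (f p) (b i) (f q) = W q := by
  filter_upwards [eventually_mem_source hf (mem_chart_source E (f p))] with q hq
  simp_rw [← constField_smul hq, ← constField_sum hq]
  refine Eq.trans ?_ (constField_coordVec hq (W q))
  rw [← b.sum_repr (coordVec (f p) (f q) (W q))]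
  simp

/-- Near `p` every field along `f` is a finite combination of pulled back coordinate fields. A
property depending only on germs and compatible with sums thus reduces to one function times one
frame field. -/
theorem MDiffAlongAt.induction {P : (Π p : M, TangentSpace 𝓘(ℝ, E) (f p)) → Prop}
    (congr : ∀ V W : (Π p : M, TangentSpace 𝓘(ℝ, E) (f p)),
      (∀ᶠ q in nhds p, V q = W q) → P V → P W)
    (add : ∀ V W : (Π p : M, TangentSpace 𝓘(ℝ, E) (f p)), P V → P W → P (fun q ↦ V q + W q))
    (smul : ∀ (h : M → ℝ) (u : E), MDifferentiableAt 𝓘(ℝ, F) 𝓘(ℝ, ℝ) h p →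
      P (fun q ↦ h q • constField (f p) u (f q)))
    (hW : MDiffAlongAt F f W p) : P W := by
  have key : ∀ (s : Finset (Fin (Module.finrank ℝ E))), P (fun q ↦ ∑ i ∈ s,
      (Module.finBasis ℝ E).coord i (coordVec (f p) (f q) (W q)) •
        constField (f p) (Module.finBasis ℝ E i) (f q)) := fun s ↦ by
    induction s using Finset.cons_induction with
    -- The zero field is the case of a zero coefficient.
    | empty => simpa using smul 0 0 mdifferentiableAt_const
    | cons i s hi ih =>
      simp only [Finset.sum_cons]
      refine add _ _ (smul _ _ ?_) ih
      exact ((LinearMap.toContinuousLinearMap ((Module.finBasis ℝ E).coord i)).mdifferentiableAt).comp p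
        (hW.coord (mem_chart_source E (f p)))
  exact congr _ _ (eventually_eq_sum_constField hW.base.continuousAt W _) (key Finset.univ)

theorem C2AlongAt.induction {P : (Π p : M, TangentSpace 𝓘(ℝ, E) (f p)) → Prop}
    (congr : ∀ V W : (Π p : M, TangentSpace 𝓘(ℝ, E) (f p)),
      (∀ᶠ q in nhds p, V q = W q) → P V → P W)
    (add : ∀ V W : (Π p : M, TangentSpace 𝓘(ℝ, E) (f p)), P V → P W → P (fun q ↦ V q + W q))
    (smul : ∀ (h : M → ℝ) (u : E), ContMDiffAt 𝓘(ℝ, F) 𝓘(ℝ, ℝ) 2 h p →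
      P (fun q ↦ h q • constField (f p) u (f q)))
    (hW : C2AlongAt F f W p) : P W := by
  have key : ∀ (s : Finset (Fin (Module.finrank ℝ E))), P (fun q ↦ ∑ i ∈ s,
      (Module.finBasis ℝ E).coord i (coordVec (f p) (f q) (W q)) •
        constField (f p) (Module.finBasis ℝ E i) (f q)) := fun s ↦ by
    induction s using Finset.cons_induction with
    | empty => simpa using smul 0 0 contMDiffAt_const
    | cons i s hi ih =>
      simp only [Finset.sum_cons]
      refine add _ _ (smul _ _ ?_) ih
      exact ((LinearMap.toContinuousLinearMap ((Module.finBasis ℝ E).coord i)).contMDiff.contMDiffAt).comp p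
        (hW.coord (mem_chart_source E (f p)))
  exact congr _ _ (eventually_eq_sum_constField hW.base.continuousAt W _) (key Finset.univ)

/-! ### The pulled back connection -/

section Cov

variable (cov : CovariantDerivative 𝓘(ℝ, E) E (TangentSpace 𝓘(ℝ, E) : Q → Type _))

theorem cov_congr {Y Z : Π x : Q, TangentSpace 𝓘(ℝ, E) x} {x : Q} (hY : MDiffAt (T% Y) x)
    (h : ∀ᶠ y in nhds x, Y y = Z y) : cov Y x = cov Z x :=
  cov.isCovariantDerivativeOnUniv.congr_of_eventuallyEq hY
    (MDifferentiableAt.congr_of_eventuallyEq hY (h.mono fun q hq ↦ by simp only [hq]))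
    Filter.univ_mem h

theorem cov_add {Y Z : Π x : Q, TangentSpace 𝓘(ℝ, E) x} {x : Q} (hY : MDiffAt (T% Y) x)
    (hZ : MDiffAt (T% Z) x) : cov (fun y ↦ Y y + Z y) x = cov Y x + cov Z x :=
  cov.isCovariantDerivativeOnUniv.add hY hZ

theorem cov_smul {Y : Π x : Q, TangentSpace 𝓘(ℝ, E) x} {h : Q → ℝ} {x : Q}
    (hh : MDifferentiableAt 𝓘(ℝ, E) 𝓘(ℝ, ℝ) h x) (hY : MDiffAt (T% Y) x)
    (v : TangentSpace 𝓘(ℝ, E) x) :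
    cov (fun y ↦ h y • Y y) x v = mvfderiv 𝓘(ℝ, E) h x v • Y x + h x • cov Y x v := by
  have := DFunLike.congr_fun (cov.isCovariantDerivativeOnUniv.leibniz hY hh) v
  rw [add_comm]
  exact this

theorem cov_constField_add {x₀ x : Q} (hx : x ∈ (chartAt E x₀).source) (u v : E) :
    cov (constField x₀ (u + v)) x = cov (constField x₀ u) x + cov (constField x₀ v) x := by
  rw [← cov_add cov (mdiffAt_constField x₀ hx u) (mdiffAt_constField x₀ hx v)]
  refine cov_congr cov (mdiffAt_constField x₀ hx _) ?_
  filter_upwards [(chartAt E x₀).open_source.mem_nhds hx] with y hy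
  exact constField_add hy u v

theorem cov_constField_smul {x₀ x : Q} (hx : x ∈ (chartAt E x₀).source) (c : ℝ) (u : E) :
    cov (constField x₀ (c • u)) x = c • cov (constField x₀ u) x := by
  rw [← cov.isCovariantDerivativeOnUniv.smul_const c (mdiffAt_constField x₀ hx u)]
  refine cov_congr cov (mdiffAt_constField x₀ hx _) ?_
  filter_upwards [(chartAt E x₀).open_source.mem_nhds hx] with y hy
  exact constField_smul hy c u

theorem covAlong_def (p : M) (v : TangentSpace 𝓘(ℝ, F) p) :
    covAlong cov f W p v =
      constField (f p) (mvfderiv 𝓘(ℝ, F) (fun q ↦ coordVec (f p) (f q) (W q)) p v) (f p) +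
      cov (constField (f p) (coordVec (f p) (f p) (W p))) (f p)
        (mfderiv 𝓘(ℝ, F) 𝓘(ℝ, E) f p v) := rfl

theorem mvfderiv_congr {G : Type*} [NormedAddCommGroup G] [NormedSpace ℝ G] {h k : M → G} {p : M}
    (hhk : ∀ᶠ q in nhds p, h q = k q) (v : TangentSpace 𝓘(ℝ, F) p) :
    mvfderiv 𝓘(ℝ, F) h p v = mvfderiv 𝓘(ℝ, F) k p v := by
  have h1 : h =ᶠ[nhds p] k := hhk
  have h2 := h1.mfderiv_eq (I := 𝓘(ℝ, F)) (I' := 𝓘(ℝ, G))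
  exact DFunLike.congr_fun h2 v

theorem covAlong_congr (h : ∀ᶠ q in nhds p, V q = W q) (v : TangentSpace 𝓘(ℝ, F) p) :
    covAlong cov f V p v = covAlong cov f W p v := by
  rw [covAlong_def, covAlong_def, h.self_of_nhds,
    mvfderiv_congr (h.mono fun q hq ↦ by rw [hq]) v]

theorem covAlong_add (hV : MDiffAlongAt F f V p) (hW : MDiffAlongAt F f W p)
    (v : TangentSpace 𝓘(ℝ, F) p) : covAlong cov f (fun q ↦ V q + W q) p v =
      covAlong cov f V p v + covAlong cov f W p v := by
  have hx := mem_chart_source E (f p)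
  have h1 : mvfderiv 𝓘(ℝ, F) (fun q ↦ coordVec (f p) (f q) (V q + W q)) p v =
      mvfderiv 𝓘(ℝ, F) (fun q ↦ coordVec (f p) (f q) (V q)) p v +
      mvfderiv 𝓘(ℝ, F) (fun q ↦ coordVec (f p) (f q) (W q)) p v := by
    rw [mvfderiv_congr (k := fun q ↦ coordVec (f p) (f q) (V q) + coordVec (f p) (f q) (W q)),
      mvfderiv_fun_add (hV.coord hx) (hW.coord hx), add_apply]
    filter_upwards [eventually_mem_source hV.base.continuousAt hx] with q hq
    exact coordVec_add hq _ _
  rw [covAlong_def, covAlong_def, covAlong_def, h1, constField_add hx, coordVec_add hx,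
    cov_constField_add cov hx, add_apply]
  abel

theorem covAlong_smul {h : M → ℝ} (hh : MDifferentiableAt 𝓘(ℝ, F) 𝓘(ℝ, ℝ) h p)
    (hW : MDiffAlongAt F f W p) (v : TangentSpace 𝓘(ℝ, F) p) :
    covAlong cov f (fun q ↦ h q • W q) p v =
      mvfderiv 𝓘(ℝ, F) h p v • W p + h p • covAlong cov f W p v := by
  have hx := mem_chart_source E (f p)
  have h1 : mvfderiv 𝓘(ℝ, F) (fun q ↦ coordVec (f p) (f q) (h q • W q)) p v =
      h p • mvfderiv 𝓘(ℝ, F) (fun q ↦ coordVec (f p) (f q) (W q)) p v +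
      mvfderiv 𝓘(ℝ, F) h p v • coordVec (f p) (f p) (W p) := by
    rw [mvfderiv_congr (k := fun q ↦ h q • coordVec (f p) (f q) (W q)),
      mvfderiv_fun_smul hh (hW.coord hx)]
    · rfl
    filter_upwards [eventually_mem_source hW.base.continuousAt hx] with q hq
    exact coordVec_smul hq _ _
  rw [covAlong_def, covAlong_def, h1, constField_add hx, constField_smul hx, constField_smul hx,
    coordVec_smul hx, cov_constField_smul cov hx, constField_coordVec hx, smul_apply]
  module

/-- Along the identity the pulled back connection is the connection itself, so results for fields
along maps also cover fields on `Q`. -/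
theorem covAlong_id {Y : Π x : Q, TangentSpace 𝓘(ℝ, E) x} {x : Q} (hY : MDiffAt (T% Y) x)
    (v : TangentSpace 𝓘(ℝ, E) x) : covAlong cov (fun x : Q ↦ x) Y x v = cov Y x v := by
  have hx := mem_chart_source E x
  have hm : mfderiv 𝓘(ℝ, E) 𝓘(ℝ, E) (fun x : Q ↦ x) x = ContinuousLinearMap.id ℝ _ :=
    mfderiv_id
  have key : MDiffAlongAt E (fun x : Q ↦ x) Y x ∧
      covAlong cov (fun x : Q ↦ x) Y x v = cov Y x v := by
    refine MDiffAlongAt.induction (f := fun x : Q ↦ x) (p := x) (F := E)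
      (P := fun Y ↦ MDiffAlongAt E (fun x : Q ↦ x) Y x ∧
        covAlong cov (fun x : Q ↦ x) Y x v = cov Y x v) ?_ ?_ ?_ hY
    · rintro V W h ⟨h1, h2⟩
      exact ⟨h1.congr h, by rw [← covAlong_congr cov h, h2, cov_congr cov h1 h]⟩
    · rintro V W ⟨h1, h2⟩ ⟨h3, h4⟩
      refine ⟨h1.add h3, ?_⟩
      rw [covAlong_add cov h1 h3, cov_add cov h1 h3, h2, h4]
      rfl
    · intro h u hh
      have hc := mdiffAt_constField x hx u
      refine ⟨MDiffAlongAt.smul hh hc, ?_⟩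
      rw [covAlong_smul cov hh hc, cov_smul cov hh hc, covAlong_def,
        mvfderiv_congr (k := fun _ ↦ u), mvfderiv_const, coordVec_constField hx]
      · have : constField x (0 : E) x = 0 := by simpa using constField_smul hx 0 (0 : E)
        simp only [this, zero_apply, zero_add, hm, ContinuousLinearMap.id_apply]
      · filter_upwards [eventually_mem_chartAt_source (F := E) x] with y hy
        exact coordVec_constField hy u
  exact key.2

/-- The chain rule for the coordinates of `Y ∘ f`, combined with the expression of `∇Y` in the same
frame. -/
theorem covAlong_comp {Y : Π x : Q, TangentSpace 𝓘(ℝ, E) x}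
    (hf : MDifferentiableAt 𝓘(ℝ, F) 𝓘(ℝ, E) f p) (hY : MDiffAt (T% Y) (f p))
    (v : TangentSpace 𝓘(ℝ, F) p) :
    covAlong cov f (fun q ↦ Y (f q)) p v = cov Y (f p) (mfderiv 𝓘(ℝ, F) 𝓘(ℝ, E) f p v) := by
  have hx := mem_chart_source E (f p)
  have hc : MDifferentiableAt 𝓘(ℝ, E) 𝓘(ℝ, E) (fun x ↦ coordVec (f p) x (Y x)) (f p) :=
    MDiffAlongAt.coord (f := fun x : Q ↦ x) hY hx
  have hm : mfderiv 𝓘(ℝ, E) 𝓘(ℝ, E) (fun x : Q ↦ x) (f p) = ContinuousLinearMap.id ℝ _ :=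
    mfderiv_id
  rw [← covAlong_id cov hY, covAlong_def, covAlong_def, hm, ContinuousLinearMap.id_apply]
  congr 2
  exact mfderiv_comp_apply p hc hf v

theorem covAlong_smul_dir (c : ℝ) (v : TangentSpace 𝓘(ℝ, F) p) :
    covAlong cov f W p (c • v) = c • covAlong cov f W p v := by
  have hx := mem_chart_source E (f p)
  simp only [covAlong_def, map_smul, constField_smul hx, smul_add]

end Cov
end Along
end

noncomputable section
-- Torsion and curvature of the pulled back connection
section LeviCivita

set_option linter.unusedSectionVars false

variable {E : Type*} [NormedAddCommGroup E] [NormedSpace ℝ E] [FiniteDimensional ℝ E]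
  {Q : Type*} [TopologicalSpace Q] [ChartedSpace E Q] [IsManifold 𝓘(ℝ, E) ∞ Q]
  {F : Type*} [NormedAddCommGroup F] [NormedSpace ℝ F]
  {M : Type*} [TopologicalSpace M] [ChartedSpace F M] [IsManifold 𝓘(ℝ, F) ∞ M]
  {g : Π x : Q, TangentSpace 𝓘(ℝ, E) x → TangentSpace 𝓘(ℝ, E) x → ℝ}
  {cov : CovariantDerivative 𝓘(ℝ, E) E (TangentSpace 𝓘(ℝ, E) : Q → Type _)}
  {f : M → Q} {V W : Π p : M, TangentSpace 𝓘(ℝ, E) (f p)} {p : M}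

theorem IsLeviCivita.cov_constField_comm (hcov : IsLeviCivita g cov) {x₀ x : Q}
    (hx : x ∈ (chartAt E x₀).source) (u v : E) :
    cov (constField x₀ u) x (constField x₀ v x) = cov (constField x₀ v) x (constField x₀ u x) := by
  have := hcov.torsion_free x _ _ (mdiffAt_constField x₀ hx v) (mdiffAt_constField x₀ hx u)
  rw [mlieBracket_constField x₀ hx] at this
  exact sub_eq_zero.1 this

/-- `∇_X (df Y) - ∇_Y (df X) = df [X, Y]`. -/
theorem IsLeviCivita.covAlong_torsion (hcov : IsLeviCivita g cov)
    (hf : ContMDiff 𝓘(ℝ, F) 𝓘(ℝ, E) ∞ f) {X Y : Π q : M, TangentSpace 𝓘(ℝ, F) q}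
    (hX : MDiffAt (T% X) p) (hY : MDiffAt (T% Y) p) :
    covAlong cov f (fun q ↦ mfderiv 𝓘(ℝ, F) 𝓘(ℝ, E) f q (Y q)) p (X p) -
      covAlong cov f (fun q ↦ mfderiv 𝓘(ℝ, F) 𝓘(ℝ, E) f q (X q)) p (Y p) =
      mfderiv 𝓘(ℝ, F) 𝓘(ℝ, E) f p (VectorField.mlieBracket 𝓘(ℝ, F) X Y p) := by
  have hx := mem_chart_source E (f p)
  have hfd : ∀ q, MDifferentiableAt 𝓘(ℝ, F) 𝓘(ℝ, E) f q := fun q ↦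
    hf.mdifferentiableAt (by simp)
  -- The coordinates of `df v` are the derivative of the chart expression of `f`, so the torsion
  -- identity becomes `[X, Y] h = X(Yh) - Y(Xh)` for that function, and the connection terms agree
  -- by symmetry.
  have hc : ∀ᶠ q in nhds p, ∀ v : TangentSpace 𝓘(ℝ, F) q,
      coordVec (f p) (f q) (mfderiv 𝓘(ℝ, F) 𝓘(ℝ, E) f q v) =
      mvfderiv 𝓘(ℝ, F) (extChartAt 𝓘(ℝ, E) (f p) ∘ f) q v := by
    filter_upwards [eventually_mem_source (hfd p).continuousAt hx] with q hq v
    rw [coordVec_eq_mfderiv hq]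
    exact (mfderiv_comp_apply q (mdifferentiableAt_extChartAt hq) (hfd q) v).symm
  have hh : ContMDiffAt 𝓘(ℝ, F) 𝓘(ℝ, E) 2 (extChartAt 𝓘(ℝ, E) (f p) ∘ f) p :=
    (contMDiffAt_extChartAt' hx).comp p (hf.contMDiffAt.of_le (by norm_cast))
  have hb := mvfderiv_mlieBracket hh hX hY
  rw [covAlong_def, covAlong_def,
    mvfderiv_congr (hc.mono fun q hq ↦ hq (Y q)), mvfderiv_congr (hc.mono fun q hq ↦ hq (X q))]
  have e1 : mvfderiv 𝓘(ℝ, F) (fun q ↦ mvfderiv 𝓘(ℝ, F) (extChartAt 𝓘(ℝ, E) (f p) ∘ f) q (Y q)) p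
      (X p) = mvfderiv 𝓘(ℝ, F) (extChartAt 𝓘(ℝ, E) (f p) ∘ f) p
        (VectorField.mlieBracket 𝓘(ℝ, F) X Y p) +
        mvfderiv 𝓘(ℝ, F) (fun q ↦ mvfderiv 𝓘(ℝ, F) (extChartAt 𝓘(ℝ, E) (f p) ∘ f) q (X q)) p
      (Y p) := by rw [hb]; abel
  have e2 := hcov.cov_constField_comm hx (coordVec (f p) (f p) (mfderiv 𝓘(ℝ, F) 𝓘(ℝ, E) f p (Y p)))
    (coordVec (f p) (f p) (mfderiv 𝓘(ℝ, F) 𝓘(ℝ, E) f p (X p)))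
  rw [constField_coordVec hx, constField_coordVec hx] at e2
  rw [e1, e2, constField_add hx, ← hc.self_of_nhds, constField_coordVec hx]
  abel

/-- The covariant derivatives of coordinate fields are differentiable. -/
def IsDifferentiableCov
    (cov : CovariantDerivative 𝓘(ℝ, E) E (TangentSpace 𝓘(ℝ, E) : Q → Type _)) : Prop :=
  ∀ (x₀ : Q) (u w : E), MDiffAt (T% fun x ↦ cov (constField x₀ u) x (constField x₀ w x)) x₀

variable (cov) in
/-- The difference `∇_v (∇_c z) - ∇_(∇_v c) z` for the coordinate fields `z`, `c` at `x₀`. -/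
def hessianField (x₀ : Q) (z c : E) (v : TangentSpace 𝓘(ℝ, E) x₀) : TangentSpace 𝓘(ℝ, E) x₀ :=
  cov (fun x ↦ cov (constField x₀ z) x (constField x₀ c x)) x₀ v -
    cov (constField x₀ z) x₀ (cov (constField x₀ c) x₀ v)

theorem hessianField_add (hd : IsDifferentiableCov cov) (x₀ : Q) (z c d : E)
    (v : TangentSpace 𝓘(ℝ, E) x₀) :
    hessianField cov x₀ z (c + d) v = hessianField cov x₀ z c v + hessianField cov x₀ z d v := by
  have hx := mem_chart_source E x₀
  have h1 : cov (fun x ↦ cov (constField x₀ z) x (constField x₀ (c + d) x)) x₀ =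
      cov (fun x ↦ cov (constField x₀ z) x (constField x₀ c x)) x₀ +
      cov (fun x ↦ cov (constField x₀ z) x (constField x₀ d x)) x₀ := by
    rw [← cov_add cov (hd x₀ z c) (hd x₀ z d)]
    refine cov_congr cov (hd x₀ z (c + d)) ?_
    filter_upwards [eventually_mem_chartAt_source (F := E) x₀] with x hx
    rw [constField_add hx, map_add]
  rw [hessianField, hessianField, hessianField, h1, cov_constField_add cov hx, add_apply,
    add_apply, map_add]
  abel

theorem hessianField_smul (hd : IsDifferentiableCov cov) (x₀ : Q) (z c : E) (a : ℝ)
    (v : TangentSpace 𝓘(ℝ, E) x₀) :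
    hessianField cov x₀ z (a • c) v = a • hessianField cov x₀ z c v := by
  have hx := mem_chart_source E x₀
  have h1 : cov (fun x ↦ cov (constField x₀ z) x (constField x₀ (a • c) x)) x₀ =
      a • cov (fun x ↦ cov (constField x₀ z) x (constField x₀ c x)) x₀ := by
    rw [← cov.isCovariantDerivativeOnUniv.smul_const a (hd x₀ z c)]
    refine cov_congr cov (hd x₀ z (a • c)) ?_
    filter_upwards [eventually_mem_chartAt_source (F := E) x₀] with x hx
    rw [constField_smul hx, map_smul]
    rfl
  rw [hessianField, hessianField, h1, cov_constField_smul cov hx, smul_apply, smul_apply,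
    map_smul, smul_sub]

theorem hessianField_add_left (hd : IsDifferentiableCov cov) (x₀ : Q) (z y c : E)
    (v : TangentSpace 𝓘(ℝ, E) x₀) :
    hessianField cov x₀ (z + y) c v = hessianField cov x₀ z c v + hessianField cov x₀ y c v := by
  have hx := mem_chart_source E x₀
  have h1 : cov (fun x ↦ cov (constField x₀ (z + y)) x (constField x₀ c x)) x₀ =
      cov (fun x ↦ cov (constField x₀ z) x (constField x₀ c x)) x₀ +
      cov (fun x ↦ cov (constField x₀ y) x (constField x₀ c x)) x₀ := by
    rw [← cov_add cov (hd x₀ z c) (hd x₀ y c)]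
    refine cov_congr cov (hd x₀ (z + y) c) ?_
    filter_upwards [eventually_mem_chartAt_source (F := E) x₀] with x hx
    rw [cov_constField_add cov hx, add_apply]
  rw [hessianField, hessianField, hessianField, h1, cov_constField_add cov hx, add_apply,
    add_apply]
  abel

theorem hessianField_smul_left (hd : IsDifferentiableCov cov) (x₀ : Q) (z c : E) (a : ℝ)
    (v : TangentSpace 𝓘(ℝ, E) x₀) :
    hessianField cov x₀ (a • z) c v = a • hessianField cov x₀ z c v := by
  have hx := mem_chart_source E x₀
  have h1 : cov (fun x ↦ cov (constField x₀ (a • z)) x (constField x₀ c x)) x₀ =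
      a • cov (fun x ↦ cov (constField x₀ z) x (constField x₀ c x)) x₀ := by
    rw [← cov.isCovariantDerivativeOnUniv.smul_const a (hd x₀ z c)]
    refine cov_congr cov (hd x₀ (a • z) c) ?_
    filter_upwards [eventually_mem_chartAt_source (F := E) x₀] with x hx
    rw [cov_constField_smul cov hx, smul_apply]
    rfl
  rw [hessianField, hessianField, h1, cov_constField_smul cov hx, smul_apply, smul_apply,
    smul_sub]

/-- Curvature is the antisymmetrized second covariant derivative: the correction terms `∇_(∇_a b) z`
and `∇_(∇_b a) z` agree because coordinate fields commute and torsion vanishes. Linearity in each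
slot can then be read off `hessianField`. -/
theorem IsLeviCivita.curvatureAt_eq (hcov : IsLeviCivita g cov) (x : Q)
    (a b c : TangentSpace 𝓘(ℝ, E) x) :
    curvatureAt cov x a b c =
      hessianField cov x (coordVec x x c) (coordVec x x b) a -
      hessianField cov x (coordVec x x c) (coordVec x x a) b := by
  have hx := mem_chart_source E x
  have e2 := hcov.cov_constField_comm hx (coordVec x x a) (coordVec x x b)
  rw [constField_coordVec hx, constField_coordVec hx] at e2
  rw [curvatureAt, curvature, extend_eq_constField, extend_eq_constField, extend_eq_constField,
    mlieBracket_constField x hx, map_zero, constField_coordVec hx, constField_coordVec hx,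
    hessianField, hessianField, e2]
  abel

/-- The product rule for `∇_W z`: the part not differentiating `W` is the second covariant
derivative of `z`, which depends on `W` only through its value at `p`. -/
theorem covAlong_cov_constField (hd : IsDifferentiableCov cov) (z : E)
    (hW : MDiffAlongAt F f W p) :
    MDiffAlongAt F f (fun q ↦ cov (constField (f p) z) (f q) (W q)) p ∧
    ∀ v, covAlong cov f (fun q ↦ cov (constField (f p) z) (f q) (W q)) p v =
      cov (constField (f p) z) (f p) (covAlong cov f W p v) +
        hessianField cov (f p) z (coordVec (f p) (f p) (W p)) (mfderiv 𝓘(ℝ, F) 𝓘(ℝ, E) f p v) := by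
  have hx := mem_chart_source E (f p)
  have hf := hW.base
  suffices h : MDiffAlongAt F f W p ∧
    MDiffAlongAt F f (fun q ↦ cov (constField (f p) z) (f q) (W q)) p ∧
    ∀ v, covAlong cov f (fun q ↦ cov (constField (f p) z) (f q) (W q)) p v =
      cov (constField (f p) z) (f p) (covAlong cov f W p v) +
        hessianField cov (f p) z (coordVec (f p) (f p) (W p))
          (mfderiv 𝓘(ℝ, F) 𝓘(ℝ, E) f p v) from h.2
  refine MDiffAlongAt.induction (p := p) (P := fun W ↦ MDiffAlongAt F f W p ∧
    MDiffAlongAt F f (fun q ↦ cov (constField (f p) z) (f q) (W q)) p ∧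
    ∀ v, covAlong cov f (fun q ↦ cov (constField (f p) z) (f q) (W q)) p v =
      cov (constField (f p) z) (f p) (covAlong cov f W p v) +
        hessianField cov (f p) z (coordVec (f p) (f p) (W p))
          (mfderiv 𝓘(ℝ, F) 𝓘(ℝ, E) f p v)) ?_ ?_ ?_ hW
  · rintro V W h ⟨h1, h2, h3⟩
    have h' : ∀ᶠ q in nhds p, cov (constField (f p) z) (f q) (V q) =
      cov (constField (f p) z) (f q) (W q) := h.mono fun q hq ↦ by rw [hq]
    refine ⟨h1.congr h, h2.congr h', fun v ↦ ?_⟩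
    rw [← covAlong_congr cov h', h3, covAlong_congr cov h, h.self_of_nhds]
  · rintro V W ⟨h1, h2, h3⟩ ⟨k1, k2, k3⟩
    refine ⟨h1.add k1, ?_, fun v ↦ ?_⟩
    · simpa only [map_add] using h2.add k2
    · simp only [map_add]
      rw [covAlong_add cov h2 k2, h3, k3, covAlong_add cov h1 k1, coordVec_add hx,
        hessianField_add hd, map_add]
      abel
  · intro h c hh
    have hk := MDiffAlongAt.comp_constField hf hx c
    have hk2 := MDiffAlongAt.comp hf (hd (f p) z c)
    refine ⟨hk.smul hh, ?_, fun v ↦ ?_⟩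
    · simpa only [map_smul] using hk2.smul hh
    · simp only [map_smul]
      rw [covAlong_smul cov hh hk2, covAlong_smul cov hh hk, covAlong_comp cov hf (hd (f p) z c),
        covAlong_comp cov hf (mdiffAt_constField (f p) hx c), coordVec_smul hx,
        coordVec_constField hx, hessianField_smul hd, hessianField, map_add, map_smul, map_smul]
      module

theorem covAlong_covAlong_smul_constField (hd : IsDifferentiableCov cov)
    (hf : ContMDiff 𝓘(ℝ, F) 𝓘(ℝ, E) ∞ f) {X : Π q : M, TangentSpace 𝓘(ℝ, F) q}
    (hX : MDiffAt (T% X) p) {h : M → ℝ} (hh : ContMDiffAt 𝓘(ℝ, F) 𝓘(ℝ, ℝ) 2 h p) (u : E) :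
    MDiffAlongAt F f (fun q ↦ covAlong cov f (fun q ↦ h q • constField (f p) u (f q)) q (X q)) p ∧
    ∀ v, covAlong cov f
      (fun q ↦ covAlong cov f (fun q ↦ h q • constField (f p) u (f q)) q (X q)) p v =
      mvfderiv 𝓘(ℝ, F) (fun q ↦ mvfderiv 𝓘(ℝ, F) h q (X q)) p v • constField (f p) u (f p) +
      mvfderiv 𝓘(ℝ, F) h p (X p) •
        cov (constField (f p) u) (f p) (mfderiv 𝓘(ℝ, F) 𝓘(ℝ, E) f p v) +
      mvfderiv 𝓘(ℝ, F) h p v •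
        cov (constField (f p) u) (f p) (mfderiv 𝓘(ℝ, F) 𝓘(ℝ, E) f p (X p)) +
      h p • (cov (constField (f p) u) (f p)
        (covAlong cov f (fun q ↦ mfderiv 𝓘(ℝ, F) 𝓘(ℝ, E) f q (X q)) p v) +
        hessianField cov (f p) u (coordVec (f p) (f p) (mfderiv 𝓘(ℝ, F) 𝓘(ℝ, E) f p (X p)))
          (mfderiv 𝓘(ℝ, F) 𝓘(ℝ, E) f p v)) := by
  have hx := mem_chart_source E (f p)
  have hfd : ∀ q, MDifferentiableAt 𝓘(ℝ, F) 𝓘(ℝ, E) f q := fun q ↦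
    hf.mdifferentiableAt (by simp)
  have e : ∀ᶠ q in nhds p,
      mvfderiv 𝓘(ℝ, F) h q (X q) • constField (f p) u (f q) + h q •
        cov (constField (f p) u) (f q) (mfderiv 𝓘(ℝ, F) 𝓘(ℝ, E) f q (X q)) =
      covAlong cov f (fun q ↦ h q • constField (f p) u (f q)) q (X q) := by
    filter_upwards [hh.eventually_mdifferentiableAt,
      eventually_mem_source (hfd p).continuousAt hx] with q hq hq'
    rw [covAlong_smul cov hq (MDiffAlongAt.comp_constField (hfd q) hq' u),
      covAlong_comp cov (hfd q) (mdiffAt_constField (f p) hq' u)]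
  have hhd := hh.mdifferentiableAt (n := 2) (by simp)
  have hXh := mdifferentiableAt_mvfderiv_apply hh hX
  have hk := MDiffAlongAt.comp_constField (hfd p) hx u
  have hc := covAlong_cov_constField hd u (MDiffAlongAt.mfderiv hf hX)
  have h1 := hk.smul hXh
  have h2 := hc.1.smul hhd
  refine ⟨(h1.add h2).congr e, fun v ↦ ?_⟩
  rw [← covAlong_congr cov e, covAlong_add cov h1 h2, covAlong_smul cov hXh hk,
    covAlong_smul cov hhd hc.1, hc.2, covAlong_comp cov (hfd p) (mdiffAt_constField (f p) hx u)]
  abel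

/-- The curvature of the pulled back connection. -/
theorem IsLeviCivita.covAlong_curvature (hcov : IsLeviCivita g cov)
    (hd : IsDifferentiableCov cov) (hf : ContMDiff 𝓘(ℝ, F) 𝓘(ℝ, E) ∞ f)
    {X Y : Π q : M, TangentSpace 𝓘(ℝ, F) q}
    (hX : MDiffAt (T% X) p) (hY : MDiffAt (T% Y) p) (hW : C2AlongAt F f W p) :
    MDiffAlongAt F f (fun q ↦ covAlong cov f W q (X q)) p ∧
    MDiffAlongAt F f (fun q ↦ covAlong cov f W q (Y q)) p ∧
    covAlong cov f (fun q ↦ covAlong cov f W q (Y q)) p (X p) -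
      covAlong cov f (fun q ↦ covAlong cov f W q (X q)) p (Y p) -
      covAlong cov f W p (VectorField.mlieBracket 𝓘(ℝ, F) X Y p) =
    curvatureAt cov (f p) (mfderiv 𝓘(ℝ, F) 𝓘(ℝ, E) f p (X p))
      (mfderiv 𝓘(ℝ, F) 𝓘(ℝ, E) f p (Y p)) (W p) := by
  have hx := mem_chart_source E (f p)
  suffices h : C2AlongAt F f W p ∧
    MDiffAlongAt F f (fun q ↦ covAlong cov f W q (X q)) p ∧
    MDiffAlongAt F f (fun q ↦ covAlong cov f W q (Y q)) p ∧
    covAlong cov f (fun q ↦ covAlong cov f W q (Y q)) p (X p) -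
      covAlong cov f (fun q ↦ covAlong cov f W q (X q)) p (Y p) -
      covAlong cov f W p (VectorField.mlieBracket 𝓘(ℝ, F) X Y p) =
    curvatureAt cov (f p) (mfderiv 𝓘(ℝ, F) 𝓘(ℝ, E) f p (X p))
      (mfderiv 𝓘(ℝ, F) 𝓘(ℝ, E) f p (Y p)) (W p) from h.2
  refine C2AlongAt.induction (p := p) (P := fun W ↦ C2AlongAt F f W p ∧
    MDiffAlongAt F f (fun q ↦ covAlong cov f W q (X q)) p ∧
    MDiffAlongAt F f (fun q ↦ covAlong cov f W q (Y q)) p ∧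
    covAlong cov f (fun q ↦ covAlong cov f W q (Y q)) p (X p) -
      covAlong cov f (fun q ↦ covAlong cov f W q (X q)) p (Y p) -
      covAlong cov f W p (VectorField.mlieBracket 𝓘(ℝ, F) X Y p) =
    curvatureAt cov (f p) (mfderiv 𝓘(ℝ, F) 𝓘(ℝ, E) f p (X p))
      (mfderiv 𝓘(ℝ, F) 𝓘(ℝ, E) f p (Y p)) (W p)) ?_ ?_ ?_ hW
  · rintro V W h ⟨h1, h2, h3, h4⟩
    have h' : ∀ X : Π q : M, TangentSpace 𝓘(ℝ, F) q, ∀ᶠ q in nhds p,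
        covAlong cov f V q (X q) = covAlong cov f W q (X q) := fun X ↦ by
      filter_upwards [h.eventually_nhds] with q hq using covAlong_congr cov hq _
    refine ⟨h1.congr h, h2.congr (h' X), h3.congr (h' Y), ?_⟩
    rw [← covAlong_congr cov (h' X), ← covAlong_congr cov (h' Y), ← covAlong_congr cov h, h4,
      h.self_of_nhds]
  · rintro V W ⟨h1, h2, h3, h4⟩ ⟨k1, k2, k3, k4⟩
    have h' : ∀ X : Π q : M, TangentSpace 𝓘(ℝ, F) q, ∀ᶠ q in nhds p,
        covAlong cov f V q (X q) + covAlong cov f W q (X q) =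
        covAlong cov f (fun q ↦ V q + W q) q (X q) := fun X ↦ by
      filter_upwards [h1.eventually, k1.eventually] with q hq hq'
      rw [covAlong_add cov hq.mdiff hq'.mdiff]
    refine ⟨h1.add k1, (h2.add k2).congr (h' X), (h3.add k3).congr (h' Y), ?_⟩
    rw [← covAlong_congr cov (h' X), ← covAlong_congr cov (h' Y), covAlong_add cov h2 k2,
      covAlong_add cov h3 k3, covAlong_add cov h1.mdiff k1.mdiff]
    rw [hcov.curvatureAt_eq] at h4 k4 ⊢
    rw [coordVec_add hx, hessianField_add_left hd, hessianField_add_left hd]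
    rw [sub_sub, sub_eq_iff_eq_add] at h4 k4
    rw [h4, k4]
    abel
  · intro h u hh
    have hhd := hh.mdifferentiableAt (n := 2) (by simp)
    have hfd := hf.mdifferentiableAt (x := p) (by simp)
    have h1 := covAlong_covAlong_smul_constField hd hf hX hh u
    have h2 := covAlong_covAlong_smul_constField hd hf hY hh u
    have hk := C2AlongAt.comp_constField (F := F) (hf.contMDiffAt.of_le (by norm_cast)) hx u
    refine ⟨hk.smul hh, h1.1, h2.1, ?_⟩
    have ht := hcov.covAlong_torsion hf hX hY
    have hb := mvfderiv_mlieBracket hh hX hY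
    rw [h1.2, h2.2, covAlong_smul cov hhd hk.mdiff,
      covAlong_comp cov hfd (mdiffAt_constField (f p) hx u), hcov.curvatureAt_eq, hb, ← ht,
      coordVec_smul hx, coordVec_constField hx, hessianField_smul_left hd,
      hessianField_smul_left hd, map_sub]
    -- Second derivatives of `h` combine to `[X, Y] h`, mixed first derivatives cancel, torsion
    -- absorbs the connection terms, and the two Hessians remain.
    module

end LeviCivita
end

noncomputable section
-- Regularity of the structure tensors along a map
section TensorsAlong

set_option linter.unusedSectionVars false

variable {E : Type*} [NormedAddCommGroup E] [NormedSpace ℝ E]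
  {Q : Type*} [TopologicalSpace Q] [ChartedSpace E Q] [IsManifold 𝓘(ℝ, E) ∞ Q]
  {F : Type*} [NormedAddCommGroup F] [NormedSpace ℝ F]
  {M : Type*} [TopologicalSpace M] [ChartedSpace F M] [IsManifold 𝓘(ℝ, F) ∞ M]
  {A : AlmostContactBMetric E Q}
  {f : M → Q} {V W : Π p : M, TangentSpace 𝓘(ℝ, E) (f p)} {p : M}

theorem MDiffAlongAt.φ (hW : MDiffAlongAt F f W p) :
    MDiffAlongAt F f (fun q ↦ A.φ (f q) (W q)) p := by
  have h := MDifferentiableAt.comp p ((A.contMDiff_φ (f p)).mdifferentiableAt (by simp)) hW.base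
  exact MDifferentiableAt.clm_bundle_apply (F₁ := E) (F₂ := E) (ϕ := fun q ↦ A.φ (f q)) h hW

theorem C2AlongAt.φ (hW : C2AlongAt F f W p) :
    C2AlongAt F f (fun q ↦ A.φ (f q) (W q)) p := by
  have h := ContMDiffAt.comp p ((A.contMDiff_φ (f p)).of_le (m := 2) (by norm_cast)) hW.base
  exact ContMDiffAt.clm_bundle_apply (F₁ := E) (F₂ := E) (ϕ := fun q ↦ A.φ (f q)) h hW

theorem SmoothFieldAt.φ {Y : Π x : Q, TangentSpace 𝓘(ℝ, E) x} {x : Q} (hY : SmoothFieldAt Y x) :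
    SmoothFieldAt (fun x ↦ A.φ x (Y x)) x :=
  ContMDiffAt.clm_bundle_apply (F₁ := E) (F₂ := E) (b := fun x : Q ↦ x) (ϕ := fun q ↦ A.φ q)
    (A.contMDiff_φ x) hY

theorem MDiffAlongAt.η (hW : MDiffAlongAt F f W p) :
    MDifferentiableAt 𝓘(ℝ, F) 𝓘(ℝ, ℝ) (fun q ↦ A.η (f q) (W q)) p := by
  have h := MDifferentiableAt.comp p ((A.contMDiff_η (f p)).mdifferentiableAt (by simp)) hW.base
  have h2 := MDifferentiableAt.clm_bundle_apply (F₁ := E) (F₂ := ℝ) (E₂ := Bundle.Trivial Q ℝ)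
    (ϕ := fun q ↦ A.η (f q)) h hW
  exact ((Trivialization.mdifferentiableAt_totalSpace_iff _ _
    (e := trivializationAt ℝ (Bundle.Trivial Q ℝ) (f p)) (by simp)).1 h2).2

theorem C2AlongAt.η (hW : C2AlongAt F f W p) :
    ContMDiffAt 𝓘(ℝ, F) 𝓘(ℝ, ℝ) 2 (fun q ↦ A.η (f q) (W q)) p := by
  have h := ContMDiffAt.comp p ((A.contMDiff_η (f p)).of_le (m := 2) (by norm_cast)) hW.base
  have h2 := ContMDiffAt.clm_bundle_apply (F₁ := E) (F₂ := ℝ) (E₂ := Bundle.Trivial Q ℝ)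
    (ϕ := fun q ↦ A.η (f q)) h hW
  exact ((Trivialization.contMDiffAt_iff
    (e := trivializationAt ℝ (Bundle.Trivial Q ℝ) (f p)) (by simp)).1 h2).2

theorem MDiffAlongAt.g (hV : MDiffAlongAt F f V p) (hW : MDiffAlongAt F f W p) :
    MDifferentiableAt 𝓘(ℝ, F) 𝓘(ℝ, ℝ) (fun q ↦ A.g (f q) (V q) (W q)) p := by
  have h := MDifferentiableAt.comp p ((A.contMDiff_g (f p)).mdifferentiableAt (by simp)) hW.base
  have h2 := MDifferentiableAt.clm_bundle_apply₂ (F₁ := E) (F₂ := E) (F₃ := ℝ)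
    (E₃ := Bundle.Trivial Q ℝ) (ψ := fun q ↦ A.g (f q)) h hV hW
  exact ((Trivialization.mdifferentiableAt_totalSpace_iff _ _
    (e := trivializationAt ℝ (Bundle.Trivial Q ℝ) (f p)) (by simp)).1 h2).2

theorem C2AlongAt.g (hV : C2AlongAt F f V p) (hW : C2AlongAt F f W p) :
    ContMDiffAt 𝓘(ℝ, F) 𝓘(ℝ, ℝ) 2 (fun q ↦ A.g (f q) (V q) (W q)) p := by
  have h := ContMDiffAt.comp p ((A.contMDiff_g (f p)).of_le (m := 2) (by norm_cast)) hW.base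
  have h2 := ContMDiffAt.clm_bundle_apply₂ (F₁ := E) (F₂ := E) (F₃ := ℝ)
    (E₃ := Bundle.Trivial Q ℝ) (ψ := fun q ↦ A.g (f q)) h hV hW
  exact ((Trivialization.contMDiffAt_iff
    (e := trivializationAt ℝ (Bundle.Trivial Q ℝ) (f p)) (by simp)).1 h2).2

end TensorsAlong
end

noncomputable section
-- Pointwise algebra of almost contact B-metric structures
namespace AlmostContactBMetric

set_option linter.unusedSectionVars false

variable {E : Type*} [NormedAddCommGroup E] [NormedSpace ℝ E]
  {Q : Type*} [TopologicalSpace Q] [ChartedSpace E Q] [IsManifold 𝓘(ℝ, E) ∞ Q]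
  (A : AlmostContactBMetric E Q) (x : Q)

theorem ξ_ne_zero : A.ξ x ≠ 0 := fun h ↦ by simpa [h] using A.η_ξ x

/-- From `φ²ξ = 0` and the formula for `φ²` at `φξ` one gets `φξ = cξ`; then `0 = φ²ξ = c²ξ` forces
`c = 0`. -/
theorem φ_ξ : A.φ x (A.ξ x) = 0 := by
  have h1 : A.φ x (A.φ x (A.ξ x)) = 0 := by rw [A.φ_φ, A.η_ξ]; module
  have h2 := A.φ_φ x (A.φ x (A.ξ x))
  rw [h1, map_zero] at h2
  have h3 : A.φ x (A.ξ x) = A.η x (A.φ x (A.ξ x)) • A.ξ x := by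
    rw [← sub_eq_zero, ← neg_eq_zero, h2]; module
  generalize A.η x (A.φ x (A.ξ x)) = c at h3
  rw [h3, map_smul, h3, smul_smul] at h1
  have h5 := (smul_eq_zero.1 h1).resolve_right (A.ξ_ne_zero x)
  rw [h3, mul_self_eq_zero.1 h5, zero_smul]

theorem η_φ (v : TangentSpace 𝓘(ℝ, E) x) : A.η x (A.φ x v) = 0 := by
  have h1 := A.φ_φ x (A.φ x v)
  rw [A.φ_φ x v, map_add, map_smul, A.φ_ξ, map_neg, smul_zero, add_zero] at h1
  exact (smul_eq_zero.1 (left_eq_add.1 h1)).resolve_right (A.ξ_ne_zero x)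

theorem g_ξ_ξ : A.g x (A.ξ x) (A.ξ x) = 1 := by
  have h := A.g_φ_φ x (A.ξ x) (A.ξ x)
  simp only [A.φ_ξ, map_zero, A.η_ξ] at h
  linarith

theorem g_ξ_right (v : TangentSpace 𝓘(ℝ, E) x) : A.g x v (A.ξ x) = A.η x v := by
  have h := A.g_φ_φ x v (A.ξ x)
  simp only [A.φ_ξ, map_zero, A.η_ξ] at h
  linarith

theorem g_ξ_left (v : TangentSpace 𝓘(ℝ, E) x) : A.g x (A.ξ x) v = A.η x v := by
  rw [A.g_symm, A.g_ξ_right]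

theorem g_φ_left (v w : TangentSpace 𝓘(ℝ, E) x) : A.g x (A.φ x v) w = A.g x v (A.φ x w) := by
  have h := A.g_φ_φ x (A.φ x v) w
  rw [A.φ_φ, A.η_φ, map_add, map_smul, map_neg, add_apply, neg_apply, smul_apply, A.g_ξ_left,
    A.η_φ] at h
  simp at h
  linarith

theorem eq_of_g {v w : TangentSpace 𝓘(ℝ, E) x} (h : ∀ z, A.g x v z = A.g x w z) : v = w := by
  rw [← sub_eq_zero]
  refine A.g_nondegenerate x _ fun z ↦ ?_
  rw [map_sub, sub_apply, h, sub_self]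

theorem eq_zero_of_φ_eq_zero {v : TangentSpace 𝓘(ℝ, E) x} (h : A.φ x v = 0) (h' : A.η x v = 0) :
    v = 0 := by
  have := A.φ_φ x v
  rw [h, h', map_zero, zero_smul, add_zero] at this
  exact neg_eq_zero.1 this.symm

/-- Testing on `ξ` gives `η(v) = 0`; then `g(φv, ·) = 0`, and `φ` is injective on `ker η`. -/
theorem assocMetric_nondegenerate {v : TangentSpace 𝓘(ℝ, E) x}
    (h : ∀ w, A.assocMetric x v w = 0) : v = 0 := by
  have h1 : A.η x v = 0 := by
    have := h (A.ξ x)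
    simpa [assocMetric, A.φ_ξ, A.η_ξ] using this
  refine A.eq_zero_of_φ_eq_zero x ?_ h1
  refine A.g_nondegenerate x _ fun w ↦ ?_
  have := h w
  rw [assocMetric, h1, zero_mul, add_zero] at this
  rw [A.g_φ_left, this]

end AlmostContactBMetric

/-! ### Parallel tensors in the class `F₀` -/

section Parallel

set_option linter.unusedSectionVars false

variable {E : Type*} [NormedAddCommGroup E] [NormedSpace ℝ E] [FiniteDimensional ℝ E]
  {Q : Type*} [TopologicalSpace Q] [ChartedSpace E Q] [IsManifold 𝓘(ℝ, E) ∞ Q]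
  {F : Type*} [NormedAddCommGroup F] [NormedSpace ℝ F]
  {M : Type*} [TopologicalSpace M] [ChartedSpace F M] [IsManifold 𝓘(ℝ, F) ∞ M]
  {A : AlmostContactBMetric E Q}
  {cov : CovariantDerivative 𝓘(ℝ, E) E (TangentSpace 𝓘(ℝ, E) : Q → Type _)}
  {f : M → Q} {V W : Π p : M, TangentSpace 𝓘(ℝ, E) (f p)} {p : M}

theorem mvfderiv_mul_apply {h k : M → ℝ} (hh : MDifferentiableAt 𝓘(ℝ, F) 𝓘(ℝ, ℝ) h p)
    (hk : MDifferentiableAt 𝓘(ℝ, F) 𝓘(ℝ, ℝ) k p) (v : TangentSpace 𝓘(ℝ, F) p) :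
    mvfderiv 𝓘(ℝ, F) (fun q ↦ h q * k q) p v =
      mvfderiv 𝓘(ℝ, F) h p v * k p + h p * mvfderiv 𝓘(ℝ, F) k p v := by
  have h1 := DFunLike.congr_fun (mvfderiv_mul hh hk) v
  rw [mul_comm, add_comm]
  exact h1

theorem mvfderiv_add_apply {h k : M → ℝ} (hh : MDifferentiableAt 𝓘(ℝ, F) 𝓘(ℝ, ℝ) h p)
    (hk : MDifferentiableAt 𝓘(ℝ, F) 𝓘(ℝ, ℝ) k p) (v : TangentSpace 𝓘(ℝ, F) p) :
    mvfderiv 𝓘(ℝ, F) (fun q ↦ h q + k q) p v =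
      mvfderiv 𝓘(ℝ, F) h p v + mvfderiv 𝓘(ℝ, F) k p v :=
  DFunLike.congr_fun (mvfderiv_add hh hk) v

theorem IsLeviCivita.mvfderiv_g (hcov : IsLeviCivita A.metric cov)
    (hV : MDiffAlongAt F f V p) (hW : MDiffAlongAt F f W p) (v : TangentSpace 𝓘(ℝ, F) p) :
    mvfderiv 𝓘(ℝ, F) (fun q ↦ A.g (f q) (V q) (W q)) p v =
      A.g (f p) (covAlong cov f V p v) (W p) + A.g (f p) (V p) (covAlong cov f W p v) := by
  have hx := mem_chart_source E (f p)
  have hf := hV.base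
  have base : ∀ u w : E, mvfderiv 𝓘(ℝ, F)
      (fun q ↦ A.g (f q) (constField (f p) u (f q)) (constField (f p) w (f q))) p v =
      A.g (f p) (covAlong cov f (fun q ↦ constField (f p) u (f q)) p v) (constField (f p) w (f p)) +
      A.g (f p) (constField (f p) u (f p))
        (covAlong cov f (fun q ↦ constField (f p) w (f q)) p v) := fun u w ↦ by
    have hu := mdiffAt_constField (f p) hx u
    have hw := mdiffAt_constField (f p) hx w
    rw [covAlong_comp cov hf hu, covAlong_comp cov hf hw]
    have h1 := hcov.metric (f p) (mfderiv 𝓘(ℝ, F) 𝓘(ℝ, E) f p v) _ _ hu hw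
    refine Eq.trans ?_ h1
    have hd : MDifferentiableAt 𝓘(ℝ, E) 𝓘(ℝ, ℝ)
      (fun x ↦ A.g x (constField (f p) u x) (constField (f p) w x)) (f p) :=
      MDiffAlongAt.g (f := fun x : Q ↦ x) hu hw
    exact mfderiv_comp_apply p hd hf v
  -- Metricity is extended to fields along `f` one argument at a time, first with a coordinate field
  -- in the other slot.
  have step : ∀ u : E, MDiffAlongAt F f W p ∧ mvfderiv 𝓘(ℝ, F)
      (fun q ↦ A.g (f q) (constField (f p) u (f q)) (W q)) p v =
      A.g (f p) (covAlong cov f (fun q ↦ constField (f p) u (f q)) p v) (W p) +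
      A.g (f p) (constField (f p) u (f p)) (covAlong cov f W p v) := fun u ↦ by
    have hu := MDiffAlongAt.comp_constField hf hx u
    refine MDiffAlongAt.induction (p := p) (P := fun W ↦ MDiffAlongAt F f W p ∧ mvfderiv 𝓘(ℝ, F)
      (fun q ↦ A.g (f q) (constField (f p) u (f q)) (W q)) p v =
      A.g (f p) (covAlong cov f (fun q ↦ constField (f p) u (f q)) p v) (W p) +
      A.g (f p) (constField (f p) u (f p)) (covAlong cov f W p v)) ?_ ?_ ?_ hW
    · rintro V W h ⟨h1, h2⟩
      refine ⟨h1.congr h, ?_⟩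
      rw [← covAlong_congr cov h, ← h.self_of_nhds, ← h2]
      exact mvfderiv_congr (h.mono fun q hq ↦ by rw [hq]) v
    · rintro V W ⟨h1, h2⟩ ⟨k1, k2⟩
      refine ⟨h1.add k1, ?_⟩
      simp only [map_add]
      rw [mvfderiv_add_apply (hu.g h1) (hu.g k1), covAlong_add cov h1 k1, h2, k2, map_add]
      ring
    · intro h w hh
      have hw := MDiffAlongAt.comp_constField hf hx w
      refine ⟨hw.smul hh, ?_⟩
      simp only [map_smul, smul_eq_mul]
      rw [mvfderiv_mul_apply hh (hu.g hw), covAlong_smul cov hh hw, base, map_add, map_smul,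
        map_smul, smul_eq_mul, smul_eq_mul]
      ring
  suffices h : MDiffAlongAt F f V p ∧ mvfderiv 𝓘(ℝ, F) (fun q ↦ A.g (f q) (V q) (W q)) p v =
      A.g (f p) (covAlong cov f V p v) (W p) + A.g (f p) (V p) (covAlong cov f W p v) from h.2
  refine MDiffAlongAt.induction (p := p) (P := fun V ↦ MDiffAlongAt F f V p ∧
    mvfderiv 𝓘(ℝ, F) (fun q ↦ A.g (f q) (V q) (W q)) p v =
      A.g (f p) (covAlong cov f V p v) (W p) + A.g (f p) (V p) (covAlong cov f W p v)) ?_ ?_ ?_ hV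
  · rintro V V' h ⟨h1, h2⟩
    refine ⟨h1.congr h, ?_⟩
    rw [← covAlong_congr cov h, ← h.self_of_nhds, ← h2]
    exact mvfderiv_congr (h.mono fun q hq ↦ by rw [hq]) v
  · rintro V V' ⟨h1, h2⟩ ⟨k1, k2⟩
    refine ⟨h1.add k1, ?_⟩
    simp only [map_add, add_apply]
    rw [mvfderiv_add_apply (h1.g hW) (k1.g hW), covAlong_add cov h1 k1, h2, k2, map_add, add_apply]
    ring
  · intro h w hh
    have hw := MDiffAlongAt.comp_constField hf hx w
    refine ⟨hw.smul hh, ?_⟩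
    simp only [map_smul, smul_apply, smul_eq_mul]
    rw [mvfderiv_mul_apply hh (hw.g hW), covAlong_smul cov hh hw, (step w).2, map_add, map_smul,
      map_smul, add_apply, smul_apply, smul_apply, smul_eq_mul, smul_eq_mul]
    ring

theorem AlmostContactBMetric.IsF0.cov_φ (hF0 : A.IsF0 cov) {Y : Π x : Q, TangentSpace 𝓘(ℝ, E) x}
    {x : Q} (hY : SmoothFieldAt Y x) (v : TangentSpace 𝓘(ℝ, E) x) :
    cov (fun x ↦ A.φ x (Y x)) x v = A.φ x (cov Y x v) :=
  sub_eq_zero.1 (A.g_nondegenerate x _ fun w ↦ hF0 x v w Y hY)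

theorem AlmostContactBMetric.IsF0.covAlong_φ (hF0 : A.IsF0 cov) (hW : MDiffAlongAt F f W p)
    (v : TangentSpace 𝓘(ℝ, F) p) :
    covAlong cov f (fun q ↦ A.φ (f q) (W q)) p v = A.φ (f p) (covAlong cov f W p v) := by
  have hx := mem_chart_source E (f p)
  have hf := hW.base
  suffices h : MDiffAlongAt F f W p ∧
    covAlong cov f (fun q ↦ A.φ (f q) (W q)) p v = A.φ (f p) (covAlong cov f W p v) from h.2
  refine MDiffAlongAt.induction (p := p) (P := fun W ↦ MDiffAlongAt F f W p ∧
    covAlong cov f (fun q ↦ A.φ (f q) (W q)) p v = A.φ (f p) (covAlong cov f W p v)) ?_ ?_ ?_ hW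
  · rintro V W h ⟨h1, h2⟩
    refine ⟨h1.congr h, ?_⟩
    rw [← covAlong_congr cov h, ← h2]
    exact (covAlong_congr cov (h.mono fun q hq ↦ by rw [hq]) v).symm
  · rintro V W ⟨h1, h2⟩ ⟨k1, k2⟩
    refine ⟨h1.add k1, ?_⟩
    simp only [map_add]
    rw [covAlong_add cov h1.φ k1.φ, covAlong_add cov h1 k1, h2, k2, map_add]
  · intro h w hh
    have hw := MDiffAlongAt.comp_constField hf hx w
    have hs := smoothFieldAt_constField (f p) hx w
    refine ⟨hw.smul hh, ?_⟩
    simp only [map_smul]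
    have e := covAlong_comp cov hf (Y := fun x ↦ A.φ x (constField (f p) w x))
      (hs.φ.mdifferentiableAt (by simp)) v
    rw [hF0.cov_φ hs] at e
    rw [covAlong_smul cov hh hw.φ, e, covAlong_smul cov hh hw, map_add, map_smul, map_smul,
      covAlong_comp cov hf (hs.mdifferentiableAt (by simp))]

theorem AlmostContactBMetric.mdiffAt_ξ (A : AlmostContactBMetric E Q) (x : Q) :
    MDiffAt (T% A.ξ) x :=
  (A.contMDiff_ξ x).mdifferentiableAt (by simp)

/-- Differentiating `φξ = 0` gives `φ(∇ξ) = 0`, and differentiating `g(ξ, ξ) = 1` gives `η(∇ξ) = 0`;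
together these kill `∇ξ`. -/
theorem AlmostContactBMetric.IsF0.cov_ξ (hF0 : A.IsF0 cov) (hcov : IsLeviCivita A.metric cov)
    (x : Q) : cov A.ξ x = 0 := by
  ext v
  have h1 := hF0.cov_φ (A.contMDiff_ξ x) v
  have h2 : (fun x ↦ A.φ x (A.ξ x)) = fun x ↦ (0 : TangentSpace 𝓘(ℝ, E) x) :=
    funext fun x ↦ A.φ_ξ x
  have h3 : cov (fun x ↦ (0 : TangentSpace 𝓘(ℝ, E) x)) x = 0 :=
    cov.isCovariantDerivativeOnUniv.zero
  rw [h2, h3, zero_apply] at h1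
  refine A.eq_zero_of_φ_eq_zero x h1.symm ?_
  have h4 := hcov.metric x v _ _ (A.mdiffAt_ξ x) (A.mdiffAt_ξ x)
  have h5 : (fun x ↦ A.metric x (A.ξ x) (A.ξ x)) = fun _ ↦ (1 : ℝ) := funext fun x ↦ A.g_ξ_ξ x
  rw [h5, mvfderiv_const, AlmostContactBMetric.metric, AlmostContactBMetric.metric, A.g_ξ_left,
    A.g_ξ_right, zero_apply] at h4
  linarith

theorem AlmostContactBMetric.IsF0.covAlong_ξ (hF0 : A.IsF0 cov)
    (hcov : IsLeviCivita A.metric cov) (hf : MDifferentiableAt 𝓘(ℝ, F) 𝓘(ℝ, E) f p)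
    (v : TangentSpace 𝓘(ℝ, F) p) : covAlong cov f (fun q ↦ A.ξ (f q)) p v = 0 := by
  rw [covAlong_comp cov hf (A.mdiffAt_ξ _), hF0.cov_ξ hcov, zero_apply]

theorem AlmostContactBMetric.IsF0.mvfderiv_η (hF0 : A.IsF0 cov) (hcov : IsLeviCivita A.metric cov)
    (hW : MDiffAlongAt F f W p) (v : TangentSpace 𝓘(ℝ, F) p) :
    mvfderiv 𝓘(ℝ, F) (fun q ↦ A.η (f q) (W q)) p v = A.η (f p) (covAlong cov f W p v) := by
  have hξ := MDiffAlongAt.comp hW.base (A.mdiffAt_ξ _)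
  have h := hcov.mvfderiv_g hW hξ v
  simp only [A.g_ξ_right, hF0.covAlong_ξ hcov hW.base, map_zero, add_zero] at h
  exact h

/-- The associated metric is built from parallel tensors, so the connection of `g` is metric for it
too. -/
theorem AlmostContactBMetric.IsF0.mvfderiv_assocMetric (hF0 : A.IsF0 cov)
    (hcov : IsLeviCivita A.metric cov)
    (hV : MDiffAlongAt F f V p) (hW : MDiffAlongAt F f W p) (v : TangentSpace 𝓘(ℝ, F) p) :
    mvfderiv 𝓘(ℝ, F) (fun q ↦ A.assocMetric (f q) (V q) (W q)) p v =
      A.assocMetric (f p) (covAlong cov f V p v) (W p) +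
        A.assocMetric (f p) (V p) (covAlong cov f W p v) := by
  have h1 := hcov.mvfderiv_g hV (hW.φ (A := A)) v
  simp only [AlmostContactBMetric.assocMetric]
  have hVη := hV.η (A := A)
  have hWη := hW.η (A := A)
  have h2 := mvfderiv_add_apply (hV.g (A := A) (hW.φ (A := A))) (hVη.mul hWη) v
  have h3 := mvfderiv_mul_apply hVη hWη v
  refine h2.trans ?_
  rw [h1]
  refine (congrArg _ h3).trans ?_
  rw [hF0.mvfderiv_η hcov hV, hF0.mvfderiv_η hcov hW, hF0.covAlong_φ hW]
  ring

end Parallel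
end

noncomputable section
-- The ambient connection and the symmetries of its curvature
section AmbientCurvature

set_option linter.unusedSectionVars false

variable {E : Type*} [NormedAddCommGroup E] [NormedSpace ℝ E] [FiniteDimensional ℝ E]
  {Q : Type*} [TopologicalSpace Q] [ChartedSpace E Q] [IsManifold 𝓘(ℝ, E) ∞ Q]
  {A : AlmostContactBMetric E Q}
  {cov cov' : CovariantDerivative 𝓘(ℝ, E) E (TangentSpace 𝓘(ℝ, E) : Q → Type _)}

theorem MDifferentiableAt.pi {ι : Type*} [Fintype ι] {h : Q → ι → ℝ} {x : Q}
    (hh : ∀ i, MDifferentiableAt 𝓘(ℝ, E) 𝓘(ℝ, ℝ) (fun y ↦ h y i) x) :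
    MDifferentiableAt 𝓘(ℝ, E) 𝓘(ℝ, ι → ℝ) h x := by
  simp only [mdifferentiableAt_iff] at hh ⊢
  exact ⟨continuousAt_pi.2 fun i ↦ (hh i).1, differentiableWithinAt_pi.2 fun i ↦ (hh i).2⟩

theorem eventually_mdiffAt_constField (x₀ : Q) (u : E) :
    ∀ᶠ x in nhds x₀, MDiffAt (T% (constField x₀ u)) x := by
  filter_upwards [eventually_mem_chartAt_source (F := E) x₀] with x hx
  exact mdiffAt_constField x₀ hx u

theorem c2_constField (x₀ : Q) (u : E) : C2AlongAt E (fun x : Q ↦ x) (constField x₀ u) x₀ :=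
  ContMDiffAt.of_le (smoothFieldAt_constField x₀ (mem_chart_source E x₀) u) (by norm_cast)

/-- Koszul's formula for coordinate fields. -/
theorem IsLeviCivita.koszul_constField (hcov : IsLeviCivita A.metric cov) {x₀ x : Q}
    (hx : x ∈ (chartAt E x₀).source) (u w t : E) :
    2 * A.g x (cov (constField x₀ u) x (constField x₀ w x)) (constField x₀ t x) =
      mvfderiv 𝓘(ℝ, E) (fun x ↦ A.g x (constField x₀ u x) (constField x₀ t x)) x
        (constField x₀ w x) +
      mvfderiv 𝓘(ℝ, E) (fun x ↦ A.g x (constField x₀ w x) (constField x₀ t x)) x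
        (constField x₀ u x) -
      mvfderiv 𝓘(ℝ, E) (fun x ↦ A.g x (constField x₀ u x) (constField x₀ w x)) x
        (constField x₀ t x) := by
  have hm := fun u ↦ mdiffAt_constField x₀ hx u
  have h1 := hcov.metric x (constField x₀ w x) _ _ (hm u) (hm t)
  have h2 := hcov.metric x (constField x₀ u x) _ _ (hm w) (hm t)
  have h3 := hcov.metric x (constField x₀ t x) _ _ (hm u) (hm w)
  simp only [AlmostContactBMetric.metric] at h1 h2 h3
  rw [h1, h2, h3, hcov.cov_constField_comm hx w u, hcov.cov_constField_comm hx t w,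
    hcov.cov_constField_comm hx t u, A.g_symm x (constField x₀ w x)]
  ring

/-- Koszul's formula gives the inner products of `∇_w u` with the frame as first derivatives of
metric coefficients. Inverting the Gram matrix, which is nondegenerate at `x₀`, transfers
differentiability to `∇_w u` itself. -/
theorem IsLeviCivita.isDifferentiableCov (hcov : IsLeviCivita A.metric cov) :
    IsDifferentiableCov cov := by
  intro x₀ u w
  have hx₀ := mem_chart_source E x₀
  have hc := fun u ↦ c2_constField (E := E) x₀ u
  refine (mdiffAt_iff_coordVec (b := fun x : Q ↦ x) hx₀).2 ⟨mdifferentiableAt_id, ?_⟩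
  let e := trivializationAt E (TangentSpace 𝓘(ℝ, E) : Q → Type _) x₀
  let b := Module.finBasis ℝ E
  let B : Q → E →L[ℝ] (Fin (Module.finrank ℝ E) → ℝ) := fun x ↦
    ContinuousLinearMap.pi fun k ↦ (A.g x (constField x₀ (b k) x)).comp (e.symmL ℝ x)
  have hB : ∀ {x : Q}, x ∈ (chartAt E x₀).source → ∀ u k,
      B x u k = A.g x (constField x₀ u x) (constField x₀ (b k) x) :=
    fun {x} hx u k ↦ by
      change A.g x (constField x₀ (b k) x) (e.symmL ℝ x u) = _
      rw [e.symmL_apply (R := ℝ) (by simpa [e] using hx), A.g_symm]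
      rfl
  refine mdifferentiableAt_of_clm_apply (A := B) ?_ ?_ ?_
  · intro u
    refine MDifferentiableAt.pi fun k ↦ ?_
    refine ((hc u).mdiff.g (A := A) (hc (b k)).mdiff).congr_of_eventuallyEq ?_
    filter_upwards [eventually_mem_chartAt_source (F := E) x₀] with x hx using hB hx u k
  · refine (injective_iff_map_eq_zero _).2 fun u hu ↦ ?_
    have h1 : constField x₀ u x₀ = 0 := by
      refine A.g_nondegenerate x₀ _ fun w ↦ ?_
      rw [← constField_coordVec hx₀ w, ← b.sum_repr (coordVec x₀ x₀ w), constField_sum hx₀, map_sum]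
      refine Finset.sum_eq_zero fun k _ ↦ ?_
      rw [constField_smul hx₀, map_smul, ← hB hx₀, hu]
      simp
    rw [← coordVec_constField hx₀ u, h1, coordVec_self]
    rfl
  · refine MDifferentiableAt.pi fun k ↦ ?_
    have hd : ∀ u w t : E, MDifferentiableAt 𝓘(ℝ, E) 𝓘(ℝ, ℝ) (fun x ↦
        mvfderiv 𝓘(ℝ, E) (fun x ↦ A.g x (constField x₀ u x) (constField x₀ t x)) x
          (constField x₀ w x)) x₀ := fun u w t ↦
      mdifferentiableAt_mvfderiv_apply ((hc u).g (hc t)) (hc w).mdiff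
    have h := (((hd u w (b k)).add (hd w u (b k))).sub (hd u (b k) w)).const_smul (1 / 2 : ℝ)
    refine MDifferentiableAt.congr_of_eventuallyEq h ?_
    filter_upwards [eventually_mem_chartAt_source (F := E) x₀] with x hx
    rw [hB hx, constField_coordVec hx]
    have := hcov.koszul_constField hx u w (b k)
    simp only [Pi.smul_apply, Pi.add_apply, Pi.sub_apply, smul_eq_mul]
    rw [← this]
    ring

/-- Alternating the two symmetries six times returns to the original arguments after three sign
changes. Applied to the difference of two torsion-free metric connections, it yields the uniqueness
of the Levi-Civita connection. -/
theorem eq_zero_of_symm_of_skew {V : Type*} {T : V → V → V → ℝ}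
    (h1 : ∀ u v w, T u v w = T v u w) (h2 : ∀ u v w, T u v w + T u w v = 0) (u v w : V) :
    T u v w = 0 := by
  linarith [h1 u v w, h2 v u w, h1 v w u, h2 w v u, h1 w u v, h2 u w v]

theorem AlmostContactBMetric.IsF0.cov_eq (hF0 : A.IsF0 cov) (hcov : IsLeviCivita A.metric cov)
    (hcov' : IsLeviCivita A.assocMetric cov') {Y : Π x : Q, TangentSpace 𝓘(ℝ, E) x} {x : Q}
    (hY : MDiffAt (T% Y) x) : cov' Y x = cov Y x := by
  have hx := mem_chart_source E x
  have base : ∀ u : E, cov' (constField x u) x = cov (constField x u) x := by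
    intro u
    ext v
    rw [← sub_eq_zero]
    refine A.assocMetric_nondegenerate x fun w ↦ ?_
    -- The difference tensor is symmetric since both connections are torsion-free, and skew since
    -- both are metric for `g̃`.
    have key := eq_zero_of_symm_of_skew (T := fun w u v : E ↦
      A.assocMetric x (cov' (constField x u) x (constField x w x) -
        cov (constField x u) x (constField x w x)) (constField x v x))
      (fun w u v ↦ by
        rw [hcov.cov_constField_comm hx, hcov'.cov_constField_comm hx])
      (fun w u v ↦ by
        have h1 := hcov'.metric x (constField x w x) _ _ (mdiffAt_constField x hx u)
          (mdiffAt_constField x hx v)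
        have h2 := hF0.mvfderiv_assocMetric (f := fun x : Q ↦ x) hcov (mdiffAt_constField x hx u)
          (mdiffAt_constField x hx v) (constField x w x)
        rw [covAlong_id cov (mdiffAt_constField x hx u),
          covAlong_id cov (mdiffAt_constField x hx v)] at h2
        rw [h2] at h1
        have hs : ∀ a b, A.assocMetric x a b = A.assocMetric x b a := fun a b ↦ by
          simp only [AlmostContactBMetric.assocMetric]
          rw [← A.g_φ_left, A.g_symm]; ring
        rw [hs (constField x u x), hs (constField x u x)] at h1
        simp only [AlmostContactBMetric.assocMetric, map_sub, sub_apply] at h1 ⊢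
        linarith)
      (coordVec x x v) u (coordVec x x w)
    simpa only [constField_coordVec hx] using key
  ext v
  rw [← covAlong_id cov hY, ← covAlong_id cov' hY, covAlong_def, covAlong_def, base]

theorem AlmostContactBMetric.IsF0.curvatureAt_eq (hF0 : A.IsF0 cov)
    (hcov : IsLeviCivita A.metric cov) (hcov' : IsLeviCivita A.assocMetric cov') (x : Q)
    (a b c : TangentSpace 𝓘(ℝ, E) x) : curvatureAt cov' x a b c = curvatureAt cov x a b c := by
  have hx := mem_chart_source E x
  have hH : ∀ (z c : E) v, hessianField cov' x z c v = hessianField cov x z c v := fun z c v ↦ by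
    have h1 : cov (fun y ↦ cov (constField x z) y (constField x c y)) x =
        cov' (fun y ↦ cov' (constField x z) y (constField x c y)) x := by
      rw [← hF0.cov_eq hcov hcov' (hcov.isDifferentiableCov x z c)]
      refine cov_congr cov' (hcov.isDifferentiableCov x z c) ?_
      filter_upwards [eventually_mdiffAt_constField x z] with y hy
      rw [hF0.cov_eq hcov hcov' hy]
    rw [hessianField, hessianField, h1, hF0.cov_eq hcov hcov' (mdiffAt_constField x hx _),
      hF0.cov_eq hcov hcov' (mdiffAt_constField x hx _)]
  rw [hcov'.curvatureAt_eq, hcov.curvatureAt_eq, hH, hH]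

theorem IsLeviCivita.curvatureAt_swap (hcov : IsLeviCivita A.metric cov) (x : Q)
    (a b c : TangentSpace 𝓘(ℝ, E) x) : curvatureAt cov x a b c = -curvatureAt cov x b a c := by
  rw [hcov.curvatureAt_eq, hcov.curvatureAt_eq]; abel

theorem IsLeviCivita.curvatureAt_add_left (hcov : IsLeviCivita A.metric cov) (x : Q)
    (a a' b c : TangentSpace 𝓘(ℝ, E) x) :
    curvatureAt cov x (a + a') b c = curvatureAt cov x a b c + curvatureAt cov x a' b c := by
  have hx := mem_chart_source E x
  simp only [hcov.curvatureAt_eq, coordVec_add hx, hessianField_add hcov.isDifferentiableCov]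
  simp only [hessianField, map_add]
  abel

theorem IsLeviCivita.curvatureAt_smul_left (hcov : IsLeviCivita A.metric cov) (x : Q) (r : ℝ)
    (a b c : TangentSpace 𝓘(ℝ, E) x) :
    curvatureAt cov x (r • a) b c = r • curvatureAt cov x a b c := by
  have hx := mem_chart_source E x
  simp only [hcov.curvatureAt_eq, coordVec_smul hx, hessianField_smul hcov.isDifferentiableCov]
  simp only [hessianField, map_smul]
  module

theorem IsLeviCivita.curvatureAt_add_right (hcov : IsLeviCivita A.metric cov) (x : Q)
    (a b c c' : TangentSpace 𝓘(ℝ, E) x) :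
    curvatureAt cov x a b (c + c') = curvatureAt cov x a b c + curvatureAt cov x a b c' := by
  have hx := mem_chart_source E x
  simp only [hcov.curvatureAt_eq, coordVec_add hx, hessianField_add_left hcov.isDifferentiableCov]
  abel

theorem IsLeviCivita.curvatureAt_smul_right (hcov : IsLeviCivita A.metric cov) (x : Q) (r : ℝ)
    (a b c : TangentSpace 𝓘(ℝ, E) x) :
    curvatureAt cov x a b (r • c) = r • curvatureAt cov x a b c := by
  have hx := mem_chart_source E x
  simp only [hcov.curvatureAt_eq, coordVec_smul hx, hessianField_smul_left hcov.isDifferentiableCov]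
  module

theorem curvatureAt_eq_sub (x : Q) (a b c : TangentSpace 𝓘(ℝ, E) x) :
    curvatureAt cov x a b c =
      cov (fun y ↦ cov (constField x (coordVec x x c)) y (constField x (coordVec x x b) y)) x a -
      cov (fun y ↦ cov (constField x (coordVec x x c)) y (constField x (coordVec x x a) y)) x b := by
  have hx := mem_chart_source E x
  rw [curvatureAt, curvature, extend_eq_constField, extend_eq_constField, extend_eq_constField,
    mlieBracket_constField x hx, map_zero, constField_coordVec hx, constField_coordVec hx, sub_zero]

/-- For commuting fields `∇_b c = ∇_c b` near `x`, so the six second derivatives cancel in pairs. -/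
theorem IsLeviCivita.curvatureAt_bianchi (hcov : IsLeviCivita A.metric cov) (x : Q)
    (a b c : TangentSpace 𝓘(ℝ, E) x) :
    curvatureAt cov x a b c + curvatureAt cov x b c a + curvatureAt cov x c a b = 0 := by
  have hs : ∀ z c : E, cov (fun y ↦ cov (constField x z) y (constField x c y)) x =
      cov (fun y ↦ cov (constField x c) y (constField x z y)) x := fun z c ↦ by
    refine cov_congr cov (hcov.isDifferentiableCov x z c) ?_
    filter_upwards [eventually_mem_chartAt_source (F := E) x] with y hy
    exact hcov.cov_constField_comm hy z c
  rw [curvatureAt_eq_sub, curvatureAt_eq_sub, curvatureAt_eq_sub,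
    hs (coordVec x x a) (coordVec x x b), hs (coordVec x x b) (coordVec x x c),
    hs (coordVec x x a) (coordVec x x c)]
  abel

/-- Second derivatives of `g(Z, W)` along commuting fields commute; expanding both by metricity
leaves exactly the two curvature terms. -/
theorem IsLeviCivita.g_curvatureAt (hcov : IsLeviCivita A.metric cov) (x : Q)
    (a b c d : TangentSpace 𝓘(ℝ, E) x) :
    A.g x (curvatureAt cov x a b c) d = -A.g x c (curvatureAt cov x a b d) := by
  have hx := mem_chart_source E x
  set Z := constField x (coordVec x x c) with hZ
  set W := constField x (coordVec x x d) with hW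
  have hZx : Z x = c := constField_coordVec hx c
  have hWx : W x = d := constField_coordVec hx d
  have hZm : MDiffAt (T% Z) x := mdiffAt_constField x hx _
  have hWm : MDiffAt (T% W) x := mdiffAt_constField x hx _
  have key : ∀ u w : E, mvfderiv 𝓘(ℝ, E) (fun y ↦ mvfderiv 𝓘(ℝ, E)
      (fun y ↦ A.g y (Z y) (W y)) y (constField x w y)) x (constField x u x) =
      (A.g x (cov (fun y ↦ cov Z y (constField x w y)) x (constField x u x)) d +
        A.g x (cov Z x (constField x w x)) (cov W x (constField x u x))) +
      (A.g x (cov Z x (constField x u x)) (cov W x (constField x w x)) +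
        A.g x c (cov (fun y ↦ cov W y (constField x w y)) x (constField x u x))) := fun u w ↦ by
    have hdZ := hcov.isDifferentiableCov x (coordVec x x c) w
    have hdW := hcov.isDifferentiableCov x (coordVec x x d) w
    have e : ∀ᶠ y in nhds x, mvfderiv 𝓘(ℝ, E) (fun y ↦ A.g y (Z y) (W y)) y (constField x w y) =
        A.g y (cov Z y (constField x w y)) (W y) + A.g y (Z y) (cov W y (constField x w y)) := by
      filter_upwards [eventually_mdiffAt_constField x (coordVec x x c),
        eventually_mdiffAt_constField x (coordVec x x d)] with y h1 h2
      exact hcov.metric y (constField x w y) _ _ h1 h2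
    rw [mvfderiv_congr e, mvfderiv_add_apply
      (MDiffAlongAt.g (f := fun x : Q ↦ x) hdZ hWm) (MDiffAlongAt.g (f := fun x : Q ↦ x) hZm hdW)]
    have h1 := hcov.metric x (constField x u x) _ _ hdZ hWm
    have h2 := hcov.metric x (constField x u x) _ _ hZm hdW
    simp only [AlmostContactBMetric.metric] at h1 h2
    rw [h1, h2, hZx, hWx]
  have hb := mvfderiv_mlieBracket
    ((c2_constField x (coordVec x x c)).g (A := A) (c2_constField x (coordVec x x d)))
    (mdiffAt_constField x hx (coordVec x x a)) (mdiffAt_constField x hx (coordVec x x b))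
  rw [mlieBracket_constField x hx, map_zero] at hb
  have e1 := key (coordVec x x a) (coordVec x x b)
  have e2 := key (coordVec x x b) (coordVec x x a)
  rw [e1, e2] at hb
  rw [curvatureAt_eq_sub, curvatureAt_eq_sub, map_sub, map_sub, sub_apply]
  simp only [constField_coordVec hx] at hb
  linarith

/-- The field `φZ` need not have constant coordinates, so the curvature on it is computed by the
pulled back identity along the identity map, valid for any `C^2` field. Parallelism then takes `φ`
through both derivatives. -/
theorem AlmostContactBMetric.IsF0.curvatureAt_φ (hF0 : A.IsF0 cov)
    (hcov : IsLeviCivita A.metric cov) (x : Q) (a b c : TangentSpace 𝓘(ℝ, E) x) :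
    curvatureAt cov x a b (A.φ x c) = A.φ x (curvatureAt cov x a b c) := by
  have hx := mem_chart_source E x
  set Z := constField x (coordVec x x c) with hZ
  have hZx : Z x = c := constField_coordVec hx c
  have hm : mfderiv 𝓘(ℝ, E) 𝓘(ℝ, E) (fun x : Q ↦ x) x = ContinuousLinearMap.id ℝ _ :=
    mfderiv_id
  have h1 := (hcov.covAlong_curvature hcov.isDifferentiableCov (f := fun x : Q ↦ x) contMDiff_id
    (mdiffAt_constField x hx (coordVec x x a)) (mdiffAt_constField x hx (coordVec x x b))
    ((c2_constField x (coordVec x x c)).φ (A := A))).2.2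
  have hd : ∀ w u : E, covAlong cov (fun x : Q ↦ x) (fun q ↦ covAlong cov (fun x : Q ↦ x)
      (fun q ↦ A.φ q (constField x (coordVec x x c) q)) q (constField x w q)) x (constField x u x) =
      A.φ x (cov (fun y ↦ cov Z y (constField x w y)) x (constField x u x)) := fun w u ↦ by
    have e : ∀ᶠ y in nhds x, A.φ y (cov Z y (constField x w y)) =
        covAlong cov (fun x : Q ↦ x) (fun q ↦ A.φ q (constField x (coordVec x x c) q)) y
          (constField x w y) := by
      filter_upwards [eventually_mdiffAt_constField x (coordVec x x c)] with y h1
      rw [hF0.covAlong_φ (f := fun x : Q ↦ x) h1, covAlong_id cov h1]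
    have hdZ := hcov.isDifferentiableCov x (coordVec x x c) w
    rw [← covAlong_congr cov e, hF0.covAlong_φ (f := fun x : Q ↦ x) hdZ, covAlong_id cov hdZ]
  rw [mlieBracket_constField x hx, hd, hd, constField_coordVec hx, constField_coordVec hx, hm,
    constField_coordVec hx] at h1
  have h0 := covAlong_smul_dir cov (f := fun x : Q ↦ x)
    (W := fun q ↦ A.φ q (constField x (coordVec x x c) q)) (p := x) (F := E) 0
    (0 : TangentSpace 𝓘(ℝ, E) x)
  rw [zero_smul, zero_smul] at h0
  rw [h0, sub_zero, ContinuousLinearMap.id_apply, ContinuousLinearMap.id_apply, ← map_sub] at h1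
  rw [curvatureAt_eq_sub x a b c]
  exact h1.symm

end AmbientCurvature
end

noncomputable section
-- Orthonormal bases of `ker η` for the complex bilinear metric
namespace AlmostContactBMetric

set_option linter.unusedSectionVars false

variable {E : Type*} [NormedAddCommGroup E] [NormedSpace ℝ E]
  {Q : Type*} [TopologicalSpace Q] [ChartedSpace E Q] [IsManifold 𝓘(ℝ, E) ∞ Q]
  (A : AlmostContactBMetric E Q) (x : Q)

theorem g_smul_left (r : ℝ) (v w : TangentSpace 𝓘(ℝ, E) x) :
    A.g x (r • v) w = r * A.g x v w := by
  rw [map_smul, smul_apply, smul_eq_mul]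

theorem g_add_left (u v w : TangentSpace 𝓘(ℝ, E) x) :
    A.g x (u + v) w = A.g x u w + A.g x v w := by
  rw [map_add, add_apply]

theorem g_sub_left (u v w : TangentSpace 𝓘(ℝ, E) x) :
    A.g x (u - v) w = A.g x u w - A.g x v w := by
  rw [map_sub, sub_apply]

theorem g_neg_left (v w : TangentSpace 𝓘(ℝ, E) x) :
    A.g x (-v) w = -A.g x v w := by
  rw [map_neg, neg_apply]

theorem g_sum_left {ι : Type*} (s : Finset ι) (u : ι → TangentSpace 𝓘(ℝ, E) x)
    (w : TangentSpace 𝓘(ℝ, E) x) : A.g x (∑ i ∈ s, u i) w = ∑ i ∈ s, A.g x (u i) w :=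
  map_sum (AddMonoidHom.mk' (fun u ↦ A.g x u w) fun u v ↦ A.g_add_left x u v w) u s

theorem g_smul_right (r : ℝ) (v w : TangentSpace 𝓘(ℝ, E) x) :
    A.g x v (r • w) = r * A.g x v w := by
  rw [map_smul, smul_eq_mul]

theorem g_add_right (u v w : TangentSpace 𝓘(ℝ, E) x) :
    A.g x u (v + w) = A.g x u v + A.g x u w := map_add _ _ _

theorem g_sub_right (u v w : TangentSpace 𝓘(ℝ, E) x) :
    A.g x u (v - w) = A.g x u v - A.g x u w := map_sub _ _ _

theorem g_neg_right (v w : TangentSpace 𝓘(ℝ, E) x) :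
    A.g x v (-w) = -A.g x v w := map_neg _ _

/-- Orthonormal with respect to the `φ`-holomorphic metric on `ker η`. -/
structure IsComplexOrthonormal {ι : Type*} [DecidableEq ι] (e : ι → TangentSpace 𝓘(ℝ, E) x) :
    Prop where
  η_eq : ∀ i, A.η x (e i) = 0
  g_eq : ∀ i j, A.g x (e i) (e j) = if i = j then 1 else 0
  g_φ_eq : ∀ i j, A.g x (e i) (A.φ x (e j)) = 0

variable {A x}

theorem φ_φ_of_η {v : TangentSpace 𝓘(ℝ, E) x} (h : A.η x v = 0) : A.φ x (A.φ x v) = -v := by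
  rw [A.φ_φ, h, zero_smul, add_zero]

theorem g_φ_φ_of_η {v : TangentSpace 𝓘(ℝ, E) x} (h : A.η x v = 0) (w : TangentSpace 𝓘(ℝ, E) x) :
    A.g x (A.φ x v) (A.φ x w) = -A.g x v w := by
  rw [A.g_φ_φ, h, zero_mul, add_zero]

/-- With `φ` as multiplication by `i`, the form `g(v, v) - i g(v, φv)` is complex quadratic on `ker
η`. Scaling `v` by a square root of the inverse of its value makes the value `1`. -/
theorem exists_unit_of_ne {v : TangentSpace 𝓘(ℝ, E) x} (hv : A.η x v = 0)
    (h : A.g x v v ≠ 0 ∨ A.g x v (A.φ x v) ≠ 0) :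
    ∃ s t : ℝ, A.g x (s • v + t • A.φ x v) (s • v + t • A.φ x v) = 1 ∧
      A.g x (s • v + t • A.φ x v) (A.φ x (s • v + t • A.φ x v)) = 0 := by
  set a := A.g x v v with ha
  set b := A.g x v (A.φ x v) with hb
  have hz : (⟨a, -b⟩ : ℂ) ≠ 0 := by
    intro h0
    have h1 := congrArg Complex.re h0
    have h2 := congrArg Complex.im h0
    simp at h1 h2
    tauto
  obtain ⟨z, hz2⟩ := IsAlgClosed.exists_pow_nat_eq ((⟨a, -b⟩ : ℂ)⁻¹) (n := 2) (by norm_num)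
  have h3 : z * z * ⟨a, -b⟩ = 1 := by
    rw [← sq, hz2, inv_mul_cancel₀ hz]
  have h4 := congrArg Complex.re h3
  have h5 := congrArg Complex.im h3
  simp at h4 h5
  have e1 : A.g x (A.φ x v) v = b := by rw [A.g_φ_left]
  have e2 : A.g x (A.φ x v) (A.φ x v) = -a := g_φ_φ_of_η hv v
  refine ⟨z.re, z.im, ?_, ?_⟩
  · simp only [A.g_add_right, A.g_smul_right, A.g_add_left, A.g_smul_left, e1, e2, ← ha, ← hb]
    linarith
  · simp only [map_add (A.φ x), map_smul (A.φ x), A.g_add_right, A.g_smul_right, A.g_add_left,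
      A.g_smul_left, e1, e2, ← ha, ← hb, φ_φ_of_η hv, A.g_neg_right]
    linarith

theorem IsComplexOrthonormal.card_le [FiniteDimensional ℝ E] {k : ℕ}
    {e : Fin k → TangentSpace 𝓘(ℝ, E) x} (he : A.IsComplexOrthonormal x e) :
    k ≤ Module.finrank ℝ E := by
  have hl : LinearIndependent ℝ e := by
    rw [Fintype.linearIndependent_iff]
    intro c hc i
    have h1 : A.g x (∑ j, c j • e j) (e i) = 0 := by rw [hc, map_zero, zero_apply]
    rw [A.g_sum_left] at h1
    simpa [A.g_smul_left, he.g_eq] using h1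
  have : FiniteDimensional ℝ (TangentSpace 𝓘(ℝ, E) x) := inferInstanceAs (FiniteDimensional ℝ E)
  have := hl.fintype_card_le_finrank
  rw [Fintype.card_fin] at this
  exact this

-- Complex Gram-Schmidt by maximality: for an orthonormal family of greatest length, a residual with
-- nonzero square could be normalized and adjoined. So all residuals are null, and polarization with
-- nondegeneracy makes them vanish.
variable (A x) in
theorem exists_complexOrthonormal_basis [FiniteDimensional ℝ E] :
    ∃ (k : ℕ) (e : Fin k → TangentSpace 𝓘(ℝ, E) x), A.IsComplexOrthonormal x e ∧
      ∀ v, A.η x v = 0 →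
        v = ∑ i, A.g x v (e i) • e i + A.φ x (∑ i, (-A.g x v (A.φ x (e i))) • e i) := by
  obtain ⟨k, ⟨e, he⟩, hk⟩ : ∃ k : ℕ,
      (∃ e : Fin k → TangentSpace 𝓘(ℝ, E) x, A.IsComplexOrthonormal x e) ∧
      ∀ l, (∃ e : Fin l → TangentSpace 𝓘(ℝ, E) x, A.IsComplexOrthonormal x e) → l ≤ k := by
    classical
    set P : ℕ → Prop := fun l ↦ ∃ e : Fin l → TangentSpace 𝓘(ℝ, E) x, A.IsComplexOrthonormal x e
    have h0 : P 0 := ⟨Fin.elim0, ⟨fun i ↦ i.elim0, fun i ↦ i.elim0, fun i ↦ i.elim0⟩⟩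
    refine ⟨Nat.findGreatest P (Module.finrank ℝ E), Nat.findGreatest_spec (Nat.zero_le _) h0,
      fun l ⟨e, he⟩ ↦ Nat.le_findGreatest he.card_le ⟨e, he⟩⟩
  refine ⟨k, e, he, fun v hv ↦ ?_⟩
  let Pr : TangentSpace 𝓘(ℝ, E) x → TangentSpace 𝓘(ℝ, E) x := fun v ↦
    v - (∑ i, A.g x v (e i) • e i + A.φ x (∑ i, (-A.g x v (A.φ x (e i))) • e i))
  have hη : ∀ v, A.η x v = 0 → A.η x (Pr v) = 0 := fun v hv ↦ by
    simp [Pr, hv, A.η_φ, he.η_eq]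
  have hPe : ∀ v j, A.g x (Pr v) (e j) = 0 := fun v j ↦ by
    simp only [Pr, A.g_sub_left, A.g_add_left, A.g_sum_left, A.g_smul_left, A.g_φ_left, he.g_eq,
      he.g_φ_eq]
    simp
  have hPf : ∀ v j, A.g x (Pr v) (A.φ x (e j)) = 0 := fun v j ↦ by
    simp only [Pr, A.g_sub_left, A.g_add_left, A.g_sum_left, A.g_smul_left, A.g_φ_left,
      φ_φ_of_η (he.η_eq _), map_neg, he.g_eq, he.g_φ_eq]
    simp
  have hPP : ∀ v w, A.g x (Pr v) (Pr w) = A.g x (Pr v) w := fun v w ↦ by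
    have hu : ∀ u, (∀ j, A.g x u (e j) = 0) → (∀ j, A.g x u (A.φ x (e j)) = 0) →
        A.g x u (Pr w) = A.g x u w := fun u h1 h2 ↦ by
      simp [Pr, h1, h2]
    exact hu _ (hPe v) (hPf v)
  have hnull : ∀ v, A.η x v = 0 → A.g x (Pr v) (Pr v) = 0 := fun v hv ↦ by
    by_contra hne
    obtain ⟨s, t, hs, ht⟩ := exists_unit_of_ne (hη v hv) (Or.inl hne)
    set w := s • Pr v + t • A.φ x (Pr v) with hw
    have hwη : A.η x w = 0 := by simp [hw, hη v hv, A.η_φ]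
    have hwe : ∀ j, A.g x w (e j) = 0 := fun j ↦ by
      simp only [hw, A.g_add_left, A.g_smul_left, A.g_φ_left, hPe, hPf]; ring
    have hwf : ∀ j, A.g x w (A.φ x (e j)) = 0 := fun j ↦ by
      simp only [hw, A.g_add_left, A.g_smul_left, A.g_φ_left, hPf, φ_φ_of_η (he.η_eq _), map_neg,
        hPe]; ring
    have := hk (k + 1) ⟨Fin.cons w e, ?_, ?_, ?_⟩
    · omega
    · intro i
      refine Fin.cases ?_ (fun i ↦ ?_) i
      · simpa using hwη
      · simpa using he.η_eq i
    · intro i j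
      refine Fin.cases ?_ (fun i ↦ ?_) i <;> refine Fin.cases ?_ (fun j ↦ ?_) j
      · simpa using hs
      · simpa [(Fin.succ_ne_zero j).symm] using hwe j
      · simpa [Fin.succ_ne_zero i] using (A.g_symm x _ _).trans (hwe i)
      · simpa using he.g_eq i j
    · intro i j
      refine Fin.cases ?_ (fun i ↦ ?_) i <;> refine Fin.cases ?_ (fun j ↦ ?_) j
      · simpa using ht
      · simpa using hwf j
      · simpa using (A.g_φ_left x _ _).symm.trans ((A.g_symm x _ _).trans (hwf i))
      · simpa using he.g_φ_eq i j
  have hadd : ∀ v w, Pr (v + w) = Pr v + Pr w := fun v w ↦ by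
    simp only [Pr, A.g_add_left, neg_add, add_smul, Finset.sum_add_distrib, map_add (A.φ x)]
    abel
  have hzero : Pr v = 0 := by
    refine A.g_nondegenerate x _ fun w ↦ ?_
    have hw : A.η x (w - A.η x w • A.ξ x) = 0 := by simp [A.η_ξ]
    set w' := w - A.η x w • A.ξ x with hw'
    -- Nullity is known only on `ker η`, so the test vector is split; its `ξ` part pairs to zero
    -- with the residual.
    have h1 : w = w' + A.η x w • A.ξ x := by rw [hw']; abel
    have h2 := hnull (v + w') (by rw [map_add, hv, hw, add_zero])
    rw [hadd, A.g_add_right, A.g_add_left, A.g_add_left, hnull v hv, hnull w' hw,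
      A.g_symm x (Pr w') (Pr v), hPP] at h2
    rw [h1, A.g_add_right, A.g_smul_right, A.g_ξ_right, hη v hv]
    linarith
  exact sub_eq_zero.1 hzero

end AlmostContactBMetric
end

/-! ### Curvature-like tensors and their sectional values -/

noncomputable section

/-- A tensor with the symmetries of a curvature tensor is determined by its sectional values. -/
theorem eq_zero_of_sectional_eq_zero {V : Type*} [AddCommGroup V] {τ : V → V → V → V → ℝ}
    (hadd : ∀ a a' b c d, τ (a + a') b c d = τ a b c d + τ a' b c d)
    (hswap : ∀ a b c d, τ a b c d = -τ b a c d) (hskew : ∀ a b c d, τ a b c d = -τ a b d c)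
    (hbianchi : ∀ a b c d, τ a b c d + τ b c a d + τ c a b d = 0)
    (H : AddSubmonoid V) (h : ∀ a ∈ H, ∀ b ∈ H, τ a b b a = 0) :
    ∀ a ∈ H, ∀ b ∈ H, ∀ c ∈ H, ∀ d ∈ H, τ a b c d = 0 := by
  -- Pair symmetry is a linear combination of four Bianchi identities and the two skew symmetries.
  have hpair : ∀ a b c d, τ a b c d = τ c d a b := fun a b c d ↦ by
    linarith [hbianchi a b c d, hbianchi b c d a, hbianchi c d a b, hbianchi d a b c,
      hskew a b c d, hskew b c a d, hskew c a b d, hskew c d a b, hskew d b c a, hskew b c d a,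
      hskew d a c b, hskew a c d b, hskew d a b c, hskew a b d c, hskew b d a c,
      hswap a b c d, hswap c d a b, hswap c a b d, hswap b d a c, hswap d b c a, hswap a c b d,
      hswap a c d b, hswap d b a c, hskew c a d b, hskew b d c a]
  have hadd2 : ∀ a b b' c d, τ a (b + b') c d = τ a b c d + τ a b' c d := fun a b b' c d ↦ by
    rw [hswap, hadd, hswap b, hswap b']; ring
  have hadd3 : ∀ a b c c' d, τ a b (c + c') d = τ a b c d + τ a b c' d := fun a b c c' d ↦ by
    rw [hpair, hadd, hpair c, hpair c']
  have hadd4 : ∀ a b c d d', τ a b c (d + d') = τ a b c d + τ a b c d' := fun a b c d d' ↦ by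
    rw [hskew, hadd3, hskew a b d, hskew a b d']; ring
  -- Polarization in the middle pair here and in the outer pair in `h2` makes `τ` invariant under
  -- cycling its first three arguments, so Bianchi reads `3τ = 0`. Only sums are used, hence a
  -- submonoid suffices.
  have h1 : ∀ a ∈ H, ∀ b ∈ H, ∀ c ∈ H, τ a b c a = 0 := fun a ha b hb c hc ↦ by
    have e := h a ha (b + c) (H.add_mem hb hc)
    rw [hadd2, hadd3, hadd3, h a ha b hb, h a ha c hc] at e
    have e2 : τ a c b a = τ a b c a := by rw [hpair, hswap, hskew]; ring
    linarith
  have h2 : ∀ a ∈ H, ∀ b ∈ H, ∀ c ∈ H, ∀ d ∈ H, τ a b c d = -τ d b c a := fun a ha b hb c hc d hd ↦ by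
    have e := h1 (a + d) (H.add_mem ha hd) b hb c hc
    rw [hadd, hadd4, hadd4, h1 a ha b hb c hc, h1 d hd b hb c hc] at e
    linarith
  intro a ha b hb c hc d hd
  have e1 := h2 a ha b hb c hc d hd
  have e2 := h2 b hb c hc a ha d hd
  have e3 := h2 c hc a ha b hb d hd
  have e4 := h2 b hb a ha c hc d hd
  have e5 := h2 c hc b hb a ha d hd
  linarith [hbianchi a b c d, hswap a b c d, hswap b c a d, hswap c a b d,
    hpair d b c a, hpair d c a b, hpair d a b c, hpair d a c b, hpair d b a c, hpair d c b a,
    hswap c a d b, hskew c a d b, hswap a b d c, hskew a b d c, hswap b c d a, hskew b c d a,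
    hbianchi b a c d, hswap c b a d, hswap a c b d, hskew b a d c, hskew a b c d, hskew b c a d,
    hskew c a b d]

namespace AlmostContactBMetric

set_option linter.unusedSectionVars false

variable {E : Type*} [NormedAddCommGroup E] [NormedSpace ℝ E]
  {Q : Type*} [TopologicalSpace Q] [ChartedSpace E Q] [IsManifold 𝓘(ℝ, E) ∞ Q]
  (A : AlmostContactBMetric E Q) (x : Q)

/-- The algebraic properties of the curvature tensor of an `F₀`-manifold. -/
structure IsCurvatureLike (T : TangentSpace 𝓘(ℝ, E) x → TangentSpace 𝓘(ℝ, E) x →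
    TangentSpace 𝓘(ℝ, E) x → TangentSpace 𝓘(ℝ, E) x) : Prop where
  add_left : ∀ a a' b c, T (a + a') b c = T a b c + T a' b c
  smul_left : ∀ (r : ℝ) a b c, T (r • a) b c = r • T a b c
  add_right : ∀ a b c c', T a b (c + c') = T a b c + T a b c'
  smul_right : ∀ (r : ℝ) a b c, T a b (r • c) = r • T a b c
  swap : ∀ a b c, T a b c = -T b a c
  skew : ∀ a b c d, A.g x (T a b c) d = -A.g x c (T a b d)
  bianchi : ∀ a b c, T a b c + T b c a + T c a b = 0
  φ_comm : ∀ a b c, T a b (A.φ x c) = A.φ x (T a b c)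

variable {A x}
variable {T T' : TangentSpace 𝓘(ℝ, E) x → TangentSpace 𝓘(ℝ, E) x →
    TangentSpace 𝓘(ℝ, E) x → TangentSpace 𝓘(ℝ, E) x}

theorem _root_.AlmostContactBMetric.IsF0.isCurvatureLike [FiniteDimensional ℝ E]
    {cov : CovariantDerivative 𝓘(ℝ, E) E (TangentSpace 𝓘(ℝ, E) : Q → Type _)}
    (hF0 : A.IsF0 cov) (hcov : IsLeviCivita A.metric cov) :
    A.IsCurvatureLike x (curvatureAt cov x) where
  add_left := hcov.curvatureAt_add_left x
  smul_left := hcov.curvatureAt_smul_left x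
  add_right := hcov.curvatureAt_add_right x
  smul_right := hcov.curvatureAt_smul_right x
  swap := hcov.curvatureAt_swap x
  skew := hcov.g_curvatureAt x
  bianchi := hcov.curvatureAt_bianchi x
  φ_comm := hF0.curvatureAt_φ hcov x

namespace IsCurvatureLike

theorem sub (h : A.IsCurvatureLike x T) (h' : A.IsCurvatureLike x T') :
    A.IsCurvatureLike x (fun a b c ↦ T a b c - T' a b c) where
  add_left a a' b c := by rw [h.add_left, h'.add_left]; abel
  smul_left r a b c := by rw [h.smul_left, h'.smul_left]; module
  add_right a b c c' := by rw [h.add_right, h'.add_right]; abel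
  smul_right r a b c := by rw [h.smul_right, h'.smul_right]; module
  swap a b c := by rw [h.swap, h'.swap]; abel
  skew a b c d := by rw [A.g_sub_left, A.g_sub_right, h.skew, h'.skew]; ring
  bianchi a b c := by
    have e := h.bianchi a b c
    have e' := h'.bianchi a b c
    rw [show T a b c - T' a b c + (T b c a - T' b c a) + (T c a b - T' c a b) =
      (T a b c + T b c a + T c a b) - (T' a b c + T' b c a + T' c a b) by abel, e, e', sub_zero]
  φ_comm a b c := by rw [h.φ_comm, h'.φ_comm, map_sub]

theorem smul (h : A.IsCurvatureLike x T) (s : ℝ) :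
    A.IsCurvatureLike x (fun a b c ↦ s • T a b c) where
  add_left a a' b c := by rw [h.add_left, smul_add]
  smul_left r a b c := by rw [h.smul_left, smul_comm]
  add_right a b c c' := by rw [h.add_right, smul_add]
  smul_right r a b c := by rw [h.smul_right, smul_comm]
  swap a b c := by rw [h.swap, smul_neg]
  skew a b c d := by rw [A.g_smul_left, A.g_smul_right, h.skew]; ring
  bianchi a b c := by rw [← smul_add, ← smul_add, h.bianchi, smul_zero]
  φ_comm a b c := by rw [h.φ_comm, map_smul]

theorem φ (h : A.IsCurvatureLike x T) : A.IsCurvatureLike x (fun a b c ↦ A.φ x (T a b c)) where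
  add_left a a' b c := by rw [h.add_left, map_add]
  smul_left r a b c := by rw [h.smul_left, map_smul]
  add_right a b c c' := by rw [h.add_right, map_add]
  smul_right r a b c := by rw [h.smul_right, map_smul]
  swap a b c := by rw [h.swap, map_neg]
  skew a b c d := by rw [A.g_φ_left, h.skew, h.φ_comm]
  bianchi a b c := by rw [← map_add, ← map_add, h.bianchi, map_zero]
  φ_comm a b c := by rw [h.φ_comm]

theorem add_mid (h : A.IsCurvatureLike x T) (a b b' c : TangentSpace 𝓘(ℝ, E) x) :
    T a (b + b') c = T a b c + T a b' c := by
  rw [h.swap, h.add_left, h.swap b, h.swap b']; abel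

theorem smul_mid (h : A.IsCurvatureLike x T) (r : ℝ) (a b c : TangentSpace 𝓘(ℝ, E) x) :
    T a (r • b) c = r • T a b c := by
  rw [h.swap, h.smul_left, h.swap b]; module

/-- `φ` annihilates `T(a, b)ξ` by commutation, and `η` annihilates it by skewness; pair symmetry
later transfers this to the first slot. -/
theorem ξ_right (h : A.IsCurvatureLike x T) (a b : TangentSpace 𝓘(ℝ, E) x) :
    T a b (A.ξ x) = 0 := by
  refine A.eq_zero_of_φ_eq_zero x ?_ ?_
  · have := h.smul_right 0 a b 0
    rw [← h.φ_comm, A.φ_ξ]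
    simpa using this
  · have := h.skew a b (A.ξ x) (A.ξ x)
    rw [A.g_ξ_left, A.g_ξ_right] at this
    linarith

theorem pair (h : A.IsCurvatureLike x T) (a b c d : TangentSpace 𝓘(ℝ, E) x) :
    A.g x (T a b c) d = A.g x (T c d a) b := by
  set τ := fun a b c d ↦ A.g x (T a b c) d with hτ
  have hswap : ∀ a b c d, τ a b c d = -τ b a c d := fun a b c d ↦ by
    simp only [τ]
    rw [h.swap, A.g_neg_left]
  have hskew : ∀ a b c d, τ a b c d = -τ a b d c := fun a b c d ↦ by
    simp only [τ]
    rw [h.skew, A.g_symm]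
  have hbianchi : ∀ a b c d, τ a b c d + τ b c a d + τ c a b d = 0 := fun a b c d ↦ by
    simp only [τ]
    rw [← A.g_add_left, ← A.g_add_left, h.bianchi, map_zero, zero_apply]
  change τ a b c d = τ c d a b
  linarith [hbianchi a b c d, hbianchi b c d a, hbianchi c d a b, hbianchi d a b c,
      hskew a b c d, hskew b c a d, hskew c a b d, hskew c d a b, hskew d b c a, hskew b c d a,
      hskew d a c b, hskew a c d b, hskew d a b c, hskew a b d c, hskew b d a c,
      hswap a b c d, hswap c d a b, hswap c a b d, hswap b d a c, hswap d b c a, hswap a c b d,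
      hswap a c d b, hswap d b a c, hskew c a d b, hskew b d c a]

theorem ξ_left (h : A.IsCurvatureLike x T) (b c : TangentSpace 𝓘(ℝ, E) x) :
    T (A.ξ x) b c = 0 := by
  refine A.g_nondegenerate x _ fun d ↦ ?_
  rw [h.pair, h.ξ_right, map_zero, zero_apply]

/-- Pair symmetry moves `φ` between the first two slots. For the defect `D(a, b, c) = T(a, φb)c -
φT(a, b)c`, Bianchi gives `D(a, b, c) + D(b, c, a) = 0`; the alternating sum of its three cyclic
versions is `2D = 0`. -/
theorem φ_left (h : A.IsCurvatureLike x T) (a b c : TangentSpace 𝓘(ℝ, E) x) :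
    T (A.φ x a) b c = A.φ x (T a b c) := by
  have h1 : ∀ a b c, T (A.φ x a) b c = T a (A.φ x b) c := fun a b c ↦ by
    refine A.eq_of_g x fun d ↦ ?_
    rw [h.pair, h.φ_comm, A.g_φ_left, h.pair]
  have hD : ∀ a b c, (T a (A.φ x b) c - A.φ x (T a b c)) + (T b (A.φ x c) a - A.φ x (T b c a)) =
      0 := fun a b c ↦ by
    have e1 := h.bianchi c a (A.φ x b)
    have e2 := congrArg (A.φ x) (h.bianchi c a b)
    rw [map_add, map_add, map_zero] at e2
    rw [h.φ_comm, h1] at e1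
    have e3 : T a (A.φ x b) c + T b (A.φ x c) a = -A.φ x (T c a b) := by
      rw [← sub_eq_zero, ← e1]; abel
    have e4 : A.φ x (T a b c) + A.φ x (T b c a) = -A.φ x (T c a b) := by
      rw [← sub_eq_zero, ← e2]; abel
    rw [show T a (A.φ x b) c - A.φ x (T a b c) + (T b (A.φ x c) a - A.φ x (T b c a)) =
      (T a (A.φ x b) c + T b (A.φ x c) a) - (A.φ x (T a b c) + A.φ x (T b c a)) by abel, e3, e4,
      sub_self]
  have e1 := hD a b c
  have e2 := hD b c a
  have e3 := hD c a b
  rw [h1]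
  generalize A.φ x (T a b c) = u1, A.φ x (T b c a) = u2, A.φ x (T c a b) = u3,
    T a (A.φ x b) c = v1, T b (A.φ x c) a = v2, T c (A.φ x a) b = v3 at *
  have : (2 : ℝ) • (v1 - u1) = 0 := by
    calc (2 : ℝ) • (v1 - u1) = (v1 - u1 + (v2 - u2)) - (v2 - u2 + (v3 - u3)) +
        (v3 - u3 + (v1 - u1)) := by module
      _ = 0 := by rw [e1, e2, e3]; simp
  exact sub_eq_zero.1 ((smul_eq_zero.1 this).resolve_left two_ne_zero)

theorem φ_mid (h : A.IsCurvatureLike x T) (a b c : TangentSpace 𝓘(ℝ, E) x) :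
    T a (A.φ x b) c = A.φ x (T a b c) := by
  rw [h.swap, h.φ_left, ← map_neg, ← h.swap]

/-- The real span `H` of a complex orthonormal basis is totally real and `g`-positive definite.
There `g(T·, ·)` and `g(T·, φ·)` are both real curvature tensors with zero sectional values, so they
vanish; `φ`-linearity in every slot and `T(ξ, ·) = 0` extend this to `ξ ⊕ H ⊕ φH`, the whole space.
-/
theorem eq_zero [FiniteDimensional ℝ E] (h : A.IsCurvatureLike x T)
    (hs : ∀ a b, A.IsTotallyRealSection x a b →
      A.g x (T a b b) a = 0 ∧ A.g x (T a b b) (A.φ x a) = 0) (a b c : TangentSpace 𝓘(ℝ, E) x) :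
    T a b c = 0 := by
  obtain ⟨k, e, he, hspan⟩ := A.exists_complexOrthonormal_basis x
  set H := Submodule.span ℝ (Set.range e) with hH
  have hHe : ∀ a ∈ H, ∃ α : Fin k → ℝ, a = ∑ i, α i • e i := fun a ha ↦ by
    obtain ⟨α, hα⟩ := (Submodule.mem_span_range_iff_exists_fun ℝ).1 ha
    exact ⟨α, hα.symm⟩
  have hHη : ∀ a ∈ H, A.η x a = 0 := fun a ha ↦ by
    obtain ⟨α, rfl⟩ := hHe a ha
    simp [he.η_eq]
  have hHφ : ∀ a ∈ H, ∀ b ∈ H, A.g x a (A.φ x b) = 0 := fun a ha b hb ↦ by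
    obtain ⟨α, rfl⟩ := hHe a ha
    obtain ⟨β, rfl⟩ := hHe b hb
    rw [A.g_sum_left]
    refine Finset.sum_eq_zero fun i _ ↦ ?_
    rw [map_sum (A.φ x), map_sum]
    refine Finset.sum_eq_zero fun j _ ↦ ?_
    rw [A.g_smul_left, map_smul, A.g_smul_right, he.g_φ_eq, mul_zero, mul_zero]
  have hHg : ∀ a ∈ H, A.g x a a = 0 → a = 0 := fun a ha h0 ↦ by
    obtain ⟨α, rfl⟩ := hHe a ha
    have h2 : ∀ i, A.g x (e i) (∑ j, α j • e j) = α i := fun i ↦ by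
      rw [map_sum]
      simp [he.g_eq]
    simp only [A.g_sum_left, A.g_smul_left, h2] at h0
    have h1 := (Finset.sum_eq_zero_iff_of_nonneg (fun i _ ↦ mul_self_nonneg (α i))).1 h0
    refine Finset.sum_eq_zero fun i hi ↦ ?_
    rw [mul_self_eq_zero.1 (h1 i hi), zero_smul]
  have hself : ∀ a c, T a a c = 0 := fun a c ↦ by
    have := h.swap a a c
    have h2 : (2 : ℝ) • T a a c = 0 := by rw [two_smul]; nth_rewrite 2 [this]; abel
    exact (smul_eq_zero.1 h2).resolve_left two_ne_zero
  have hsec : ∀ a ∈ H, ∀ b ∈ H, A.g x (T a b b) a = 0 ∧ A.g x (T a b b) (A.φ x a) = 0 := by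
    intro a ha b hb
    -- The hypothesis covers nondegenerate sections only. On `H` a zero Gram determinant means
    -- linear dependence, and then `T(a, b)b = 0` by skewness.
    by_cases hg : A.gramDet x a b = 0
    · have hw : A.g x a a • b - A.g x a b • a = 0 := by
        refine hHg _ (H.sub_mem (H.smul_mem _ hb) (H.smul_mem _ ha)) ?_
        simp only [A.g_sub_left, A.g_sub_right, A.g_smul_left, A.g_smul_right, A.g_symm x b a]
        rw [gramDet] at hg
        linear_combination (A.g x a a) * hg
      have hT : T a b b = 0 := by
        by_cases h0 : A.g x a a = 0
        · rw [hHg a ha h0]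
          have := h.smul_left 0 0 b b
          simpa using this
        · have h1 : A.g x a a • T a b b = 0 := by
            rw [← h.smul_mid, sub_eq_zero.1 hw, h.smul_mid, hself, smul_zero]
          exact (smul_eq_zero.1 h1).resolve_left h0
      rw [hT]; simp
    · have hle : ∀ v ∈ Submodule.span ℝ {a, b}, v ∈ H := fun v hv ↦
        Submodule.span_le.2 (Set.insert_subset ha (Set.singleton_subset_iff.2 hb)) hv
      refine hs a b ⟨hg, fun v hv w hw ↦ ?_, fun v hv ↦ ?_⟩
      · rw [A.g_φ_left]; exact hHφ v (hle v hv) w (hle w hw)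
      · rw [A.g_ξ_right]; exact hHη v (hle v hv)
  have hreal : ∀ a ∈ H, ∀ b ∈ H, ∀ c ∈ H, ∀ d ∈ H, A.g x (T a b c) d = 0 :=
    eq_zero_of_sectional_eq_zero (τ := fun a b c d ↦ A.g x (T a b c) d)
      (fun a a' b c d ↦ by rw [h.add_left, A.g_add_left])
      (fun a b c d ↦ by rw [h.swap, A.g_neg_left])
      (fun a b c d ↦ by rw [h.skew, A.g_symm])
      (fun a b c d ↦ by
        rw [← A.g_add_left, ← A.g_add_left, h.bianchi, map_zero, zero_apply])
      H.toAddSubmonoid (fun a ha b hb ↦ (hsec a ha b hb).1)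
  have himag : ∀ a ∈ H, ∀ b ∈ H, ∀ c ∈ H, ∀ d ∈ H, A.g x (T a b c) (A.φ x d) = 0 :=
    eq_zero_of_sectional_eq_zero (τ := fun a b c d ↦ A.g x (T a b c) (A.φ x d))
      (fun a a' b c d ↦ by rw [h.add_left, A.g_add_left])
      (fun a b c d ↦ by rw [h.swap, A.g_neg_left])
      (fun a b c d ↦ by rw [h.skew, A.g_symm, h.φ_comm, A.g_φ_left])
      (fun a b c d ↦ by
        rw [← A.g_add_left, ← A.g_add_left, h.bianchi, map_zero, zero_apply])
      H.toAddSubmonoid (fun a ha b hb ↦ (hsec a ha b hb).2)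
  have hdec : ∀ v, ∃ r : ℝ, ∃ u ∈ H, ∃ w ∈ H, v = r • A.ξ x + (u + A.φ x w) := fun v ↦ by
    have h0 : A.η x (v - A.η x v • A.ξ x) = 0 := by simp [A.η_ξ]
    have hm : ∀ i, e i ∈ H := fun i ↦ Submodule.subset_span ⟨i, rfl⟩
    refine ⟨A.η x v, _, ?_, _, ?_, sub_eq_iff_eq_add'.1 (hspan _ h0)⟩ <;>
    exact H.sum_mem fun i _ ↦ H.smul_mem _ (hm i)
  have hzero : ∀ a ∈ H, ∀ b ∈ H, ∀ c ∈ H, T a b c = 0 := fun a ha b hb c hc ↦ by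
    refine A.g_nondegenerate x _ fun d ↦ ?_
    obtain ⟨r, u, hu, w, hw, rfl⟩ := hdec d
    rw [A.g_add_right, A.g_add_right, hreal a ha b hb c hc u hu, himag a ha b hb c hc w hw,
      A.g_smul_right, h.skew, h.ξ_right, map_zero]
    simp
  have hzero1 : ∀ a ∈ H, ∀ b ∈ H, ∀ c, T a b c = 0 := fun a ha b hb c ↦ by
    obtain ⟨r, u, hu, w, hw, rfl⟩ := hdec c
    rw [h.add_right, h.add_right, h.smul_right, h.ξ_right, h.φ_comm, hzero a ha b hb u hu,
      hzero a ha b hb w hw]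
    simp
  have hzero2 : ∀ a, ∀ b ∈ H, ∀ c, T a b c = 0 := fun a b hb c ↦ by
    obtain ⟨r, u, hu, w, hw, rfl⟩ := hdec a
    rw [h.add_left, h.add_left, h.smul_left, h.ξ_left, h.φ_left, hzero1 u hu b hb,
      hzero1 w hw b hb]
    simp
  obtain ⟨r, u, hu, w, hw, rfl⟩ := hdec b
  rw [h.add_mid, h.add_mid, h.smul_mid, h.swap a (A.ξ x), h.ξ_left, h.φ_mid, hzero2 a u hu,
    hzero2 a w hw]
  simp

end IsCurvatureLike

/-! ### The ambient curvature in terms of the model tensor -/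

variable (A x) in
/-- The model curvature tensor of constant totally real sectional curvature one. -/
def modelCurvature (a b c : TangentSpace 𝓘(ℝ, E) x) : TangentSpace 𝓘(ℝ, E) x :=
  (A.g x b c - A.η x b * A.η x c) • (a - A.η x a • A.ξ x) -
    (A.g x a c - A.η x a * A.η x c) • (b - A.η x b • A.ξ x) -
    A.g x b (A.φ x c) • A.φ x a + A.g x a (A.φ x c) • A.φ x b

theorem isCurvatureLike_modelCurvature : A.IsCurvatureLike x (A.modelCurvature x) where
  add_left a a' b c := by simp only [modelCurvature, map_add, add_apply]; module
  smul_left r a b c := by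
    simp only [modelCurvature, map_smul, smul_apply, smul_eq_mul]; module
  add_right a b c c' := by simp only [modelCurvature, map_add]; module
  smul_right r a b c := by simp only [modelCurvature, map_smul, smul_eq_mul]; module
  swap a b c := by simp only [modelCurvature]; module
  skew a b c d := by
    simp only [modelCurvature, A.g_add_left, A.g_sub_left, A.g_smul_left, A.g_add_right,
      A.g_sub_right, A.g_smul_right, A.g_ξ_left, A.g_ξ_right, A.g_φ_left]
    rw [A.g_symm x c a, A.g_symm x c b, ← A.g_φ_left x c a, ← A.g_φ_left x c b,
      A.g_symm x (A.φ x c) a, A.g_symm x (A.φ x c) b]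
    ring
  bianchi a b c := by
    simp only [modelCurvature]
    rw [A.g_symm x c a, A.g_symm x b a, A.g_symm x c b, ← A.g_φ_left x c a, ← A.g_φ_left x b a,
      ← A.g_φ_left x c b, A.g_symm x (A.φ x c) a, A.g_symm x (A.φ x b) a, A.g_symm x (A.φ x c) b]
    module
  φ_comm a b c := by
    simp only [modelCurvature, map_add, map_sub, map_smul, A.φ_φ, A.φ_ξ, A.η_φ, A.g_neg_right,
      A.g_smul_right, A.g_ξ_right]
    module

/-- The difference of the two sides is curvature-like and vanishes on totally real sections. Since
both metrics have the same curvature, the second sectional curvature is `g(R(x, y)y, φx)`; the minus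
sign before `ν'` comes from `g(φ·, φ·) = -g` on `ker η`. -/
theorem HasConstTotallyRealCurvatures.curvatureAt_eq [FiniteDimensional ℝ E]
    {cov cov' : CovariantDerivative 𝓘(ℝ, E) E (TangentSpace 𝓘(ℝ, E) : Q → Type _)} {ν ν' : Q → ℝ}
    (hν : A.HasConstTotallyRealCurvatures cov cov' ν ν') (hF0 : A.IsF0 cov)
    (hcov : IsLeviCivita A.metric cov) (hcov' : IsLeviCivita A.assocMetric cov') (x : Q)
    (a b c : TangentSpace 𝓘(ℝ, E) x) :
    curvatureAt cov x a b c =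
      ν x • A.modelCurvature x a b c - ν' x • A.φ x (A.modelCurvature x a b c) := by
  have hm := A.isCurvatureLike_modelCurvature (x := x)
  have h := (hF0.isCurvatureLike hcov (x := x)).sub ((hm.smul (ν x)).sub (hm.φ.smul (ν' x)))
  refine sub_eq_zero.1 (h.eq_zero (fun a b hab ↦ ?_) a b c)
  have ha : a ∈ Submodule.span ℝ {a, b} := Submodule.subset_span (by simp)
  have hb : b ∈ Submodule.span ℝ {a, b} := Submodule.subset_span (by simp)
  obtain ⟨h1, h2⟩ := hν x a b hab
  rw [div_eq_iff hab.nondegenerate] at h1 h2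
  rw [hF0.curvatureAt_eq hcov hcov'] at h2
  have ha0 : A.η x a = 0 := by rw [← A.g_ξ_right]; exact hab.orthogonal_ξ a ha
  have hb0 : A.η x b = 0 := by rw [← A.g_ξ_right]; exact hab.orthogonal_ξ b hb
  have haa : A.g x a (A.φ x a) = 0 := by rw [← A.g_φ_left]; exact hab.totally_real a ha a ha
  have hbb : A.g x b (A.φ x b) = 0 := by rw [← A.g_φ_left]; exact hab.totally_real b hb b hb
  have hab' : A.g x a (A.φ x b) = 0 := by rw [← A.g_φ_left]; exact hab.totally_real a ha b hb
  have hba' : A.g x b (A.φ x a) = 0 := by rw [← A.g_φ_left]; exact hab.totally_real b hb a ha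
  simp only [metric] at h1
  simp only [assocMetric, ha0, mul_zero, add_zero] at h2
  have hsymm := A.g_symm x b a
  rw [gramDet] at h1 h2
  have hmod : A.modelCurvature x a b b = A.g x b b • a - A.g x a b • b := by
    simp [modelCurvature, ha0, hb0, hbb, hab']
  constructor
  · rw [A.g_sub_left, h1, A.g_sub_left, A.g_smul_left, A.g_smul_left, A.g_φ_left, hmod]
    simp only [A.g_sub_left, A.g_smul_left, haa, hba', hsymm]
    ring
  · rw [A.g_sub_left, h2, A.g_sub_left, A.g_smul_left, A.g_smul_left, A.g_φ_left, hmod,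
      φ_φ_of_η ha0]
    simp only [A.g_sub_left, A.g_smul_left, haa, hba', hsymm, A.g_neg_right]
    ring

end AlmostContactBMetric
end

noncomputable section
-- Independence of `v` and `φv`
namespace AlmostContactBMetric

variable {E : Type*} [NormedAddCommGroup E] [NormedSpace ℝ E]
  {Q : Type*} [TopologicalSpace Q] [ChartedSpace E Q] [IsManifold 𝓘(ℝ, E) ∞ Q]
  {A : AlmostContactBMetric E Q} {x : Q}

/-- Applying `sφ` once more gives `(s² + t²) v = 0`: `φ` has no real eigenvalue on `ker η`. -/
theorem eq_zero_of_smul_φ_eq {v : TangentSpace 𝓘(ℝ, E) x} (hv : A.η x v = 0) (h0 : v ≠ 0)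
    {s t : ℝ} (h : s • A.φ x v = t • v) : s = 0 ∧ t = 0 := by
  have h1 := congrArg (fun w ↦ s • A.φ x w) h
  simp only [map_smul, φ_φ_of_η hv] at h1
  rw [smul_comm s t, h] at h1
  have h2 : (t * t + s * s) • v = 0 := by
    rw [add_smul, mul_smul, mul_smul, ← h1]
    module
  have h3 := (smul_eq_zero.1 h2).resolve_right h0
  constructor <;> nlinarith [mul_self_nonneg s, mul_self_nonneg t]

end AlmostContactBMetric

/-! ### Tangent and normal vectors of the submanifold at a point -/

namespace HalfLightlike

set_option linter.unusedSectionVars false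

variable {E : Type*} [NormedAddCommGroup E] [NormedSpace ℝ E]
  {Q : Type*} [TopologicalSpace Q] [ChartedSpace E Q] [IsManifold 𝓘(ℝ, E) ∞ Q]
  {F : Type*} [NormedAddCommGroup F] [NormedSpace ℝ F]
  {M : Type*} [TopologicalSpace M] [ChartedSpace F M] [IsManifold 𝓘(ℝ, F) ∞ M]
  {A : AlmostContactBMetric E Q} {f : M → Q} (S : HalfLightlike F A f)

local notation "Df" => mfderiv 𝓘(ℝ, F) 𝓘(ℝ, E) f

theorem exists_smul_of_mem_radical {p : M} {v : TangentSpace 𝓘(ℝ, F) p}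
    (hv : v ∈ radical F A f p) : ∃ c : ℝ, v = c • S.ξ p := by
  obtain ⟨c, hc⟩ := (finrank_eq_one_iff_of_nonzero' (⟨S.ξ p, S.ξ_mem p⟩ : radical F A f p)
    (fun h ↦ S.ξ_ne_zero p (congrArg Subtype.val h))).1 (S.finrank_radical p) ⟨v, hv⟩
  exact ⟨c, (congrArg Subtype.val hc).symm⟩

theorem g_ξ_df (p : M) (v : TangentSpace 𝓘(ℝ, F) p) : A.g (f p) (Df p (S.ξ p)) (Df p v) = 0 :=
  S.ξ_mem p v

theorem exists_ξ_eq (hA : S.IsAscreen) (p : M) :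
    ∃ a b : ℝ, A.ξ (f p) = a • Df p (S.ξ p) + b • S.N p := by
  obtain ⟨_, ⟨v, hv, rfl⟩, n, hn, h⟩ := Submodule.mem_sup.1 (hA p)
  obtain ⟨c, rfl⟩ := S.exists_smul_of_mem_radical hv
  obtain ⟨b, rfl⟩ := Submodule.mem_span_singleton.1 hn
  refine ⟨c, b, h.symm.trans ?_⟩
  congr 1
  exact map_smul (Df p) c (S.ξ p)

theorem η_eq (hA : S.IsAscreen) (p : M) (v : TangentSpace 𝓘(ℝ, F) p) :
    A.η (f p) (Df p v) = S.μ p * S.η p v := by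
  obtain ⟨a, b, h⟩ := S.exists_ξ_eq hA p
  have h1 : ∀ v, A.η (f p) (Df p v) = b * S.η p v := fun v ↦ by
    rw [← A.g_ξ_right, h, A.g_add_right, A.g_smul_right, A.g_smul_right, A.g_symm, S.g_ξ_df,
      mul_zero, zero_add]
    rfl
  have h2 : S.μ p = b := by
    rw [μ, h1, η, A.g_symm, S.N_ξ, mul_one]
  rw [h2, h1]

/-- Were `μ = 0`, then `ξ̄` would lie in the radical and be null, contradicting `g(ξ̄, ξ̄) = 1`. -/
theorem μ_ne_zero (hA : S.IsAscreen) (p : M) : S.μ p ≠ 0 := fun h0 ↦ by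
  obtain ⟨a, b, h⟩ := S.exists_ξ_eq hA p
  have hη : ∀ v, A.η (f p) (Df p v) = 0 := fun v ↦ by rw [S.η_eq hA, h0, zero_mul]
  have h1 := A.g_ξ_ξ (f p)
  have h2 : A.g (f p) (S.N p) (A.ξ (f p)) = a := by
    rw [h, A.g_add_right, A.g_smul_right, A.g_smul_right, S.N_ξ, S.N_N]; ring
  have h3 : b = 0 := by
    have := A.g_ξ_right (f p) (Df p (S.ξ p))
    rw [hη, h, A.g_add_right, A.g_smul_right, A.g_smul_right, S.g_ξ_df, A.g_symm, S.N_ξ] at this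
    linarith
  rw [h3, zero_smul, add_zero] at h
  rw [A.g_ξ_left, h, map_smul, hη] at h1
  simp at h1

/-- The section `ζ = μ⁻¹ ξ` of the radical distribution. -/
def radicalSection (p : M) : TangentSpace 𝓘(ℝ, F) p := (S.μ p)⁻¹ • S.ξ p

/-- `ζ = μ⁻¹ ξ` as a vector field along the immersion. -/
def zeta (p : M) : TangentSpace 𝓘(ℝ, E) (f p) := (S.μ p)⁻¹ • Df p (S.ξ p)

theorem df_radicalSection (p : M) : Df p (S.radicalSection p) = S.zeta p := map_smul _ _ _

theorem g_zeta_df (p : M) (v : TangentSpace 𝓘(ℝ, F) p) : A.g (f p) (S.zeta p) (Df p v) = 0 := by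
  rw [zeta, A.g_smul_left, S.g_ξ_df, mul_zero]

theorem g_df_zeta (p : M) (v : TangentSpace 𝓘(ℝ, F) p) : A.g (f p) (Df p v) (S.zeta p) = 0 := by
  rw [A.g_symm, S.g_zeta_df]

theorem g_zeta_zeta (p : M) : A.g (f p) (S.zeta p) (S.zeta p) = 0 := by
  nth_rewrite 2 [← S.df_radicalSection]
  exact S.g_zeta_df p _

theorem η_zeta (hA : S.IsAscreen) (p : M) : A.η (f p) (S.zeta p) = 1 := by
  rw [zeta, map_smul]
  exact inv_mul_cancel₀ (S.μ_ne_zero hA p)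

theorem η_smul_df_ξ (hA : S.IsAscreen) (p : M) (v : TangentSpace 𝓘(ℝ, F) p) :
    S.η p v • Df p (S.ξ p) = A.η (f p) (Df p v) • S.zeta p := by
  rw [zeta, S.η_eq hA, smul_smul, mul_right_comm, mul_inv_cancel₀ (S.μ_ne_zero hA p), one_mul]

theorem exists_φ_zeta_eq (hR : S.IsRSTHL) (p : M) :
    ∃ c : ℝ, A.φ (f p) (S.zeta p) = c • S.L p := by
  have h : A.φ (f p) (S.zeta p) ∈ Submodule.span ℝ {S.L p} := by
    rw [← hR p, ← S.df_radicalSection]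
    exact ⟨_, ⟨_, (radical F A f p).smul_mem _ (S.ξ_mem p), rfl⟩, rfl⟩
  obtain ⟨c, hc⟩ := Submodule.mem_span_singleton.1 h
  exact ⟨c, hc.symm⟩

theorem g_φ_zeta_df (hR : S.IsRSTHL) (p : M) (v : TangentSpace 𝓘(ℝ, F) p) :
    A.g (f p) (A.φ (f p) (S.zeta p)) (Df p v) = 0 := by
  obtain ⟨c, hc⟩ := S.exists_φ_zeta_eq hR p
  rw [hc, A.g_smul_left, S.L_normal, mul_zero]

theorem g_df_φ_zeta (hR : S.IsRSTHL) (p : M) (v : TangentSpace 𝓘(ℝ, F) p) :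
    A.g (f p) (Df p v) (A.φ (f p) (S.zeta p)) = 0 := by
  rw [A.g_symm, S.g_φ_zeta_df hR]

theorem g_zeta_φ_zeta (hR : S.IsRSTHL) (p : M) :
    A.g (f p) (S.zeta p) (A.φ (f p) (S.zeta p)) = 0 := by
  nth_rewrite 1 [← S.df_radicalSection]
  exact S.g_df_φ_zeta hR p _

theorem g_zeta_φ_df (hR : S.IsRSTHL) (p : M) (v : TangentSpace 𝓘(ℝ, F) p) :
    A.g (f p) (S.zeta p) (A.φ (f p) (Df p v)) = 0 := by
  rw [← A.g_φ_left, S.g_φ_zeta_df hR]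

theorem g_φ_zeta_φ_zeta (hA : S.IsAscreen) (p : M) :
    A.g (f p) (A.φ (f p) (S.zeta p)) (A.φ (f p) (S.zeta p)) = 1 := by
  rw [A.g_φ_φ, S.g_zeta_zeta, S.η_zeta hA]; norm_num

variable [FiniteDimensional ℝ E] [FiniteDimensional ℝ F]

theorem df_P (hA : S.IsAscreen) (p : M) (v : TangentSpace 𝓘(ℝ, F) p) :
    Df p (S.P p v) = Df p v - A.η (f p) (Df p v) • S.zeta p := by
  have h1 : v = S.P p v + ((S.screenEquiv p).symm v).2 • S.ξ p := by
    have h := (S.screenEquiv p).apply_symm_apply v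
    have h2 := S.screenMap_apply p ((S.screenEquiv p).symm v).1 ((S.screenEquiv p).symm v).2
    exact h.symm.trans h2
  have hP : S.P p v ∈ S.screen p := ((S.screenEquiv p).symm v).1.2
  generalize ((S.screenEquiv p).symm v).2 = c at h1
  have h2 : S.η p v = c := by
    have h3 := S.N_screen p _ hP
    rw [η, h1, map_add, map_smul, A.g_add_left, A.g_smul_left, A.g_symm, h3, A.g_symm, S.N_ξ]
    ring
  rw [← S.η_smul_df_ξ hA, h2]
  nth_rewrite 2 [h1]
  rw [map_add, map_smul, add_sub_cancel_right]

/-- In the basis given by `TM`, `N` and `L`, the vector `ξ̄` has nonzero `N`-coefficient and `φ̄ζ`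
is a nonzero multiple of `L`, so they may replace `N` and `L`. -/
theorem exists_decomposition (hR : S.IsRSTHL) (hA : S.IsAscreen) (p : M)
    (w : TangentSpace 𝓘(ℝ, E) (f p)) :
    ∃ (v : TangentSpace 𝓘(ℝ, F) p) (α β : ℝ),
      w = Df p v + α • A.ξ (f p) + β • A.φ (f p) (S.zeta p) := by
  obtain ⟨a, b, hab⟩ := S.exists_ξ_eq hA p
  obtain ⟨c, hc⟩ := S.exists_φ_zeta_eq hR p
  have hb : b ≠ 0 := by
    rintro rfl
    have := A.g_ξ_right (f p) (Df p (S.ξ p))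
    rw [hab, A.g_add_right, A.g_smul_right, A.g_smul_right, S.g_ξ_df] at this
    simp at this
    exact S.μ_ne_zero hA p this.symm
  have hc0 : c ≠ 0 := by
    rintro rfl
    have := S.g_φ_zeta_φ_zeta hA p
    rw [hc] at this
    simp at this
  have hw := (S.gaussEquiv p).apply_symm_apply w
  obtain ⟨⟨v, α, β⟩, hv⟩ : ∃ t, (S.gaussEquiv p).symm w = t := ⟨_, rfl⟩
  rw [hv] at hw
  have h2 : Df p v + (α • S.N p + β • S.L p) = w := (S.gaussMap_apply p v α β).symm.trans hw
  refine ⟨v - (α * b⁻¹ * a) • S.ξ p, α * b⁻¹, β * c⁻¹, ?_⟩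
  have hαb : α * b⁻¹ * b = α := by field_simp
  have hβc : β * c⁻¹ * c = β := by field_simp
  rw [hab, hc, ← h2, map_sub, map_smul, smul_smul, hβc, smul_add, smul_smul, smul_smul, hαb]
  abel

theorem eq_of_g_tests (hR : S.IsRSTHL) (hA : S.IsAscreen) (p : M)
    {u w : TangentSpace 𝓘(ℝ, E) (f p)} (h1 : ∀ v, A.g (f p) u (Df p v) = A.g (f p) w (Df p v))
    (h2 : A.η (f p) u = A.η (f p) w)
    (h3 : A.g (f p) u (A.φ (f p) (S.zeta p)) = A.g (f p) w (A.φ (f p) (S.zeta p))) : u = w := by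
  refine A.eq_of_g _ fun z ↦ ?_
  obtain ⟨v, α, β, rfl⟩ := S.exists_decomposition hR hA p z
  simp only [A.g_add_right, A.g_smul_right, A.g_ξ_right, h1, h2, h3]

theorem exists_df_eq (hR : S.IsRSTHL) (hA : S.IsAscreen) (p : M)
    {w : TangentSpace 𝓘(ℝ, E) (f p)} (h1 : A.g (f p) w (S.zeta p) = 0)
    (h2 : A.g (f p) w (A.φ (f p) (S.zeta p)) = 0) : ∃ v, Df p v = w := by
  obtain ⟨v, α, β, rfl⟩ := S.exists_decomposition hR hA p w
  have hα : α = 0 := by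
    rw [A.g_add_left, A.g_add_left, A.g_smul_left, A.g_smul_left, S.g_df_zeta, A.g_ξ_left,
      S.η_zeta hA, A.g_φ_left, S.g_zeta_φ_zeta hR] at h1
    linarith
  have hβ : β = 0 := by
    rw [A.g_add_left, A.g_add_left, A.g_smul_left, A.g_smul_left, S.g_df_φ_zeta hR, A.g_ξ_left,
      A.η_φ, S.g_φ_zeta_φ_zeta hA] at h2
    linarith
  exact ⟨v, by rw [hα, hβ]; module⟩

theorem exists_df_eq_φ_df_P (hR : S.IsRSTHL) (hA : S.IsAscreen) (p : M)
    (v : TangentSpace 𝓘(ℝ, F) p) : ∃ w, Df p w = A.φ (f p) (Df p (S.P p v)) := by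
  refine S.exists_df_eq hR hA p ?_ ?_
  · rw [A.g_φ_left, S.g_df_φ_zeta hR]
  · rw [A.g_φ_φ, S.g_df_zeta, S.df_P hA, map_sub, map_smul, S.η_zeta hA]
    simp

theorem η_df_P (hA : S.IsAscreen) (p : M) (v : TangentSpace 𝓘(ℝ, F) p) :
    A.η (f p) (Df p (S.P p v)) = 0 := by
  rw [S.df_P hA, map_sub, map_smul, S.η_zeta hA, smul_eq_mul, mul_one, sub_self]

/-- The metric induced by the associated metric is non-degenerate. -/
theorem eq_zero_of_assocMetric (hR : S.IsRSTHL) (hA : S.IsAscreen) (p : M)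
    {v : TangentSpace 𝓘(ℝ, F) p} (h : ∀ w, A.assocMetric (f p) (Df p v) (Df p w) = 0) :
    v = 0 := by
  apply S.mfderiv_injective p
  rw [map_zero]
  refine A.assocMetric_nondegenerate _ fun z ↦ ?_
  obtain ⟨w, α, β, rfl⟩ := S.exists_decomposition hR hA p z
  -- `ξ̄ - ζ` and `φ̄ζ - ζ` are `g̃`-orthogonal to `M`, so against tangent vectors `ξ̄` and `φ̄ζ`
  -- may both be replaced by `ζ`.
  have h1 := h (w + (α + β) • S.radicalSection p)
  rw [map_add, map_smul, S.df_radicalSection] at h1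
  simp only [AlmostContactBMetric.assocMetric, map_add, map_smul, A.φ_φ, A.φ_ξ, A.η_ξ, A.η_φ,
    S.η_zeta hA, S.g_df_zeta, S.g_df_φ_zeta hR, A.g_neg_right, A.g_smul_right, A.g_ξ_right,
    smul_eq_mul] at h1 ⊢
  simp only [map_zero]
  linear_combination h1

end HalfLightlike
end

noncomputable section
-- The derivative of `ζ`
namespace HalfLightlike

set_option linter.unusedSectionVars false

variable {E : Type*} [NormedAddCommGroup E] [NormedSpace ℝ E] [FiniteDimensional ℝ E]
  {Q : Type*} [TopologicalSpace Q] [ChartedSpace E Q] [IsManifold 𝓘(ℝ, E) ∞ Q]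
  {F : Type*} [NormedAddCommGroup F] [NormedSpace ℝ F] [FiniteDimensional ℝ F]
  {M : Type*} [TopologicalSpace M] [ChartedSpace F M] [IsManifold 𝓘(ℝ, F) ∞ M]
  {A : AlmostContactBMetric E Q} {f : M → Q} (S : HalfLightlike F A f)
  {cov : CovariantDerivative 𝓘(ℝ, E) E (TangentSpace 𝓘(ℝ, E) : Q → Type _)}
  {γ : M → ℝ} {p : M}

local notation "Df" => mfderiv 𝓘(ℝ, F) 𝓘(ℝ, E) f

theorem c2_μ (p : M) : ContMDiffAt 𝓘(ℝ, F) 𝓘(ℝ, ℝ) 2 S.μ p :=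
  (C2AlongAt.mfderiv S.contMDiff_f (S.contMDiff_ξ p)).η

theorem c2_zeta (hA : S.IsAscreen) (p : M) : C2AlongAt F f S.zeta p := by
  have h1 : ContMDiffAt 𝓘(ℝ, F) 𝓘(ℝ, ℝ) 2 (fun q ↦ (S.μ q)⁻¹) p :=
    (contDiffAt_inv ℝ (S.μ_ne_zero hA p)).contMDiffAt.comp p (S.c2_μ p)
  exact (C2AlongAt.mfderiv S.contMDiff_f (S.contMDiff_ξ p)).smul h1

theorem mdiff_zeta (hA : S.IsAscreen) (p : M) : MDiffAlongAt F f S.zeta p := (S.c2_zeta hA p).mdiff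

theorem mdiff_f (S : HalfLightlike F A f) (p : M) : MDifferentiableAt 𝓘(ℝ, F) 𝓘(ℝ, E) f p :=
  S.contMDiff_f.mdifferentiableAt (by simp)

/-- The factor in `∇̄_X ζ = a P X`. -/
def shape (γ : M → ℝ) (p : M) : ℝ := 2 * S.μ p * γ p

theorem c2_shape (hγ : S.IsScreenTotallyUmbilical cov γ) (p : M) :
    ContMDiffAt 𝓘(ℝ, F) 𝓘(ℝ, ℝ) 2 (S.shape γ) p := by
  have h : ContMDiffAt 𝓘(ℝ, F) 𝓘(ℝ, ℝ) 2 (fun q ↦ (2 : ℝ) * S.μ q * γ q) p :=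
    (contMDiffAt_const.mul (S.c2_μ p)).mul (hγ.contMDiff_γ.contMDiffAt.of_le (by norm_cast))
  exact h

theorem η_covAlong_zeta (hA : S.IsAscreen) (hF0 : A.IsF0 cov) (hcov : IsLeviCivita A.metric cov)
    (v : TangentSpace 𝓘(ℝ, F) p) : A.η (f p) (covAlong cov f S.zeta p v) = 0 := by
  rw [← hF0.mvfderiv_η hcov (S.mdiff_zeta hA p)]
  simp only [S.η_zeta hA, mvfderiv_const, zero_apply]

theorem g_covAlong_zeta_zeta (hA : S.IsAscreen) (hcov : IsLeviCivita A.metric cov)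
    (v : TangentSpace 𝓘(ℝ, F) p) : A.g (f p) (covAlong cov f S.zeta p v) (S.zeta p) = 0 := by
  have h := hcov.mvfderiv_g (S.mdiff_zeta hA p) (S.mdiff_zeta hA p) v
  simp only [S.g_zeta_zeta, mvfderiv_const, zero_apply] at h
  rw [A.g_symm _ (S.zeta p)] at h
  linarith

theorem g_covAlong_zeta_φ_zeta (hR : S.IsRSTHL) (hA : S.IsAscreen) (hF0 : A.IsF0 cov)
    (hcov : IsLeviCivita A.metric cov) (v : TangentSpace 𝓘(ℝ, F) p) :
    A.g (f p) (covAlong cov f S.zeta p v) (A.φ (f p) (S.zeta p)) = 0 := by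
  have h := hcov.mvfderiv_g (S.mdiff_zeta hA p) ((S.mdiff_zeta hA p).φ (A := A)) v
  simp only [S.g_zeta_φ_zeta hR, mvfderiv_const, zero_apply, hF0.covAlong_φ (S.mdiff_zeta hA p)]
    at h
  rw [A.g_symm _ (S.zeta p), A.g_φ_left] at h
  linarith

theorem mdiff_df_P (hA : S.IsAscreen) {Z : Π q : M, TangentSpace 𝓘(ℝ, F) q}
    (hZ : MDiffAt (T% Z) p) : MDiffAlongAt F f (fun q ↦ Df q (S.P q (Z q))) p := by
  simp only [S.df_P hA]
  have h := MDiffAlongAt.mfderiv S.contMDiff_f hZ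
  exact h.sub ((S.mdiff_zeta hA p).smul h.η)

/-- The coefficient `C` in terms of the ambient connection. -/
theorem g_zeta_covAlong_df_P (hA : S.IsAscreen) (hF0 : A.IsF0 cov)
    (hcov : IsLeviCivita A.metric cov) {Z : Π q : M, TangentSpace 𝓘(ℝ, F) q}
    (hZ : MDiffAt (T% Z) p) (v : TangentSpace 𝓘(ℝ, F) p) :
    A.g (f p) (S.zeta p) (covAlong cov f (fun q ↦ Df q (S.P q (Z q))) p v) =
      -2 * S.μ p * S.C cov Z p v := by
  set w := covAlong cov f (fun q ↦ Df q (S.P q (Z q))) p v with hw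
  have hηw : A.η (f p) w = 0 := by
    rw [hw, ← hF0.mvfderiv_η hcov (S.mdiff_df_P hA hZ)]
    simp only [S.η_df_P hA, mvfderiv_const, zero_apply]
  have hN : A.g (f p) (S.N p) w = S.C cov Z p v := by
    have h1 := (S.gaussEquiv p).apply_symm_apply w
    obtain ⟨⟨u, α, β⟩, hu⟩ : ∃ t, (S.gaussEquiv p).symm w = t := ⟨_, rfl⟩
    rw [hu] at h1
    have h2 : Df p u + (α • S.N p + β • S.L p) = w := (S.gaussMap_apply p u α β).symm.trans h1
    have h3 : S.inducedConnection cov (fun q ↦ S.P q (Z q)) p v = u := congrArg Prod.fst hu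
    have h4 := (S.screenEquiv p).apply_symm_apply u
    obtain ⟨⟨s, c⟩, hs⟩ : ∃ t, (S.screenEquiv p).symm u = t := ⟨_, rfl⟩
    rw [hs] at h4
    have h5 : (s : TangentSpace 𝓘(ℝ, F) p) + c • S.ξ p = u := (S.screenMap_apply p s c).symm.trans h4
    have h6 : S.C cov Z p v = c := by rw [C, h3, hs]
    rw [h6, ← h2, ← h5, map_add (Df p), map_smul (Df p)]
    simp only [A.g_add_right, A.g_smul_right, S.N_N, S.N_L, S.N_ξ, S.N_screen p s s.2]
    ring
  obtain ⟨a, b, hab⟩ := S.exists_ξ_eq hA p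
  have hbμ : S.μ p = b := by
    have := A.g_ξ_right (f p) (Df p (S.ξ p))
    rw [hab, A.g_add_right, A.g_smul_right, A.g_smul_right, S.g_ξ_df, A.g_symm, S.N_ξ] at this
    rw [μ, ← this]; ring
  -- This is `g(ξ̄, ξ̄) = 1` for `ξ̄ = aξ + bN` with `b = μ`. With `η̄(w) = 0` it gives `g(ξ, w) =
  -- -2μ² g(N, w)`, whence the factor `-2μ`.
  have ha : 2 * a * b = 1 := by
    have := A.g_ξ_ξ (f p)
    nth_rewrite 1 [hab] at this
    rw [A.g_add_left, A.g_smul_left, A.g_smul_left, A.g_ξ_right, hab] at this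
    simp only [A.g_add_right, A.g_smul_right, S.N_N, S.N_ξ] at this
    have h2 : A.η (f p) (Df p (S.ξ p)) = b := hbμ
    rw [h2] at this
    linarith
  rw [← A.g_ξ_left, hab, A.g_add_left, A.g_smul_left, A.g_smul_left, hN] at hηw
  rw [zeta, A.g_smul_left, hbμ]
  have hb : b ≠ 0 := by rintro rfl; simp at ha
  field_simp
  linear_combination (2 * b) * hηw - A.g (f p) (Df p (S.ξ p)) w * ha

/-- Differentiating `g(ζ, PZ) = 0` expresses `g(∇̄ζ, PZ)` through `C`, that is, through `γ`. The
pairings with `ζ`, `ξ̄` and `φ̄ζ` vanish because `g(ζ, ζ)`, `η̄(ζ)` and `g(ζ, φ̄ζ)` are constant. -/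
theorem covAlong_zeta (hR : S.IsRSTHL) (hA : S.IsAscreen) (hF0 : A.IsF0 cov)
    (hcov : IsLeviCivita A.metric cov) (hγ : S.IsScreenTotallyUmbilical cov γ)
    (v : TangentSpace 𝓘(ℝ, F) p) :
    covAlong cov f S.zeta p v = S.shape γ p • Df p (S.P p v) := by
  refine S.eq_of_g_tests hR hA p (fun z ↦ ?_) ?_ ?_
  · have hx := mem_chart_source F p
    have hZ := smoothFieldAt_constField p hx (coordVec p p z)
    have hZm := mdiffAt_constField p hx (coordVec p p z)
    have h := hcov.mvfderiv_g (S.mdiff_zeta hA p) (S.mdiff_df_P hA hZm) v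
    simp only [S.g_zeta_df, mvfderiv_const, zero_apply] at h
    rw [S.g_zeta_covAlong_df_P hA hF0 hcov hZm, hγ.C_eq p v _ hZ, constField_coordVec hx] at h
    have h2 : Df p z = Df p (S.P p z) + A.η (f p) (Df p z) • S.zeta p := by rw [S.df_P hA]; abel
    rw [h2, A.g_add_right, A.g_smul_right, S.g_covAlong_zeta_zeta hA hcov, ← h2, S.df_P hA p v,
      A.g_smul_left, A.g_sub_left, A.g_smul_left, S.g_zeta_df, shape]
    simp only [inducedForm, AlmostContactBMetric.metric] at h
    linarith
  · rw [S.η_covAlong_zeta hA hF0 hcov, map_smul, S.η_df_P hA, smul_zero]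
  · rw [S.g_covAlong_zeta_φ_zeta hR hA hF0 hcov, A.g_smul_left, S.g_df_φ_zeta hR, mul_zero]

end HalfLightlike
end

noncomputable section
-- Curvature applied to `ζ`
namespace HalfLightlike

set_option linter.unusedSectionVars false

variable {E : Type*} [NormedAddCommGroup E] [NormedSpace ℝ E] [FiniteDimensional ℝ E]
  {Q : Type*} [TopologicalSpace Q] [ChartedSpace E Q] [IsManifold 𝓘(ℝ, E) ∞ Q]
  {F : Type*} [NormedAddCommGroup F] [NormedSpace ℝ F] [FiniteDimensional ℝ F]
  {M : Type*} [TopologicalSpace M] [ChartedSpace F M] [IsManifold 𝓘(ℝ, F) ∞ M]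
  {A : AlmostContactBMetric E Q} {f : M → Q} (S : HalfLightlike F A f)
  {cov cov' : CovariantDerivative 𝓘(ℝ, E) E (TangentSpace 𝓘(ℝ, E) : Q → Type _)}
  {γ : M → ℝ} {p : M}

local notation "Df" => mfderiv 𝓘(ℝ, F) 𝓘(ℝ, E) f

theorem covAlong_shape_smul_df_P (hR : S.IsRSTHL) (hA : S.IsAscreen) (hF0 : A.IsF0 cov)
    (hcov : IsLeviCivita A.metric cov) (hγ : S.IsScreenTotallyUmbilical cov γ)
    {Y : Π q : M, TangentSpace 𝓘(ℝ, F) q} (hY : MDiffAt (T% Y) p) (v : TangentSpace 𝓘(ℝ, F) p) :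
    covAlong cov f (fun q ↦ S.shape γ q • Df q (S.P q (Y q))) p v =
      mvfderiv 𝓘(ℝ, F) (S.shape γ) p v • Df p (S.P p (Y p)) +
      S.shape γ p • (covAlong cov f (fun q ↦ Df q (Y q)) p v -
        (A.η (f p) (covAlong cov f (fun q ↦ Df q (Y q)) p v) • S.zeta p +
          (A.η (f p) (Df p (Y p)) * S.shape γ p) • Df p (S.P p v))) := by
  have hd := MDiffAlongAt.mfderiv S.contMDiff_f hY
  have hη := hd.η (A := A)
  have hz := S.mdiff_zeta hA p
  have ha := (S.c2_shape hγ p).mdifferentiableAt (by simp)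
  rw [covAlong_smul cov ha (S.mdiff_df_P hA hY)]
  congr 2
  have e : ∀ q, Df q (Y q) + (-1 : ℝ) • (A.η (f q) (Df q (Y q)) • S.zeta q) =
      Df q (S.P q (Y q)) := fun q ↦ by rw [S.df_P hA]; module
  rw [← covAlong_congr cov (Filter.Eventually.of_forall e),
    covAlong_add cov hd ((hz.smul hη).smul mdifferentiableAt_const),
    covAlong_smul cov mdifferentiableAt_const (hz.smul hη), covAlong_smul cov hη hz, mvfderiv_const,
    hF0.mvfderiv_η hcov hd, S.covAlong_zeta hR hA hF0 hcov hγ, zero_apply]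
  module

/-- The curvature identity along the immersion for `∇̄ζ = aP`: for commuting fields the symmetric
terms `∇̄_X df Y` cancel, leaving the derivative of `a` and the `a²` from differentiating `ζ` inside
`P`. -/
theorem curvatureAt_zeta (hR : S.IsRSTHL) (hA : S.IsAscreen) (hF0 : A.IsF0 cov)
    (hcov : IsLeviCivita A.metric cov) (hγ : S.IsScreenTotallyUmbilical cov γ)
    (x y : TangentSpace 𝓘(ℝ, F) p) :
    curvatureAt cov (f p) (Df p x) (Df p y) (S.zeta p) =
      (mvfderiv 𝓘(ℝ, F) (S.shape γ) p x + S.shape γ p ^ 2 * A.η (f p) (Df p x)) •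
        Df p (S.P p y) -
      (mvfderiv 𝓘(ℝ, F) (S.shape γ) p y + S.shape γ p ^ 2 * A.η (f p) (Df p y)) •
        Df p (S.P p x) := by
  have hx := mem_chart_source F p
  have hX := mdiffAt_constField p hx (coordVec p p x)
  have hY := mdiffAt_constField p hx (coordVec p p y)
  have h := (hcov.covAlong_curvature hcov.isDifferentiableCov S.contMDiff_f hX hY
    (S.c2_zeta hA p)).2.2
  have ht := hcov.covAlong_torsion S.contMDiff_f hX hY
  have hz : ∀ Y : Π q : M, TangentSpace 𝓘(ℝ, F) q, (fun q ↦ covAlong cov f S.zeta q (Y q)) =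
      fun q ↦ S.shape γ q • Df q (S.P q (Y q)) := fun Y ↦ funext fun q ↦
    S.covAlong_zeta hR hA hF0 hcov hγ _
  have h0 : VectorField.mlieBracket 𝓘(ℝ, F) (constField p (coordVec p p x))
      (constField p (coordVec p p y)) p = 0 := mlieBracket_constField p hx _ _
  rw [hz, hz, S.covAlong_zeta hR hA hF0 hcov hγ,
    S.covAlong_shape_smul_df_P hR hA hF0 hcov hγ hX,
    S.covAlong_shape_smul_df_P hR hA hF0 hcov hγ hY, h0, S.df_P hA p 0, map_zero, map_zero] at h
  rw [h0, map_zero, sub_eq_zero] at ht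
  rw [ht] at h
  simp only [constField_coordVec hx] at h
  rw [← h]
  module

theorem modelCurvature_zeta (hR : S.IsRSTHL) (hA : S.IsAscreen) (x y : TangentSpace 𝓘(ℝ, F) p) :
    A.modelCurvature (f p) (Df p x) (Df p y) (S.zeta p) =
      A.η (f p) (Df p x) • Df p (S.P p y) - A.η (f p) (Df p y) • Df p (S.P p x) := by
  rw [AlmostContactBMetric.modelCurvature, S.g_df_zeta, S.g_df_zeta, S.g_df_φ_zeta hR,
    S.g_df_φ_zeta hR, S.η_zeta hA, S.df_P hA, S.df_P hA]
  module

theorem exists_df_P_ne_zero (hA : S.IsAscreen) (hF : 1 < Module.finrank ℝ F) (p : M) :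
    ∃ y : TangentSpace 𝓘(ℝ, F) p, Df p (S.P p y) ≠ 0 := by
  by_contra! h
  have h1 : ∀ y : TangentSpace 𝓘(ℝ, F) p, ∃ c : ℝ, c • S.radicalSection p = y := fun y ↦ by
    refine ⟨A.η (f p) (Df p y), S.mfderiv_injective p ?_⟩
    have h2 := h y
    rw [S.df_P hA, sub_eq_zero] at h2
    rw [map_smul, S.df_radicalSection, ← h2]
  have h2 : Module.finrank ℝ (TangentSpace 𝓘(ℝ, F) p) ≤ 1 := finrank_le_one _ h1
  have h3 : Module.finrank ℝ F ≤ 1 := h2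
  omega

variable {ν ν' : Q → ℝ}

theorem assoc_curvature_eq_zero_and_mvfderiv_shape (hR : S.IsRSTHL) (hA : S.IsAscreen)
    (hF0 : A.IsF0 cov) (hcov : IsLeviCivita A.metric cov)
    (hcov' : IsLeviCivita A.assocMetric cov')
    (hγ : S.IsScreenTotallyUmbilical cov γ) (hν : A.HasConstTotallyRealCurvatures cov cov' ν ν')
    (hF : 1 < Module.finrank ℝ F) (p : M) :
    ν' (f p) = 0 ∧ ∀ x : TangentSpace 𝓘(ℝ, F) p, mvfderiv 𝓘(ℝ, F) (S.shape γ) p x =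
      A.η (f p) (Df p x) * (ν (f p) - S.shape γ p ^ 2) := by
  have key : ∀ x y : TangentSpace 𝓘(ℝ, F) p, _ := fun x y ↦
    (hν.curvatureAt_eq hF0 hcov hcov' (f p) (Df p x) (Df p y) (S.zeta p)).symm.trans
      (S.curvatureAt_zeta hR hA hF0 hcov hγ x y)
  simp only [S.modelCurvature_zeta hR hA] at key
  set z := S.radicalSection p
  have hz : A.η (f p) (Df p z) = 1 := by rw [S.df_radicalSection, S.η_zeta hA]
  have hPz : Df p (S.P p z) = 0 := by rw [S.df_P hA, hz, S.df_radicalSection, one_smul, sub_self]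
  have h1 : ν' (f p) = 0 ∧ ν (f p) - (mvfderiv 𝓘(ℝ, F) (S.shape γ) p z + S.shape γ p ^ 2) = 0 := by
    obtain ⟨y, hy⟩ := S.exists_df_P_ne_zero hA hF p
    refine AlmostContactBMetric.eq_zero_of_smul_φ_eq (S.η_df_P hA p y) hy ?_
    -- The pair `(ζ, y)` gives a relation between `Py` and `φ̄Py`, which are independent.
    have := key z y
    rw [hz, hPz, smul_zero, sub_zero, one_smul, smul_zero, sub_zero, mul_one] at this
    rw [sub_smul, ← this]
    abel
  refine ⟨h1.1, ?_⟩
  have h2 : ∀ y, mvfderiv 𝓘(ℝ, F) (S.shape γ) p (S.P p y) = 0 := fun y ↦ by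
    by_cases hy : Df p (S.P p y) = 0
    · have : S.P p y = 0 := S.mfderiv_injective p (by rw [hy, map_zero])
      rw [this, map_zero]
    -- The pair `(Py, φ̄Py)` lies in `ker η̄`, where the model side vanishes; independence then
    -- kills `da` on the screen.
    obtain ⟨w, hw⟩ := S.exists_df_eq_φ_df_P hR hA p y
    have hηw : A.η (f p) (Df p w) = 0 := by rw [hw, A.η_φ]
    have hPw : Df p (S.P p w) = Df p w := by rw [S.df_P hA, hηw, zero_smul, sub_zero]
    have hPP : Df p (S.P p (S.P p y)) = Df p (S.P p y) := by
      rw [S.df_P hA, S.η_df_P hA, zero_smul, sub_zero]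
    have := key (S.P p y) w
    rw [S.η_df_P hA, hηw, hPw, hPP, hw] at this
    refine (AlmostContactBMetric.eq_zero_of_smul_φ_eq (S.η_df_P hA p y) hy (s :=
      mvfderiv 𝓘(ℝ, F) (S.shape γ) p (S.P p y)) (t := mvfderiv 𝓘(ℝ, F) (S.shape γ) p w) ?_).1
    rw [← sub_eq_zero]
    simpa using this.symm
  intro x
  have hx : x = S.P p x + A.η (f p) (Df p x) • z := S.mfderiv_injective p (by
    rw [map_add, map_smul, S.df_P hA, S.df_radicalSection]; abel)
  nth_rewrite 1 [hx]
  rw [map_add, map_smul, h2, smul_eq_mul]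
  linear_combination (-A.η (f p) (Df p x)) * h1.2

end HalfLightlike
end

noncomputable section
-- The Gauss formula for the associated metric
namespace HalfLightlike

set_option linter.unusedSectionVars false

variable {E : Type*} [NormedAddCommGroup E] [NormedSpace ℝ E] [FiniteDimensional ℝ E]
  {Q : Type*} [TopologicalSpace Q] [ChartedSpace E Q] [IsManifold 𝓘(ℝ, E) ∞ Q]
  {F : Type*} [NormedAddCommGroup F] [NormedSpace ℝ F] [FiniteDimensional ℝ F]
  {M : Type*} [TopologicalSpace M] [ChartedSpace F M] [IsManifold 𝓘(ℝ, F) ∞ M]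
  {A : AlmostContactBMetric E Q} {f : M → Q} (S : HalfLightlike F A f)
  {cov : CovariantDerivative 𝓘(ℝ, E) E (TangentSpace 𝓘(ℝ, E) : Q → Type _)}
  {covM : CovariantDerivative 𝓘(ℝ, F) F (TangentSpace 𝓘(ℝ, F) : M → Type _)}
  {γ : M → ℝ} {p : M}

local notation "Df" => mfderiv 𝓘(ℝ, F) 𝓘(ℝ, E) f

/-- The first normal field `ξ̄ - ζ` of `M` for the associated metric. -/
def normal₁ (p : M) : TangentSpace 𝓘(ℝ, E) (f p) := A.ξ (f p) - S.zeta p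

/-- The second normal field `φ ζ - ζ` of `M` for the associated metric. -/
def normal₂ (p : M) : TangentSpace 𝓘(ℝ, E) (f p) := A.φ (f p) (S.zeta p) - S.zeta p

/-- Minus the second fundamental form of `M` for the associated metric. -/
def assocForm (γ : M → ℝ) (p : M) (u w : TangentSpace 𝓘(ℝ, E) (f p)) :
    TangentSpace 𝓘(ℝ, E) (f p) :=
  S.shape γ p • (A.g (f p) u w • S.normal₁ p + A.g (f p) u (A.φ (f p) w) • S.normal₂ p)

theorem assocForm_comm (u w : TangentSpace 𝓘(ℝ, E) (f p)) :
    S.assocForm γ p u w = S.assocForm γ p w u := by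
  rw [assocForm, assocForm, A.g_symm _ u w, ← A.g_φ_left _ u w, A.g_symm _ (A.φ (f p) u) w]

theorem assocForm_add (u w w' : TangentSpace 𝓘(ℝ, E) (f p)) :
    S.assocForm γ p u (w + w') = S.assocForm γ p u w + S.assocForm γ p u w' := by
  simp only [assocForm, map_add]; module

theorem assocForm_smul (c : ℝ) (u w : TangentSpace 𝓘(ℝ, E) (f p)) :
    S.assocForm γ p u (c • w) = c • S.assocForm γ p u w := by
  simp only [assocForm, map_smul, smul_eq_mul]; module

theorem g_normal₁_zeta (hA : S.IsAscreen) (p : M) : A.g (f p) (S.normal₁ p) (S.zeta p) = 1 := by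
  rw [normal₁, A.g_sub_left, A.g_ξ_left, S.η_zeta hA, S.g_zeta_zeta, sub_zero]

theorem g_normal₂_zeta (hR : S.IsRSTHL) (p : M) : A.g (f p) (S.normal₂ p) (S.zeta p) = 0 := by
  rw [normal₂, A.g_sub_left, A.g_φ_left, S.g_zeta_φ_zeta hR, S.g_zeta_zeta, sub_zero]

theorem g_normal₁_φ_zeta (hR : S.IsRSTHL) (p : M) :
    A.g (f p) (S.normal₁ p) (A.φ (f p) (S.zeta p)) = 0 := by
  rw [normal₁, A.g_sub_left, A.g_ξ_left, A.η_φ, S.g_zeta_φ_zeta hR, sub_zero]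

theorem g_normal₂_φ_zeta (hR : S.IsRSTHL) (hA : S.IsAscreen) (p : M) :
    A.g (f p) (S.normal₂ p) (A.φ (f p) (S.zeta p)) = 1 := by
  rw [normal₂, A.g_sub_left, S.g_φ_zeta_φ_zeta hA, S.g_zeta_φ_zeta hR, sub_zero]

theorem assocMetric_assocForm_df (hR : S.IsRSTHL) (hA : S.IsAscreen)
    (u w : TangentSpace 𝓘(ℝ, E) (f p)) (v : TangentSpace 𝓘(ℝ, F) p) :
    A.assocMetric (f p) (S.assocForm γ p u w) (Df p v) = 0 := by
  have h1 : A.assocMetric (f p) (S.normal₁ p) (Df p v) = 0 := by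
    rw [AlmostContactBMetric.assocMetric, normal₁, A.g_sub_left, A.g_ξ_left, A.η_φ,
      S.g_zeta_φ_df hR, map_sub, A.η_ξ, S.η_zeta hA]
    ring
  have h2 : A.assocMetric (f p) (S.normal₂ p) (Df p v) = 0 := by
    rw [AlmostContactBMetric.assocMetric, normal₂, A.g_sub_left, A.g_φ_φ, S.g_zeta_df,
      S.g_zeta_φ_df hR, map_sub, A.η_φ, S.η_zeta hA]
    ring
  simp only [AlmostContactBMetric.assocMetric] at h1 h2 ⊢
  simp only [assocForm, A.g_smul_left, A.g_add_left, map_smul (A.η (f p)), map_add (A.η (f p)),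
    smul_eq_mul]
  linear_combination (S.shape γ p * A.g (f p) u w) * h1 +
    (S.shape γ p * A.g (f p) u (A.φ (f p) w)) * h2

/-- `∇̄_v (df Z) + h(v, Z)` is tangent to `M`. -/
theorem exists_df_eq_covAlong_add (hR : S.IsRSTHL) (hA : S.IsAscreen) (hF0 : A.IsF0 cov)
    (hcov : IsLeviCivita A.metric cov) (hγ : S.IsScreenTotallyUmbilical cov γ)
    {Z : Π q : M, TangentSpace 𝓘(ℝ, F) q} (hZ : MDiffAt (T% Z) p) (v : TangentSpace 𝓘(ℝ, F) p) :
    ∃ u, Df p u = covAlong cov f (fun q ↦ Df q (Z q)) p v +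
      S.assocForm γ p (Df p v) (Df p (Z p)) := by
  have hd := MDiffAlongAt.mfderiv S.contMDiff_f hZ
  have hz := S.mdiff_zeta hA p
  refine S.exists_df_eq hR hA p ?_ ?_
  · have h := hcov.mvfderiv_g hd hz v
    simp only [S.g_df_zeta, mvfderiv_const, zero_apply, S.covAlong_zeta hR hA hF0 hcov hγ] at h
    rw [S.df_P hA, A.g_smul_right, A.g_sub_right, A.g_smul_right, S.g_df_zeta,
      A.g_symm _ (Df p (Z p))] at h
    rw [A.g_add_left, assocForm, A.g_smul_left, A.g_add_left, A.g_smul_left, A.g_smul_left,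
      S.g_normal₁_zeta hA, S.g_normal₂_zeta hR]
    linarith
  · have h := hcov.mvfderiv_g hd (hz.φ (A := A)) v
    simp only [S.g_df_φ_zeta hR, mvfderiv_const, zero_apply, hF0.covAlong_φ hz,
      S.covAlong_zeta hR hA hF0 hcov hγ] at h
    rw [map_smul (A.φ (f p)), S.df_P hA, map_sub (A.φ (f p)), map_smul (A.φ (f p)),
      A.g_smul_right, A.g_sub_right, A.g_smul_right,
      S.g_df_φ_zeta hR, ← A.g_φ_left _ (Df p (Z p)), A.g_symm _ (A.φ (f p) (Df p (Z p)))] at h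
    rw [A.g_add_left, assocForm, A.g_smul_left, A.g_add_left, A.g_smul_left, A.g_smul_left,
      S.g_normal₁_φ_zeta hR, S.g_normal₂_φ_zeta hR hA]
    linarith

/-- The Gauss formula for the Levi-Civita connection of the induced associated metric. -/
theorem df_covM (hR : S.IsRSTHL) (hA : S.IsAscreen) (hF0 : A.IsF0 cov)
    (hcov : IsLeviCivita A.metric cov) (hγ : S.IsScreenTotallyUmbilical cov γ)
    (hcovM : IsLeviCivita (inducedForm f A.assocMetric) covM)
    {Z : Π q : M, TangentSpace 𝓘(ℝ, F) q} (hZ : MDiffAt (T% Z) p) (v : TangentSpace 𝓘(ℝ, F) p) :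
    Df p (covM Z p v) = covAlong cov f (fun q ↦ Df q (Z q)) p v +
      S.assocForm γ p (Df p v) (Df p (Z p)) := by
  have hx := mem_chart_source F p
  have hm := fun u ↦ mdiffAt_constField p hx u
  have hd := fun u ↦ MDiffAlongAt.mfderiv S.contMDiff_f (hm u)
  have hs : ∀ a b, A.assocMetric (f p) a b = A.assocMetric (f p) b a := fun a b ↦ by
    simp only [AlmostContactBMetric.assocMetric]
    rw [← A.g_φ_left, A.g_symm]; ring
  have hsub : ∀ a b c, A.assocMetric (f p) (a - b) c = A.assocMetric (f p) a c -
      A.assocMetric (f p) b c := fun a b c ↦ by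
    simp only [AlmostContactBMetric.assocMetric, A.g_sub_left, map_sub (A.η (f p))]; ring
  have hadd : ∀ a b c, A.assocMetric (f p) (a + b) c = A.assocMetric (f p) a c +
      A.assocMetric (f p) b c := fun a b c ↦ by
    simp only [AlmostContactBMetric.assocMetric, A.g_add_left, map_add (A.η (f p))]; ring
  let W : F → F → TangentSpace 𝓘(ℝ, E) (f p) := fun w u ↦
    covAlong cov f (fun q ↦ Df q (constField p u q)) p (constField p w p) +
      S.assocForm γ p (Df p (constField p w p)) (Df p (constField p u p))
  have hW : ∀ w u, W w u = covAlong cov f (fun q ↦ Df q (constField p u q)) p (constField p w p) +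
      S.assocForm γ p (Df p (constField p w p)) (Df p (constField p u p)) := fun _ _ ↦ rfl
  -- Uniqueness of the Levi-Civita connection again: the difference of the two sides is symmetric,
  -- and it is skew because the second fundamental form is `g̃`-normal.
  have key : ∀ w u t : F, A.assocMetric (f p)
      (Df p (covM (constField p u) p (constField p w p)) - W w u) (Df p (constField p t p)) = 0 := by
    refine eq_zero_of_symm_of_skew (fun w u t ↦ ?_) (fun w u t ↦ ?_)
    · have ht := hcov.covAlong_torsion S.contMDiff_f (hm w) (hm u)
      rw [mlieBracket_constField p hx, map_zero, sub_eq_zero] at ht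
      rw [hcovM.cov_constField_comm hx, hW, hW, ht, assocForm_comm]
    · have h1 := hcovM.metric p (constField p w p) _ _ (hm u) (hm t)
      have h2 := hF0.mvfderiv_assocMetric hcov (hd u) (hd t) (constField p w p)
      simp only [inducedForm] at h1
      rw [h2, hs (Df p (constField p u p)), hs (Df p (constField p u p))] at h1
      rw [hsub, hsub, hW, hW, hadd, hadd, S.assocMetric_assocForm_df hR hA,
        S.assocMetric_assocForm_df hR hA]
      linarith
  have base : ∀ (u : F) (v : TangentSpace 𝓘(ℝ, F) p), Df p (covM (constField p u) p v) =
      covAlong cov f (fun q ↦ Df q (constField p u q)) p v +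
        S.assocForm γ p (Df p v) (Df p (constField p u p)) := fun u v ↦ by
    -- `key` tests only against tangent vectors. It suffices because the right side is itself
    -- tangent and `g̃` is nondegenerate on `M`.
    obtain ⟨t, ht⟩ := S.exists_df_eq_covAlong_add hR hA hF0 hcov hγ (hm u) v
    rw [← ht]
    congr 1
    rw [← sub_eq_zero]
    refine S.eq_zero_of_assocMetric hR hA p fun w ↦ ?_
    have := key (coordVec p p v) u (coordVec p p w)
    rw [hW, constField_coordVec hx, constField_coordVec hx, ← ht, ← map_sub] at this
    exact this
  suffices h : MDiffAt (T% Z) p ∧ ∀ v, Df p (covM Z p v) =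
      covAlong cov f (fun q ↦ Df q (Z q)) p v + S.assocForm γ p (Df p v) (Df p (Z p)) from h.2 v
  refine MDiffAlongAt.induction (f := fun q : M ↦ q) (F := F) (p := p)
    (P := fun Z ↦ MDiffAt (T% Z) p ∧ ∀ v, Df p (covM Z p v) =
      covAlong cov f (fun q ↦ Df q (Z q)) p v + S.assocForm γ p (Df p v) (Df p (Z p)))
    ?_ ?_ ?_ hZ
  · rintro V V' h ⟨h1, h2⟩
    refine ⟨MDiffAlongAt.congr (f := fun q : M ↦ q) h1 h, fun v ↦ ?_⟩
    rw [← cov_congr covM h1 h, h2, h.self_of_nhds,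
      covAlong_congr cov (h.mono fun q hq ↦ by rw [hq])]
  · rintro V V' ⟨h1, h2⟩ ⟨k1, k2⟩
    refine ⟨MDiffAlongAt.add (f := fun q : M ↦ q) h1 k1, fun v ↦ ?_⟩
    simp only [map_add]
    rw [cov_add covM h1 k1, add_apply, map_add, h2, k2, covAlong_add cov
      (MDiffAlongAt.mfderiv S.contMDiff_f h1) (MDiffAlongAt.mfderiv S.contMDiff_f k1),
      assocForm_add]
    abel
  · intro h u hh
    refine ⟨MDiffAlongAt.smul (f := fun q : M ↦ q) hh (hm u), fun v ↦ ?_⟩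
    simp only [map_smul]
    rw [cov_smul covM hh (hm u), map_add, map_smul, map_smul, base, covAlong_smul cov hh (hd u),
      assocForm_smul]
    module

end HalfLightlike
end

noncomputable section
-- The curvature tensor of the associated metric
namespace HalfLightlike

set_option linter.unusedSectionVars false

variable {E : Type*} [NormedAddCommGroup E] [NormedSpace ℝ E] [FiniteDimensional ℝ E]
  {Q : Type*} [TopologicalSpace Q] [ChartedSpace E Q] [IsManifold 𝓘(ℝ, E) ∞ Q]
  {F : Type*} [NormedAddCommGroup F] [NormedSpace ℝ F] [FiniteDimensional ℝ F]
  {M : Type*} [TopologicalSpace M] [ChartedSpace F M] [IsManifold 𝓘(ℝ, F) ∞ M]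
  {A : AlmostContactBMetric E Q} {f : M → Q} (S : HalfLightlike F A f)
  {cov cov' : CovariantDerivative 𝓘(ℝ, E) E (TangentSpace 𝓘(ℝ, E) : Q → Type _)}
  {covM : CovariantDerivative 𝓘(ℝ, F) F (TangentSpace 𝓘(ℝ, F) : M → Type _)}
  {γ : M → ℝ} {p : M}

local notation "Df" => mfderiv 𝓘(ℝ, F) 𝓘(ℝ, E) f

/-- The Gauss formula controls `∇̃_Y Z` only through its image under `df`; injectivity of `df`
recovers differentiability on `M`, so that the formula can be applied again. -/
theorem mdiffAt_of_df (S : HalfLightlike F A f) {U : Π q : M, TangentSpace 𝓘(ℝ, F) q}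
    (hU : MDiffAlongAt F f (fun q ↦ Df q (U q)) p) : MDiffAt (T% U) p := by
  have hx := mem_chart_source F p
  have hy := mem_chart_source E (f p)
  refine (mdiffAt_iff_coordVec (b := fun q : M ↦ q) hx).2 ⟨mdifferentiableAt_id, ?_⟩
  let eM := trivializationAt F (TangentSpace 𝓘(ℝ, F) : M → Type _) p
  let eQ := trivializationAt E (TangentSpace 𝓘(ℝ, E) : Q → Type _) (f p)
  let B : M → F →L[ℝ] E := fun q ↦
    (eQ.continuousLinearMapAt ℝ (f q)).comp ((Df q).comp (eM.symmL ℝ q))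
  have hB : ∀ᶠ q in nhds p, ∀ u, B q u = coordVec (f p) (f q) (Df q (constField p u q)) := by
    filter_upwards [eventually_mem_chartAt_source (F := F) p,
      eventually_mem_source (S.mdiff_f p).continuousAt hy] with q h1 h2 u
    change eQ.continuousLinearMapAt ℝ (f q) (Df q (eM.symmL ℝ q u)) = _
    rw [Trivialization.continuousLinearMapAt_apply,
      Trivialization.coe_linearMapAt_of_mem _ (by simpa [eQ] using h2),
      eM.symmL_apply (R := ℝ) (by simpa [eM] using h1)]
    rfl
  refine mdifferentiableAt_of_clm_apply (A := B) ?_ ?_ ?_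
  · intro u
    refine ((MDiffAlongAt.mfderiv S.contMDiff_f (mdiffAt_constField p hx u)).coord
      hy).congr_of_eventuallyEq ?_
    filter_upwards [hB] with q hq using hq u
  · intro u v huv
    rw [hB.self_of_nhds, hB.self_of_nhds] at huv
    have h1 := S.mfderiv_injective p (coordVec_injective hy huv)
    rw [← coordVec_constField hx u, h1, coordVec_constField hx]
  · refine (hU.coord hy).congr_of_eventuallyEq ?_
    filter_upwards [hB, eventually_mem_chartAt_source (F := F) p] with q hq hq'
    rw [hq, constField_coordVec hq']

theorem mdiff_ξ (S : HalfLightlike F A f) (p : M) :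
    MDiffAlongAt F f (fun q ↦ A.ξ (f q)) p :=
  MDiffAlongAt.comp (S.mdiff_f p) (A.mdiffAt_ξ _)

theorem mdiff_normal₁ (hA : S.IsAscreen) (p : M) : MDiffAlongAt F f S.normal₁ p :=
  (S.mdiff_ξ p).sub (S.mdiff_zeta hA p)

theorem mdiff_normal₂ (hA : S.IsAscreen) (p : M) : MDiffAlongAt F f S.normal₂ p :=
  (S.mdiff_zeta hA p).φ.sub (S.mdiff_zeta hA p)

theorem covAlong_sub {V W : Π p : M, TangentSpace 𝓘(ℝ, E) (f p)} (hV : MDiffAlongAt F f V p)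
    (hW : MDiffAlongAt F f W p) (v : TangentSpace 𝓘(ℝ, F) p) :
    covAlong cov f (fun q ↦ V q - W q) p v = covAlong cov f V p v - covAlong cov f W p v := by
  have h1 := hW.smul (mdifferentiableAt_const (c := (-1 : ℝ)))
  have e : ∀ q, V q + (-1 : ℝ) • W q = V q - W q := fun q ↦ by module
  rw [← covAlong_congr cov (Filter.Eventually.of_forall e), covAlong_add cov hV h1,
    covAlong_smul cov mdifferentiableAt_const hW, mvfderiv_const, zero_apply]
  module

theorem covAlong_normal₁ (hR : S.IsRSTHL) (hA : S.IsAscreen) (hF0 : A.IsF0 cov)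
    (hcov : IsLeviCivita A.metric cov) (hγ : S.IsScreenTotallyUmbilical cov γ)
    (v : TangentSpace 𝓘(ℝ, F) p) :
    covAlong cov f S.normal₁ p v = -(S.shape γ p • Df p (S.P p v)) := by
  refine (covAlong_sub (S.mdiff_ξ p) (S.mdiff_zeta hA p) v).trans ?_
  rw [hF0.covAlong_ξ hcov (S.mdiff_f p), S.covAlong_zeta hR hA hF0 hcov hγ, zero_sub]

theorem covAlong_normal₂ (hR : S.IsRSTHL) (hA : S.IsAscreen) (hF0 : A.IsF0 cov)
    (hcov : IsLeviCivita A.metric cov) (hγ : S.IsScreenTotallyUmbilical cov γ)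
    (v : TangentSpace 𝓘(ℝ, F) p) :
    covAlong cov f S.normal₂ p v =
      S.shape γ p • (A.φ (f p) (Df p (S.P p v)) - Df p (S.P p v)) := by
  refine (covAlong_sub (S.mdiff_zeta hA p).φ (S.mdiff_zeta hA p) v).trans ?_
  rw [hF0.covAlong_φ (S.mdiff_zeta hA p), S.covAlong_zeta hR hA hF0 hcov hγ, map_smul, smul_sub]

theorem covAlong_assocForm (hR : S.IsRSTHL) (hA : S.IsAscreen) (hF0 : A.IsF0 cov)
    (hcov : IsLeviCivita A.metric cov) (hγ : S.IsScreenTotallyUmbilical cov γ)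
    {V W : Π p : M, TangentSpace 𝓘(ℝ, E) (f p)} (hV : MDiffAlongAt F f V p)
    (hW : MDiffAlongAt F f W p) (v : TangentSpace 𝓘(ℝ, F) p) :
    MDiffAlongAt F f (fun q ↦ S.assocForm γ q (V q) (W q)) p ∧
    covAlong cov f (fun q ↦ S.assocForm γ q (V q) (W q)) p v =
      S.assocForm γ p (covAlong cov f V p v) (W p) +
      S.assocForm γ p (V p) (covAlong cov f W p v) +
      mvfderiv 𝓘(ℝ, F) (S.shape γ) p v •
        (A.g (f p) (V p) (W p) • S.normal₁ p + A.g (f p) (V p) (A.φ (f p) (W p)) • S.normal₂ p) +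
      S.shape γ p ^ 2 • (A.g (f p) (V p) (A.φ (f p) (W p)) •
        (A.φ (f p) (Df p (S.P p v)) - Df p (S.P p v)) -
        A.g (f p) (V p) (W p) • Df p (S.P p v)) := by
  have ha := (S.c2_shape hγ p).mdifferentiableAt (by simp)
  have hφW := hW.φ (A := A)
  have hg := hV.g (A := A) hW
  have hk := hV.g (A := A) hφW
  have h1 := (S.mdiff_normal₁ hA p).smul hg
  have h2 := (S.mdiff_normal₂ hA p).smul hk
  have h3 := (h1.add h2).smul ha
  refine ⟨h3, (covAlong_smul cov ha (h1.add h2) v).trans ?_⟩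
  rw [covAlong_add cov h1 h2, covAlong_smul cov hg (S.mdiff_normal₁ hA p),
    covAlong_smul cov hk (S.mdiff_normal₂ hA p), S.covAlong_normal₁ hR hA hF0 hcov hγ,
    S.covAlong_normal₂ hR hA hF0 hcov hγ, hcov.mvfderiv_g hV hW, hcov.mvfderiv_g hV hφW,
    hF0.covAlong_φ hW, assocForm, assocForm]
  module

/-- Against tangent vectors `ξ̄ - ζ` pairs to `η̄` under `g` and to zero under `g(·, φ̄·)`; `φ̄ζ -
ζ` does the opposite. The form therefore reproduces the same normal combination, scaled by `a η̄`.
-/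
theorem assocForm_df_assocForm (hR : S.IsRSTHL) (hA : S.IsAscreen) (v : TangentSpace 𝓘(ℝ, F) p)
    (u w : TangentSpace 𝓘(ℝ, E) (f p)) :
    S.assocForm γ p (Df p v) (S.assocForm γ p u w) =
      (S.shape γ p ^ 2 * A.η (f p) (Df p v)) •
        (A.g (f p) u w • S.normal₁ p + A.g (f p) u (A.φ (f p) w) • S.normal₂ p) := by
  have h1 : A.g (f p) (Df p v) (S.normal₁ p) = A.η (f p) (Df p v) := by
    rw [normal₁, A.g_sub_right, A.g_ξ_right, S.g_df_zeta, sub_zero]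
  have h2 : A.g (f p) (Df p v) (S.normal₂ p) = 0 := by
    rw [normal₂, A.g_sub_right, S.g_df_φ_zeta hR, S.g_df_zeta, sub_zero]
  have h3 : A.g (f p) (Df p v) (A.φ (f p) (S.normal₁ p)) = 0 := by
    rw [normal₁, map_sub, A.φ_ξ, zero_sub, A.g_neg_right, S.g_df_φ_zeta hR, neg_zero]
  have h4 : A.g (f p) (Df p v) (A.φ (f p) (S.normal₂ p)) = A.η (f p) (Df p v) := by
    rw [normal₂, map_sub, A.φ_φ, S.η_zeta hA, A.g_sub_right, A.g_add_right, A.g_neg_right,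
      A.g_smul_right, A.g_ξ_right, S.g_df_zeta, S.g_df_φ_zeta hR]
    ring
  rw [assocForm, assocForm, map_smul (A.φ (f p)), map_add (A.φ (f p)), map_smul (A.φ (f p)),
    map_smul (A.φ (f p))]
  simp only [A.g_smul_right, A.g_add_right, h1, h2, h3, h4]
  module

variable {ν ν' : Q → ℝ}

/-- The curvature tensor of the induced associated metric. -/
theorem df_curvature (hR : S.IsRSTHL) (hA : S.IsAscreen) (hF0 : A.IsF0 cov)
    (hcov : IsLeviCivita A.metric cov) (hcov' : IsLeviCivita A.assocMetric cov')
    (hγ : S.IsScreenTotallyUmbilical cov γ) (hν : A.HasConstTotallyRealCurvatures cov cov' ν ν')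
    (hF : 1 < Module.finrank ℝ F) (hcovM : IsLeviCivita (inducedForm f A.assocMetric) covM)
    {X Y Z : Π q : M, TangentSpace 𝓘(ℝ, F) q} (hX : SmoothFieldAt X p) (hY : SmoothFieldAt Y p)
    (hZ : SmoothFieldAt Z p) :
    Df p (curvature covM X Y Z p) =
      ((ν (f p) - S.shape γ p ^ 2) * A.g (f p) (Df p (Y p)) (Df p (Z p)) -
        S.shape γ p ^ 2 * A.g (f p) (Df p (Y p)) (A.φ (f p) (Df p (Z p))) -
        ν (f p) * A.η (f p) (Df p (Y p)) * A.η (f p) (Df p (Z p))) • Df p (S.P p (X p)) -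
      ((ν (f p) - S.shape γ p ^ 2) * A.g (f p) (Df p (X p)) (Df p (Z p)) -
        S.shape γ p ^ 2 * A.g (f p) (Df p (X p)) (A.φ (f p) (Df p (Z p))) -
        ν (f p) * A.η (f p) (Df p (X p)) * A.η (f p) (Df p (Z p))) • Df p (S.P p (Y p)) -
      ((ν (f p) - S.shape γ p ^ 2) * A.g (f p) (Df p (Y p)) (A.φ (f p) (Df p (Z p)))) •
        A.φ (f p) (Df p (S.P p (X p))) +
      ((ν (f p) - S.shape γ p ^ 2) * A.g (f p) (Df p (X p)) (A.φ (f p) (Df p (Z p)))) •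
        A.φ (f p) (Df p (S.P p (Y p))) +
      (ν (f p) * (A.g (f p) (Df p (X p)) (A.φ (f p) (Df p (Z p))) * A.η (f p) (Df p (Y p)) -
        A.g (f p) (Df p (Y p)) (A.φ (f p) (Df p (Z p))) * A.η (f p) (Df p (X p)))) • S.zeta p := by
  have hXm := hX.mdifferentiableAt (n := ∞) (by simp)
  have hYm := hY.mdifferentiableAt (n := ∞) (by simp)
  have hZm := hZ.mdifferentiableAt (n := ∞) (by simp)
  have hdX := MDiffAlongAt.mfderiv S.contMDiff_f hXm
  have hdY := MDiffAlongAt.mfderiv S.contMDiff_f hYm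
  have hdZ := MDiffAlongAt.mfderiv S.contMDiff_f hZm
  have hZe : ∀ᶠ q in nhds p, MDiffAt (T% Z) q := by
    have h2 : C2AlongAt F (fun q : M ↦ q) Z p := ContMDiffAt.of_le hZ (by norm_cast)
    filter_upwards [h2.eventually] with q hq using hq.mdiff
  obtain ⟨hDX, hDY, hR4⟩ := hcov.covAlong_curvature hcov.isDifferentiableCov S.contMDiff_f hXm hYm
    (C2AlongAt.mfderiv S.contMDiff_f hZ)
  have ht := hcov.covAlong_torsion S.contMDiff_f hXm hYm
  have step : ∀ V : Π q : M, TangentSpace 𝓘(ℝ, F) q, MDiffAlongAt F f (fun q ↦ Df q (V q)) p →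
      MDiffAlongAt F f (fun q ↦ covAlong cov f (fun q ↦ Df q (Z q)) q (V q)) p →
      ∀ v, Df p (covM (fun q ↦ covM Z q (V q)) p v) =
        covAlong cov f (fun q ↦ covAlong cov f (fun q ↦ Df q (Z q)) q (V q)) p v +
        covAlong cov f (fun q ↦ S.assocForm γ q (Df q (V q)) (Df q (Z q))) p v +
        S.assocForm γ p (Df p v) (covAlong cov f (fun q ↦ Df q (Z q)) p (V p)) +
        S.assocForm γ p (Df p v) (S.assocForm γ p (Df p (V p)) (Df p (Z p))) := by
    intro V hV hDV v
    have e : ∀ᶠ q in nhds p, covAlong cov f (fun q ↦ Df q (Z q)) q (V q) +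
        S.assocForm γ q (Df q (V q)) (Df q (Z q)) = Df q (covM Z q (V q)) := by
      filter_upwards [hZe] with q hq
      rw [S.df_covM hR hA hF0 hcov hγ hcovM hq]
    have ha := S.covAlong_assocForm hR hA hF0 hcov hγ hV hdZ v
    have hm := S.mdiffAt_of_df ((hDV.add ha.1).congr e)
    rw [S.df_covM hR hA hF0 hcov hγ hcovM hm, ← covAlong_congr cov e, covAlong_add cov hDV ha.1,
      ← e.self_of_nhds, assocForm_add]
    abel
  obtain ⟨hν0, hda⟩ := S.assoc_curvature_eq_zero_and_mvfderiv_shape hR hA hF0 hcov hcov' hγ hν hF p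
  have hb := S.df_covM hR hA hF0 hcov hγ hcovM hZm (VectorField.mlieBracket 𝓘(ℝ, F) X Y p)
  rw [hν.curvatureAt_eq hF0 hcov hcov', hν0, zero_smul, sub_zero] at hR4
  rw [curvature, map_sub, map_sub, step Y hdY hDY, step X hdX hDX, hb, ← ht,
    (S.covAlong_assocForm hR hA hF0 hcov hγ hdY hdZ (X p)).2,
    (S.covAlong_assocForm hR hA hF0 hcov hγ hdX hdZ (Y p)).2,
    -- With `da = (ν̄ - a²) η̄` the normal terms from differentiating the form and from iterating it
    -- add up to `ν̄ η̄`, cancelling the normal part of the ambient curvature.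
    S.assocForm_df_assocForm hR hA, S.assocForm_df_assocForm hR hA, hda, hda]
  rw [sub_sub, sub_eq_iff_eq_add] at hR4
  rw [hR4]
  have hsub : ∀ u u' w, S.assocForm γ p (u - u') w =
      S.assocForm γ p u w - S.assocForm γ p u' w := fun u u' w ↦ by
    simp only [assocForm, A.g_sub_left]; module
  -- Splitting off `ζ` in the model tensor yields `φ̄ζ = (φ̄ζ - ζ) + ζ`; the surviving `ζ` is the
  -- radical component of the result.
  have hPX : Df p (X p) = Df p (S.P p (X p)) + A.η (f p) (Df p (X p)) • S.zeta p := by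
    rw [S.df_P hA]; abel
  have hPY : Df p (Y p) = Df p (S.P p (Y p)) + A.η (f p) (Df p (Y p)) • S.zeta p := by
    rw [S.df_P hA]; abel
  have hφX := congrArg (A.φ (f p)) hPX
  have hφY := congrArg (A.φ (f p)) hPY
  rw [map_add, map_smul] at hφX hφY
  have hm : A.modelCurvature (f p) (Df p (X p)) (Df p (Y p)) (Df p (Z p)) =
    (A.g (f p) (Df p (Y p)) (Df p (Z p)) - A.η (f p) (Df p (Y p)) * A.η (f p) (Df p (Z p))) •
      (Df p (S.P p (X p)) + A.η (f p) (Df p (X p)) • S.zeta p -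
        A.η (f p) (Df p (X p)) • A.ξ (f p)) -
    (A.g (f p) (Df p (X p)) (Df p (Z p)) - A.η (f p) (Df p (X p)) * A.η (f p) (Df p (Z p))) •
      (Df p (S.P p (Y p)) + A.η (f p) (Df p (Y p)) • S.zeta p -
        A.η (f p) (Df p (Y p)) • A.ξ (f p)) -
    A.g (f p) (Df p (Y p)) (A.φ (f p) (Df p (Z p))) • (A.φ (f p) (Df p (S.P p (X p))) +
      A.η (f p) (Df p (X p)) • A.φ (f p) (S.zeta p)) +
    A.g (f p) (Df p (X p)) (A.φ (f p) (Df p (Z p))) • (A.φ (f p) (Df p (S.P p (Y p))) +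
      A.η (f p) (Df p (Y p)) • A.φ (f p) (S.zeta p)) := by
    rw [← hφX, ← hφY, ← hPX, ← hPY]; rfl
  rw [hm, hsub, normal₁, normal₂]
  module

end HalfLightlike
end

noncomputable section

/-! ### Traces and the Ricci tensor -/

namespace LinearMap

variable {V : Type*} [AddCommGroup V] [Module ℝ V] {ι : Type*} [Fintype ι]

theorem sum_coord_smul_eq (b : Module.Basis ι ℝ V) (l : V →ₗ[ℝ] ℝ) (u : V) :
    ∑ i, b.coord i (l (b i) • u) = l u := by
  conv_rhs => rw [← b.sum_repr u, map_sum]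
  refine Finset.sum_congr rfl fun i _ ↦ ?_
  rw [map_smul, map_smul, smul_eq_mul, smul_eq_mul, mul_comm]; rfl

/-- A real endomorphism `T` with `T ^ 3 = -T` has purely imaginary eigenvalues, hence trace
zero. -/
theorem sum_coord_eq_zero_of_cube_eq_neg (b : Module.Basis ι ℝ V) (T : V →ₗ[ℝ] V)
    (hT : ∀ v, T (T (T v)) = -T v) : ∑ i, b.coord i (T (b i)) = 0 := by
  classical
  set B : Matrix ι ι ℝ := LinearMap.toMatrix b b T with hB
  have hB3 : B * (B * B) = -B := by
    rw [hB, ← LinearMap.toMatrix_mul, ← LinearMap.toMatrix_mul, ← map_neg]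
    exact congrArg _ (LinearMap.ext hT)
  set D : Matrix ι ι ℂ := B.map Complex.ofRealHom with hD
  have hD3 : D * (D * D) = -D := by
    rw [hD, ← Matrix.map_mul, ← Matrix.map_mul, hB3, Matrix.map_neg _ (by simp)]
  -- A complex eigenvalue satisfies `z³ = -z`, so it is `0` or `±i`; the trace is the sum of these
  -- roots and is also real.
  have hroot : ∀ z ∈ D.charpoly.roots, z.re = 0 := by
    intro z hz
    have h1 : Module.End.HasEigenvalue (Matrix.toLin' D) z := by
      rw [Module.End.hasEigenvalue_iff_isRoot_charpoly, Matrix.charpoly_toLin']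
      exact Polynomial.isRoot_of_mem_roots hz
    obtain ⟨v, hv⟩ := h1.exists_hasEigenvector
    have h2 := hv.apply_eq_smul
    have h3 : z * (z * z) = -z := by
      have h4 := congrArg (fun K ↦ Matrix.toLin' K v) hD3
      simp only [Matrix.toLin'_mul, LinearMap.comp_apply, h2, map_smul, map_neg,
        LinearMap.neg_apply, smul_smul, ← neg_smul] at h4
      have h5 := smul_left_injective ℂ hv.2 h4
      rw [← h5]; ring
    by_cases hz0 : z = 0
    · simp [hz0]
    have h6 : z * z = -1 := by
      apply mul_left_cancel₀ hz0; rw [h3]; ring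
    have h7 := congrArg Complex.re h6
    have h8 := congrArg Complex.im h6
    simp only [Complex.mul_re, Complex.mul_im, Complex.neg_re, Complex.neg_im, Complex.one_re,
      Complex.one_im] at h7 h8
    have h9 : z.re * z.im = 0 := by linarith
    rcases mul_eq_zero.1 h9 with h | h
    · exact h
    · rw [h] at h7; nlinarith [mul_self_nonneg z.re]
  have htr : D.trace.re = 0 := by
    rw [Matrix.trace_eq_sum_roots_charpoly, ← Complex.coe_reAddGroupHom,
      map_multiset_sum]
    refine Multiset.sum_eq_zero fun x hx ↦ ?_
    obtain ⟨z, hz, rfl⟩ := Multiset.mem_map.1 hx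
    exact hroot z hz
  have h : D.trace = (B.trace : ℂ) := by
    simp [hD, Matrix.trace, Matrix.diag]
  rw [h, Complex.ofReal_re] at htr
  rw [← htr, hB]
  simp [Matrix.trace, LinearMap.toMatrix_apply]

end LinearMap
namespace HalfLightlike

set_option linter.unusedSectionVars false

variable {E : Type*} [NormedAddCommGroup E] [NormedSpace ℝ E] [FiniteDimensional ℝ E]
  {Q : Type*} [TopologicalSpace Q] [ChartedSpace E Q] [IsManifold 𝓘(ℝ, E) ∞ Q]
  {F : Type*} [NormedAddCommGroup F] [NormedSpace ℝ F] [FiniteDimensional ℝ F]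
  {M : Type*} [TopologicalSpace M] [ChartedSpace F M] [IsManifold 𝓘(ℝ, F) ∞ M]
  {A : AlmostContactBMetric E Q} {f : M → Q} (S : HalfLightlike F A f)
  {cov cov' : CovariantDerivative 𝓘(ℝ, E) E (TangentSpace 𝓘(ℝ, E) : Q → Type _)}
  {covM : CovariantDerivative 𝓘(ℝ, F) F (TangentSpace 𝓘(ℝ, F) : M → Type _)}
  {γ : M → ℝ} {p : M}

local notation "Df" => mfderiv 𝓘(ℝ, F) 𝓘(ℝ, E) f

/-- The structure endomorphism `φ̄ ∘ P` of a radical screen transversal ascreen submanifold. -/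
theorem exists_linearMap_df_eq_φ_df_P (hR : S.IsRSTHL) (hA : S.IsAscreen) (p : M) :
    ∃ T : TangentSpace 𝓘(ℝ, F) p →ₗ[ℝ] TangentSpace 𝓘(ℝ, F) p,
      ∀ v, Df p (T v) = A.φ (f p) (Df p (S.P p v)) := by
  choose T hT using S.exists_df_eq_φ_df_P hR hA p
  refine ⟨⟨⟨T, fun v w ↦ S.mfderiv_injective p ?_⟩, fun c v ↦ S.mfderiv_injective p ?_⟩, hT⟩
  · rw [map_add (Df p), hT, hT, hT, ← map_add (A.φ (f p))]
    congr 1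
    simp only [S.df_P hA, map_add (Df p), map_add (A.η (f p))]
    module
  · rw [map_smul (Df p), hT, hT, RingHom.id_apply, ← map_smul (A.φ (f p))]
    congr 1
    simp only [S.df_P hA, map_smul (Df p), map_smul (A.η (f p)), smul_eq_mul]
    module

theorem df_of_df_eq_φ_df_P (hA : S.IsAscreen)
    {T : TangentSpace 𝓘(ℝ, F) p → TangentSpace 𝓘(ℝ, F) p}
    (hT : ∀ v, Df p (T v) = A.φ (f p) (Df p (S.P p v))) (v : TangentSpace 𝓘(ℝ, F) p) :
    Df p (T (T v)) = -Df p (S.P p v) := by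
  have h : Df p (S.P p (T v)) = Df p (T v) := by
    rw [S.df_P hA, hT, A.η_φ, zero_smul, sub_zero]
  rw [hT, h, hT, A.φ_φ, S.η_df_P hA, zero_smul, add_zero]

variable {ν ν' : Q → ℝ}

/-- The Ricci tensor of the induced associated metric. -/
theorem ricci_eq (hR : S.IsRSTHL) (hA : S.IsAscreen) (hF0 : A.IsF0 cov)
    (hcov : IsLeviCivita A.metric cov) (hcov' : IsLeviCivita A.assocMetric cov')
    (hγ : S.IsScreenTotallyUmbilical cov γ) (hν : A.HasConstTotallyRealCurvatures cov cov' ν ν')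
    (hF : 1 < Module.finrank ℝ F) (hcovM : IsLeviCivita (inducedForm f A.assocMetric) covM)
    (y z : TangentSpace 𝓘(ℝ, F) p) :
    ricci covM p y z =
      ((Module.finrank ℝ F : ℝ) - 3) * (ν (f p) - S.shape γ p ^ 2) *
          A.g (f p) (Df p y) (Df p z) -
        (ν (f p) + ((Module.finrank ℝ F : ℝ) - 2) * S.shape γ p ^ 2) *
          A.g (f p) (Df p y) (A.φ (f p) (Df p z)) -
        ((Module.finrank ℝ F : ℝ) - 1) * ν (f p) * A.η (f p) (Df p y) * A.η (f p) (Df p z) := by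
  obtain ⟨T, hT⟩ := S.exists_linearMap_df_eq_φ_df_P hR hA p
  let b : Module.Basis (Fin (Module.finrank ℝ F)) ℝ (TangentSpace 𝓘(ℝ, F) p) :=
    Module.finBasis ℝ F
  let ηL : TangentSpace 𝓘(ℝ, F) p →ₗ[ℝ] ℝ := ((A.η (f p)).comp (Df p)).toLinearMap
  let gL : TangentSpace 𝓘(ℝ, F) p →ₗ[ℝ] ℝ := ((A.g (f p) (Df p z)).comp (Df p)).toLinearMap
  let kL : TangentSpace 𝓘(ℝ, F) p →ₗ[ℝ] ℝ :=
    ((A.g (f p) (A.φ (f p) (Df p z))).comp (Df p)).toLinearMap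
  let cL : TangentSpace 𝓘(ℝ, F) p →ₗ[ℝ] ℝ :=
    (ν (f p) - S.shape γ p ^ 2) • gL - S.shape γ p ^ 2 • kL - (ν (f p) * ηL z) • ηL
  have hη : ∀ v, A.η (f p) (Df p v) = ηL v := fun v ↦ rfl
  have hg : ∀ v, A.g (f p) (Df p v) (Df p z) = gL v := fun v ↦ A.g_symm _ _ _
  have hk : ∀ v, A.g (f p) (Df p v) (A.φ (f p) (Df p z)) = kL v := fun v ↦ A.g_symm _ _ _
  have hc : ∀ v, cL v = (ν (f p) - S.shape γ p ^ 2) * gL v - S.shape γ p ^ 2 * kL v -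
    ν (f p) * ηL z * ηL v := fun v ↦ rfl
  have hx := mem_chart_source F p
  -- As a function of `x` the curvature is a multiple of the identity, a multiple of `T = φ̄P`, and
  -- rank one maps `l(x) u` of trace `l(u)`; `Px` is written as `x - η̄(x) ζ` for this.
  have hcurv : ∀ x, curvatureAt covM p x y z =
      cL y • x - (cL y * ηL x) • S.radicalSection p - cL x • S.P p y -
        ((ν (f p) - S.shape γ p ^ 2) * kL y) • T x +
        (((ν (f p) - S.shape γ p ^ 2) • kL) x) • T y +
        ((ν (f p) • (ηL y • kL - kL y • ηL)) x) • S.radicalSection p := by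
    intro x
    apply S.mfderiv_injective p
    rw [curvatureAt, extend_eq_constField, extend_eq_constField, extend_eq_constField,
      S.df_curvature hR hA hF0 hcov hcov' hγ hν hF hcovM (smoothFieldAt_constField p hx _)
        (smoothFieldAt_constField p hx _) (smoothFieldAt_constField p hx _),
      constField_coordVec hx, constField_coordVec hx, constField_coordVec hx]
    simp only [map_add (Df p), map_sub (Df p), map_smul (Df p), hT, S.df_radicalSection,
      LinearMap.smul_apply, LinearMap.sub_apply, smul_eq_mul, hc, hη, hg, hk]
    rw [S.df_P hA p x, hη]
    module
  have hcoord : ricci covM p y z = ∑ i, b.coord i (curvatureAt covM p (b i) y z) := rfl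
  have hone : ∑ i, b.coord i (b i) = (Module.finrank ℝ F : ℝ) := by simp
  have htr : ∑ i, b.coord i (T (b i)) = 0 := by
    refine LinearMap.sum_coord_eq_zero_of_cube_eq_neg b T fun v ↦ S.mfderiv_injective p ?_
    rw [S.df_of_df_eq_φ_df_P hA hT, map_neg, S.df_P hA, hT, A.η_φ, zero_smul, sub_zero]
  -- The rank one term in `Ty` feeds back into the coefficient of `g(y, z)`, which is why that
  -- coefficient is `dim M - 3`.
  have hkT : kL (T y) = -gL y := by
    rw [← hk, hT, ← A.g_φ_left, A.φ_φ, S.η_df_P hA, zero_smul, add_zero, A.g_neg_left, S.df_P hA,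
      A.g_sub_left, A.g_smul_left, S.g_zeta_df, mul_zero, sub_zero, hg]
  have hcP : cL (S.P p y) =
      (ν (f p) - S.shape γ p ^ 2) * gL y - S.shape γ p ^ 2 * kL y := by
    rw [hc, ← hg, ← hk, ← hη (S.P p y), S.η_df_P hA, S.df_P hA, A.g_sub_left, A.g_sub_left,
      A.g_smul_left, A.g_smul_left, S.g_zeta_df, S.g_zeta_φ_df hR, hg, hk]
    ring
  have hηζ : ηL (S.radicalSection p) = 1 := by rw [← hη, S.df_radicalSection, S.η_zeta hA]
  have hkζ : kL (S.radicalSection p) = 0 := by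
    rw [← hk, S.df_radicalSection, S.g_zeta_φ_df hR]
  have e1 := LinearMap.sum_coord_smul_eq b (cL y • ηL) (S.radicalSection p)
  have e2 := LinearMap.sum_coord_smul_eq b cL (S.P p y)
  have e3 := LinearMap.sum_coord_smul_eq b ((ν (f p) - S.shape γ p ^ 2) • kL) (T y)
  have e4 := LinearMap.sum_coord_smul_eq b (ν (f p) • (ηL y • kL - kL y • ηL))
    (S.radicalSection p)
  have e5 : ∑ i, b.coord i (cL y • b i) = cL y * Module.finrank ℝ F := by
    rw [← hone, Finset.mul_sum]
    exact Finset.sum_congr rfl fun i _ ↦ by rw [map_smul, smul_eq_mul]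
  have e6 : ∑ i, b.coord i (((ν (f p) - S.shape γ p ^ 2) * kL y) • T (b i)) = 0 := by
    simp only [map_smul, ← Finset.smul_sum, htr, smul_zero]
  rw [hcoord]
  simp only [hcurv, map_add, map_sub, Finset.sum_add_distrib, Finset.sum_sub_distrib]
  simp only [LinearMap.smul_apply, LinearMap.sub_apply, smul_eq_mul] at e1 e3 e4 ⊢
  rw [e1, e2, e3, e4, e5, e6, hηζ, hkζ, hkT, hcP, hg, hk, hη, hη, hc]
  ring

end HalfLightlike
end
theorem proposition4p5
    {E : Type*} [NormedAddCommGroup E] [NormedSpace ℝ E] [FiniteDimensional ℝ E]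
    {F : Type*} [NormedAddCommGroup F] [NormedSpace ℝ F] [FiniteDimensional ℝ F]
    {Q : Type*} [TopologicalSpace Q] [T2Space Q] [SecondCountableTopology Q]
    [ChartedSpace E Q] [IsManifold 𝓘(ℝ, E) ∞ Q]
    {M : Type*} [TopologicalSpace M] [T2Space M] [SecondCountableTopology M]
    [ChartedSpace F M] [IsManifold 𝓘(ℝ, F) ∞ M]
    (n : ℕ) (hn : 2 ≤ n) (hdim : Module.finrank ℝ E = 2 * n + 1)
    (A : AlmostContactBMetric E Q)
    (cov cov' : CovariantDerivative 𝓘(ℝ, E) E (TangentSpace 𝓘(ℝ, E) : Q → Type _))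
    (hcov : IsLeviCivita A.metric cov) (hcov' : IsLeviCivita A.assocMetric cov')
    (hF0 : A.IsF0 cov)
    (ν ν' : Q → ℝ) (hν : A.HasConstTotallyRealCurvatures cov cov' ν ν')
    (f : M → Q) (S : HalfLightlike F A f) (hRST : S.IsRSTHL) (hAscreen : S.IsAscreen)
    (γ : M → ℝ) (hγ : S.IsScreenTotallyUmbilical cov γ)
    (covM : CovariantDerivative 𝓘(ℝ, F) F (TangentSpace 𝓘(ℝ, F) : M → Type _))
    (hcovM : IsLeviCivita (inducedForm f A.assocMetric) covM) :
    -- `df p` is the differential of the immersion, `ηA` is the restriction of `η̄` to `M`,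
    -- `g p v w = g(v, w)` is the induced metric, and `gφ p v w = g(v, φ̄ w)`
    let df := fun p ↦ mfderiv 𝓘(ℝ, F) 𝓘(ℝ, E) f p
    let ηA : Π p : M, TangentSpace 𝓘(ℝ, F) p → ℝ := fun p v ↦ A.η (f p) (df p v)
    let g : Π p : M, TangentSpace 𝓘(ℝ, F) p → TangentSpace 𝓘(ℝ, F) p → ℝ :=
      inducedForm f A.metric
    let gφ : Π p : M, TangentSpace 𝓘(ℝ, F) p → TangentSpace 𝓘(ℝ, F) p → ℝ :=
      fun p v w ↦ A.g (f p) (df p v) (A.φ (f p) (df p w))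
    (∀ (p : M) (X Y Z : Π q : M, TangentSpace 𝓘(ℝ, F) q),
      SmoothFieldAt X p → SmoothFieldAt Y p → SmoothFieldAt Z p →
      df p (curvature covM X Y Z p) =
        ((ν (f p) - 4 * S.μ p ^ 2 * γ p ^ 2) * g p (Y p) (Z p)
            - 4 * S.μ p ^ 2 * γ p ^ 2 * gφ p (Y p) (Z p)
            - ν (f p) * ηA p (Y p) * ηA p (Z p)) • df p (S.P p (X p))
        - ((ν (f p) - 4 * S.μ p ^ 2 * γ p ^ 2) * g p (X p) (Z p)
            - 4 * S.μ p ^ 2 * γ p ^ 2 * gφ p (X p) (Z p)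
            - ν (f p) * ηA p (X p) * ηA p (Z p)) • df p (S.P p (Y p))
        - ((ν (f p) - 4 * S.μ p ^ 2 * γ p ^ 2) * gφ p (Y p) (Z p)) •
            A.φ (f p) (df p (S.P p (X p)))
        + ((ν (f p) - 4 * S.μ p ^ 2 * γ p ^ 2) * gφ p (X p) (Z p)) •
            A.φ (f p) (df p (S.P p (Y p)))
        + (ν (f p) * (gφ p (X p) (Z p) * S.η p (Y p) - gφ p (Y p) (Z p) * S.η p (X p))) •
            df p (S.ξ p)) ∧
    (∀ (p : M) (y z : TangentSpace 𝓘(ℝ, F) p),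
      ricci covM p y z =
        2 * ((n : ℝ) - 2) * (ν (f p) - 4 * S.μ p ^ 2 * γ p ^ 2) * g p y z
        - (ν (f p) + 4 * (2 * (n : ℝ) - 3) * S.μ p ^ 2 * γ p ^ 2) * gφ p y z
        - 2 * ((n : ℝ) - 1) * ν (f p) * ηA p y * ηA p z) := by
  have hF := S.codim_two
  have hFn : (Module.finrank ℝ F : ℝ) = 2 * n - 1 := by
    -- Codimension two in dimension `2n + 1` gives `dim M = 2n - 1`, at least `3`, so the screen is
    -- nonzero.
    have h : Module.finrank ℝ F + 1 = 2 * n := by omega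
    rw [eq_sub_iff_add_eq]
    exact_mod_cast h
  have hs : ∀ p, S.shape γ p ^ 2 = 4 * S.μ p ^ 2 * γ p ^ 2 := fun p ↦ by
    rw [HalfLightlike.shape]; ring
  refine ⟨fun p X Y Z hX hY hZ ↦ ?_, fun p y z ↦ ?_⟩
  · have h := S.df_curvature hRST hAscreen hF0 hcov hcov' hγ hν (by omega) hcovM hX hY hZ
    rw [hs] at h
    refine h.trans (congrArg _ ?_)
    have hX' := S.η_smul_df_ξ hAscreen p (X p)
    have hY' := S.η_smul_df_ξ hAscreen p (Y p)
    simp only [mul_sub, sub_smul, mul_smul, hX', hY']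
  · have h := S.ricci_eq hRST hAscreen hF0 hcov hcov' hγ hν (by omega) hcovM y z
    rw [hs, hFn] at h
    refine h.trans ?_
    change _ = 2 * ((n : ℝ) - 2) * (ν (f p) - 4 * S.μ p ^ 2 * γ p ^ 2) *
        A.g (f p) (mfderiv 𝓘(ℝ, F) 𝓘(ℝ, E) f p y) (mfderiv 𝓘(ℝ, F) 𝓘(ℝ, E) f p z) - _ - _
    ring
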